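/- Let $\mathbb{R}_+=(0,\infty)$, let $\alpha=(\alpha_1,\dots,\alpha_n)$ have positive entries, put $|\alpha|=\sum_{i=1}^n\alpha_i$ and $s(x)=\sum_{i=1}^n x_i$, and let $g\colon\mathbb{R}_+\to\mathbb{R}_+$ be a positive measurable function. Let $\mu$ be the multivariate Liouville distribution on $\mathbb{R}_+^n$ with parameters $\alpha$ and $g$, that is, a probability measure with Lebesgue density $$\rho(x)=Z^{-1}\prod_{i=1}^n x_i^{\alpha_i-1}\,g\Big(\sum_{i=1}^n x_i\Big),\qquad x\in\mathbb{R}_+^n,$$ for some normalizing constant $Z>0$. For a field $W$ of symmetric positive definite matrices on $\mathbb{R}_+^n$ and a finite constant $C>0$, say that $\mu$ satisfies the weighted Poincaré inequality with weight $W$ and constant $C$ if $$\operatorname{Var}_\mu(f):=\int f^2\,d\mu-\Big(\int f\,d\mu\Big)^2\le C\int_{\mathbb{R}_+^n}\langle W\nabla f,\nabla f\rangle\,d\mu$$ for every $f\in L^2(\mu)$ with weak gradient $\nabla f$ on $\mathbb{R}_+^n$ for which the right-hand side is finite. Suppose that $g$ is log-concave, that is, $g=e^{-V_g}$ with $V_g\colon\mathbb{R}_+\to\mathbb{R}$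 convex, and that $|\alpha|>1$. Then $\int s^2\,d\mu<\infty$ and $\mu$ satisfies the following weighted Poincaré inequalities (each for all $f$ as above): $$\operatorname{Var}_\mu(f)\le\frac{1}{|\alpha|-1}\int_{\mathbb{R}_+^n}s(x)\sum_{i=1}^n x_i\Big(\frac{\partial f}{\partial x_i}(x)\Big)^2d\mu(x),$$ $$\operatorname{Var}_\mu(f)\le\frac{1}{|\alpha|-1}\int_{\mathbb{R}_+^n}s(x)^2\,d\mu(x)\times\int_{\mathbb{R}_+^n}\sum_{i=1}^n\frac{x_i}{s(x)}\Big(\frac{\partial f}{\partial x_i}(x)\Big)^2d\mu(x).$$ In particular, $\mu$ satisfies the classical Poincaré inequality $$\operatorname{Var}_\mu(f)\le\frac{1}{|\alpha|-1}\int_{\mathbb{R}_+^n}s(x)^2\,d\mu(x)\times\int_{\mathbb{R}_+^n}\sum_{i=1}^n\Big(\frac{\partial f}{\partial x_i}(x)\Big)^2d\mu(x).$$ -/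

import Mathlib

open MeasureTheory Set

namespace MultivariateLiouville

/-- The strictly positive orthant `(0, ∞)ⁿ`. -/
def orthant (n : ℕ) : Set (Fin n → ℝ) := {x | ∀ i, 0 < x i}

/-- `Df i` is the `i`-th weak partial derivative of `f` on the open set `Ω`, for every `i`:
all these functions are locally integrable on `Ω` and
`∫_Ω f ∂ᵢφ = - ∫_Ω (Df i) φ` for every smooth `φ` with compact support contained in `Ω`. -/
structure HasWeakGradientOn {n : ℕ} (Ω : Set (Fin n → ℝ)) (f : (Fin n → ℝ) → ℝ)
    (Df : Fin n → (Fin n → ℝ) → ℝ) : Prop where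
  locallyIntegrableOn : LocallyIntegrableOn f Ω volume
  locallyIntegrableOn_grad : ∀ i, LocallyIntegrableOn (Df i) Ω volume
  integral_eq : ∀ φ : (Fin n → ℝ) → ℝ, ContDiff ℝ (⊤ : ℕ∞) φ → HasCompactSupport φ →
    tsupport φ ⊆ Ω → ∀ i,
      ∫ x in Ω, f x * fderiv ℝ φ x (Pi.single i 1) = - ∫ x in Ω, Df i x * φ x

/-- The squared norm `‖v‖²_A = ⟨A v, v⟩` induced by a matrix `A`. -/
def normSq {n : ℕ} (A : Matrix (Fin n) (Fin n) ℝ) (v : Fin n → ℝ) : ℝ :=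
  (A.mulVec v) ⬝ᵥ v

/-- The measure `μ` satisfies on `Ω` the weighted Poincaré inequality with weight `W`
(a field of symmetric positive definite matrices) and finite constant `C > 0`:
`Var_μ(f) ≤ C ∫ ‖∇f‖²_W dμ` for all weakly differentiable `f ∈ L²(μ)` for which the right-hand
side is finite. -/
structure WeightedPoincare {n : ℕ} (Ω : Set (Fin n → ℝ)) (μ : Measure (Fin n → ℝ))
    (W : (Fin n → ℝ) → Matrix (Fin n) (Fin n) ℝ) (C : ℝ) : Prop where
  posDef : ∀ x ∈ Ω, (W x).PosDef
  const_pos : 0 < C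
  variance_le : ∀ (f : (Fin n → ℝ) → ℝ) (Df : Fin n → (Fin n → ℝ) → ℝ),
    MemLp f 2 μ → HasWeakGradientOn Ω f Df →
    Integrable (fun x => normSq (W x) (fun i => Df i x)) μ →
      (∫ x, f x ^ 2 ∂μ) - (∫ x, f x ∂μ) ^ 2 ≤ C * ∫ x, normSq (W x) (fun i => Df i x) ∂μ

/-- `μ` is the multivariate Liouville distribution with parameters `α` and `g`: a probability
measure whose density with respect to Lebesgue measure is
`Z⁻¹ ∏ᵢ xᵢ ^ (αᵢ - 1) g(∑ᵢ xᵢ)` on `(0, ∞)ⁿ` (and zero elsewhere), where the `αᵢ` are positive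
and `g` is a positive measurable function on `(0, ∞)`. -/
structure IsLiouville {n : ℕ} (α : Fin n → ℝ) (g : ℝ → ℝ) (μ : Measure (Fin n → ℝ)) : Prop where
  isProbabilityMeasure : IsProbabilityMeasure μ
  param_pos : ∀ i, 0 < α i
  generator_pos : ∀ s ∈ Ioi (0 : ℝ), 0 < g s
  generator_measurable : AEMeasurable g (volume.restrict (Ioi 0))
  exists_density : ∃ Z : ℝ, 0 < Z ∧
    μ = (volume.restrict (orthant n)).withDensity
      (fun x => ENNReal.ofReal (Z⁻¹ * (∏ i, x i ^ (α i - 1)) * g (∑ i, x i)))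

/-- `g = exp (-V)` on `S` for some (finite) convex function `V` on `S`. -/
def LogConcaveOn (S : Set ℝ) (g : ℝ → ℝ) : Prop :=
  ∃ V : ℝ → ℝ, ConvexOn ℝ S V ∧ ∀ s ∈ S, g s = Real.exp (-V s)

end MultivariateLiouville

/-! ### One-dimensional Poincaré inequalities from a curvature bound -/

namespace MultivariateLiouville

/-! Write `a` for `|α|`, `s` for the sum of the coordinates, and `y = x / s`. In the coordinates
`(s, y)` the measure is a product: `s` has density proportional to `s ^ (a - 1) exp (-V s)`, and `y`
is Dirichlet distributed, being the direction of a vector of independent Gamma variables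
(`map_polarMap`). With `y` as probability weights and `D` the gradient, `∑ yᵢ Dᵢ² = (∑ yᵢ Dᵢ)² + ∑
yᵢ (Dᵢ - ∑ yⱼ Dⱼ)²`. The first term is the squared radial derivative, the second is the angular
energy. It therefore suffices to prove a radial inequality and an angular inequality and to
tensorize them.

Radial part. The potential satisfies `-(log ρ)'' ≥ (a - 1) / s²`, because `V` is convex. A
Brascamp-Lieb argument (`exists_dual_potential`, `intervalVar_le_of_curvature`) gives the inequality
with weight `s² / (a - 1)`. The unweighted inequality with constant `∫ s² / (a - 1)` lies deeper
(`isPoincareConst_of_curvature`). If the optimal constant `P` exceeded this value, then for monotone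
functions the Bochner identity would improve `P ∫ u'²` by a multiple of `(∫ u')²`, hence by a
multiple of the variance itself. Monotone functions are the worst case, so `P` would not be optimal.
No eigenfunction is needed.

Angular part. The product of Gamma laws satisfies `Var F ≤ ∫ ∑ xᵢ (∂ᵢF)²`, by tensorizing the
one-dimensional inequality, which has curvature one. Applied to `F(x) = s(x) f(r y)` for a fixed
radius `r`, and with the first two moments of `s` under the Gamma product, it yields the angular
inequality with constant `1 / a` (`angular_variance_le_of_slice`), which is better than `1 / (a -
1)`.

Tensorization. The average over `s` of the centred slices is estimated by Cauchy-Schwarz with a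
weight `τ² / s²` (`variance_integral_le`). The choice `τ = s` gives the first inequality and `τ = 1`
the second; the classical one follows from `xᵢ ≤ s`.

The rest is regularization. Convex potentials are replaced by second differences of their double
primitives (`exists_smooth_convex_approx`). Weakly differentiable functions are mollified so fast
that convergence holds on almost every radial and angular slice (`exists_approx_slices`). The
inequalities are proved on compact intervals and cubes for `C¹` functions and then exhausted. -/

theorem uIcc_subset_Ioi_zero {A B : ℝ} (hA : 0 < A) (hB : 0 < B) : uIcc A B ⊆ Ioi 0 :=
  fun _ hx => (lt_min hA hB).trans_le hx.1

theorem intervalIntegrable_of_continuousOn_Ioi {f : ℝ → ℝ} (hf : ContinuousOn f (Ioi 0))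
    {A B : ℝ} (hA : 0 < A) (hB : 0 < B) : IntervalIntegrable f volume A B :=
  (hf.mono (uIcc_subset_Ioi_zero hA hB)).intervalIntegrable

theorem hasDerivAt_primitive_of_continuousOn_Ioi {f : ℝ → ℝ} (hf : ContinuousOn f (Ioi 0))
    {A x : ℝ} (hA : 0 < A) (hx : 0 < x) : HasDerivAt (fun y => ∫ t in A..y, f t) (f x) x :=
  intervalIntegral.integral_hasDerivAt_right (intervalIntegrable_of_continuousOn_Ioi hf hA hx)
    (hf.stronglyMeasurableAtFilter isOpen_Ioi _ hx) (hf.continuousAt (Ioi_mem_nhds hx))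

/-- Two continuous functions differing by the derivative of a function vanishing at the end points
have the same integral. -/
theorem integral_eq_of_hasDerivAt_diff {f g G : ℝ → ℝ} (hf : ContinuousOn f (Ioi 0))
    (hg : ContinuousOn g (Ioi 0)) {A B : ℝ} (hA : 0 < A) (hB : 0 < B)
    (hG : ∀ x, 0 < x → HasDerivAt G (f x - g x) x) (hGA : G A = 0) (hGB : G B = 0) :
    ∫ x in A..B, f x = ∫ x in A..B, g x := by
  have h1 : ∫ x in A..B, (f x - g x) = G B - G A :=
    intervalIntegral.integral_eq_sub_of_hasDerivAt
      (fun x hx => hG x (uIcc_subset_Ioi_zero hA hB hx))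
      (intervalIntegrable_of_continuousOn_Ioi (hf.sub hg) hA hB)
  rw [intervalIntegral.integral_sub (intervalIntegrable_of_continuousOn_Ioi hf hA hB)
    (intervalIntegrable_of_continuousOn_Ioi hg hA hB), hGA, hGB] at h1
  linarith

/-- Solving `-(R k)' = u ρ` for a centred function `u`, together with the integrated Bochner
formula for the solution `k`. -/
theorem exists_dual_potential {A B : ℝ} (hA : 0 < A) (hB : 0 < B) {ρ R b θ u h : ℝ → ℝ}
    (hρ : ContinuousOn ρ (Ioi 0)) (hρpos : ∀ x, 0 < x → 0 < ρ x) (hRpos : ∀ x, 0 < x → 0 < R x)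
    (hR : ∀ x, 0 < x → HasDerivAt R (b x * ρ x) x) (hb : ∀ x, 0 < x → HasDerivAt b (-θ x) x)
    (hθ : ContinuousOn θ (Ioi 0)) (hu : ∀ x, 0 < x → HasDerivAt u (h x) x)
    (hh : ContinuousOn h (Ioi 0)) (hmean : ∫ x in A..B, u x * ρ x = 0) :
    ∃ k kd : ℝ → ℝ, ContinuousOn kd (Ioi 0) ∧ (∀ x, 0 < x → HasDerivAt k (kd x) x) ∧
      ∫ x in A..B, u x ^ 2 * ρ x = ∫ x in A..B, h x * k x * R x ∧
      ∫ x in A..B, u x ^ 2 * ρ x =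
        ∫ x in A..B, (R x ^ 2 / ρ x * kd x ^ 2 + θ x * k x ^ 2 * R x) := by
  have huc : ContinuousOn u (Ioi 0) := fun x hx => (hu x hx).continuousAt.continuousWithinAt
  have hRc : ContinuousOn R (Ioi 0) := fun x hx => (hR x hx).continuousAt.continuousWithinAt
  have hbc : ContinuousOn b (Ioi 0) := fun x hx => (hb x hx).continuousAt.continuousWithinAt
  have hρ0 : ∀ x ∈ Ioi (0 : ℝ), ρ x ≠ 0 := fun x hx => (hρpos x hx).ne'
  have hR0 : ∀ x ∈ Ioi (0 : ℝ), R x ≠ 0 := fun x hx => (hRpos x hx).ne'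
  -- The flux `R k`. It vanishes at `A` by construction and at `B` because `u` is centred, so no
  -- boundary term survives below.
  set q : ℝ → ℝ := fun x => -∫ t in A..x, u t * ρ t with hq
  have hqd : ∀ x, 0 < x → HasDerivAt q (-(u x * ρ x)) x := fun x hx =>
    (hasDerivAt_primitive_of_continuousOn_Ioi (huc.mul hρ) hA hx).neg
  have hqc : ContinuousOn q (Ioi 0) := fun x hx => (hqd x hx).continuousAt.continuousWithinAt
  have hqA : q A = 0 := by simp [hq]
  have hqB : q B = 0 := by simp [hq, hmean]
  set k : ℝ → ℝ := fun x => q x / R x with hk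
  set kd : ℝ → ℝ := fun x => (-(u x * ρ x) * R x - q x * (b x * ρ x)) / R x ^ 2 with hkd
  have hkdd : ∀ x, 0 < x → HasDerivAt k (kd x) x := fun x hx => (hqd x hx).div (hR x hx) (hR0 x hx)
  have hkc : ContinuousOn k (Ioi 0) := hqc.div hRc hR0
  have hkdc : ContinuousOn kd (Ioi 0) := by
    refine ContinuousOn.div (by fun_prop) (by fun_prop) fun x hx => pow_ne_zero 2 (hR0 x hx)
  refine ⟨k, kd, hkdc, hkdd, ?_, ?_⟩
  · refine (integral_eq_of_hasDerivAt_diff (G := fun x => u x * q x) (by fun_prop) (by fun_prop)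
      hA hB (fun x hx => ?_) (by simp [hqA]) (by simp [hqB])).symm
    refine ((hu x hx).mul (hqd x hx)).congr_deriv ?_
    have h1 := hR0 x hx
    rw [show k x = q x / R x from rfl]
    field_simp
    ring
  -- Squaring `u ρ = -(R k' + b ρ k)` and dividing by `ρ` gives `R² k'² / ρ` and the two terms `2 b
  -- R k k' + b² ρ k²`. The latter are `(b k² R)' + θ k² R`, which is where the curvature enters.
  · refine integral_eq_of_hasDerivAt_diff (G := fun x => b x * (k x ^ 2 * R x)) (by fun_prop) ?_
      hA hB (fun x hx => ?_) (by simp [hk, hqA]) (by simp [hk, hqB])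
    · have : ContinuousOn (fun x => R x ^ 2 / ρ x) (Ioi 0) := ContinuousOn.div (by fun_prop) hρ hρ0
      fun_prop
    · refine ((hb x hx).mul (((hkdd x hx).pow 2).mul (hR x hx))).congr_deriv ?_
      have h1 := hR0 x hx
      have h2 := hρ0 x hx
      have e1 : k x = q x / R x := rfl
      have e2 : kd x = (-(u x * ρ x) * R x - q x * (b x * ρ x)) / R x ^ 2 := rfl
      simp only [Pi.pow_apply, Pi.mul_apply, e1, e2, Nat.cast_ofNat, Nat.add_one_sub_one, pow_one]
      field_simp
      ring

/-- The unnormalised centred second moment of `u` with respect to the density `ρ` on `[A, B]`. -/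
noncomputable def intervalVar (A B : ℝ) (ρ u : ℝ → ℝ) : ℝ :=
  (∫ x in A..B, u x ^ 2 * ρ x) - (∫ x in A..B, u x * ρ x) ^ 2 / ∫ x in A..B, ρ x

theorem integral_pos_of_continuousOn_Ioi {A B : ℝ} (hA : 0 < A) (hAB : A < B) {ρ : ℝ → ℝ}
    (hρ : ContinuousOn ρ (Ioi 0)) (hρpos : ∀ x, 0 < x → 0 < ρ x) : 0 < ∫ x in A..B, ρ x :=
  intervalIntegral.intervalIntegral_pos_of_pos_on
    (intervalIntegrable_of_continuousOn_Ioi hρ hA (hA.trans hAB))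
    (fun x hx => hρpos x (hA.trans hx.1)) hAB

theorem integral_add_const_mul {A B : ℝ} (hA : 0 < A) (hB : 0 < B) {f g : ℝ → ℝ}
    (hf : ContinuousOn f (Ioi 0)) (hg : ContinuousOn g (Ioi 0)) (c : ℝ) :
    ∫ x in A..B, (f x + c * g x) = (∫ x in A..B, f x) + c * ∫ x in A..B, g x := by
  rw [intervalIntegral.integral_add (intervalIntegrable_of_continuousOn_Ioi hf hA hB)
    ((intervalIntegrable_of_continuousOn_Ioi hg hA hB).const_mul c),
    intervalIntegral.integral_const_mul]

theorem integral_mono_of_continuousOn_Ioi {A B : ℝ} (hA : 0 < A) (hAB : A < B) {f g : ℝ → ℝ}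
    (hf : ContinuousOn f (Ioi 0)) (hg : ContinuousOn g (Ioi 0)) (h : ∀ x, 0 < x → f x ≤ g x) :
    ∫ x in A..B, f x ≤ ∫ x in A..B, g x :=
  intervalIntegral.integral_mono_on hAB.le
    (intervalIntegrable_of_continuousOn_Ioi hf hA (hA.trans hAB))
    (intervalIntegrable_of_continuousOn_Ioi hg hA (hA.trans hAB))
    fun x hx => h x (hA.trans_le hx.1)

section Density

variable {A B : ℝ} {ρ : ℝ → ℝ}

theorem integral_sub_sq {u : ℝ → ℝ} (hA : 0 < A) (hB : 0 < B) (hρ : ContinuousOn ρ (Ioi 0))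
    (hu : ContinuousOn u (Ioi 0)) (c : ℝ) :
    ∫ x in A..B, (u x - c) ^ 2 * ρ x =
      (∫ x in A..B, u x ^ 2 * ρ x) - 2 * c * (∫ x in A..B, u x * ρ x) + c ^ 2 * ∫ x in A..B, ρ x := by
  have h1 : ∀ x, (u x - c) ^ 2 * ρ x = u x ^ 2 * ρ x + (-2 * c) * (u x * ρ x - c / 2 * ρ x) :=
    fun x => by ring
  have h2 : ∀ x, u x * ρ x - c / 2 * ρ x = u x * ρ x + (-c / 2) * ρ x := fun x => by ring
  simp_rw [h1]
  rw [integral_add_const_mul hA hB (by fun_prop) (by fun_prop)]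
  simp_rw [h2]
  rw [integral_add_const_mul hA hB (by fun_prop) (by fun_prop)]
  ring

theorem intervalVar_eq {u : ℝ → ℝ} (hA : 0 < A) (hAB : A < B) (hρ : ContinuousOn ρ (Ioi 0))
    (hρpos : ∀ x, 0 < x → 0 < ρ x) (hu : ContinuousOn u (Ioi 0)) :
    intervalVar A B ρ u = ∫ x in A..B,
      (u x - (∫ x in A..B, u x * ρ x) / ∫ x in A..B, ρ x) ^ 2 * ρ x := by
  have := (integral_pos_of_continuousOn_Ioi hA hAB hρ hρpos).ne'
  rw [integral_sub_sq hA (hA.trans hAB) hρ hu, intervalVar]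
  field_simp
  ring

theorem integral_centred {u : ℝ → ℝ} (hA : 0 < A) (hAB : A < B) (hρ : ContinuousOn ρ (Ioi 0))
    (hρpos : ∀ x, 0 < x → 0 < ρ x) (hu : ContinuousOn u (Ioi 0)) :
    ∫ x in A..B, (u x - (∫ x in A..B, u x * ρ x) / ∫ x in A..B, ρ x) * ρ x = 0 := by
  have := (integral_pos_of_continuousOn_Ioi hA hAB hρ hρpos).ne'
  have h1 : ∀ c x, (u x - c) * ρ x = u x * ρ x + (-c) * ρ x := fun c x => by ring
  simp_rw [h1]
  rw [integral_add_const_mul hA (hA.trans hAB) (by fun_prop) hρ]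
  field_simp
  ring

/-- Weighted Poincaré inequality on an interval under a lower curvature bound. -/
theorem intervalVar_le_of_curvature {R b θ σ u h : ℝ → ℝ} (hA : 0 < A) (hAB : A < B)
    (hρ : ContinuousOn ρ (Ioi 0)) (hρpos : ∀ x, 0 < x → 0 < ρ x) (hRpos : ∀ x, 0 < x → 0 < R x)
    (hR : ∀ x, 0 < x → HasDerivAt R (b x * ρ x) x) (hb : ∀ x, 0 < x → HasDerivAt b (-θ x) x)
    (hθ : ContinuousOn θ (Ioi 0)) (hσ : ContinuousOn σ (Ioi 0)) (hσpos : ∀ x, 0 < x → 0 < σ x)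
    (hσθ : ∀ x, 0 < x → 1 ≤ θ x * σ x) (hu : ∀ x, 0 < x → HasDerivAt u (h x) x)
    (hh : ContinuousOn h (Ioi 0)) :
    intervalVar A B ρ u ≤ ∫ x in A..B, σ x * h x ^ 2 * R x := by
  have hB := hA.trans hAB
  have huc : ContinuousOn u (Ioi 0) := fun x hx => (hu x hx).continuousAt.continuousWithinAt
  have hRc : ContinuousOn R (Ioi 0) := fun x hx => (hR x hx).continuousAt.continuousWithinAt
  rw [intervalVar_eq hA hAB hρ hρpos huc]
  set c := (∫ x in A..B, u x * ρ x) / ∫ x in A..B, ρ x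
  obtain ⟨k, kd, hkdc, hk, e1, e2⟩ := exists_dual_potential hA hB hρ hρpos hRpos hR hb hθ
    (u := fun x => u x - c) (fun x hx => (hu x hx).sub_const c) hh
    (integral_centred hA hAB hρ hρpos huc)
  have hkc : ContinuousOn k (Ioi 0) := fun x hx => (hk x hx).continuousAt.continuousWithinAt
  have h3 : ContinuousOn (fun x => R x ^ 2 / ρ x) (Ioi 0) :=
    ContinuousOn.div (by fun_prop) hρ fun x hx => (hρpos x hx).ne'
  -- Both expressions from the dual potential integrate to the variance, so twice the first minus
  -- the second does as well. Pointwise, `2 h k ≤ σ h² + θ k²` because `θ σ ≥ 1`, and the term with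
  -- `k'²` is discarded.
  have key := integral_mono_of_continuousOn_Ioi hA hAB
    (f := fun x => 2 * (h x * k x * R x) + (-1) * (R x ^ 2 / ρ x * kd x ^ 2 + θ x * k x ^ 2 * R x))
    (g := fun x => σ x * h x ^ 2 * R x) (by fun_prop) (by fun_prop) fun x hx => by
      have r1 := hRpos x hx
      have r2 := hρpos x hx
      have r3 := hσpos x hx
      have r4 : 0 ≤ R x ^ 2 / ρ x * kd x ^ 2 := by positivity
      have r5 : 2 * (h x * k x) ≤ σ x * h x ^ 2 + θ x * k x ^ 2 := by
        have r6 : 0 ≤ (σ x * h x - k x) ^ 2 := sq_nonneg _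
        have r7 : 0 ≤ (θ x * σ x - 1) * k x ^ 2 :=
          mul_nonneg (by linarith [hσθ x hx]) (sq_nonneg _)
        nlinarith
      nlinarith [mul_le_mul_of_nonneg_right r5 r1.le]
  rw [integral_add_const_mul hA hB (by fun_prop) (by fun_prop), ← e2,
    intervalIntegral.integral_const_mul, ← e1] at key
  linarith

end Density

end MultivariateLiouville

/-! ### The unweighted one-dimensional constant -/

namespace MultivariateLiouville

section Density

variable {A B : ℝ} {ρ : ℝ → ℝ}

theorem intervalVar_le_integral_sub_sq {u : ℝ → ℝ} (hA : 0 < A) (hAB : A < B)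
    (hρ : ContinuousOn ρ (Ioi 0)) (hρpos : ∀ x, 0 < x → 0 < ρ x) (hu : ContinuousOn u (Ioi 0))
    (c : ℝ) : intervalVar A B ρ u ≤ ∫ x in A..B, (u x - c) ^ 2 * ρ x := by
  have hN := integral_pos_of_continuousOn_Ioi hA hAB hρ hρpos
  rw [integral_sub_sq hA (hA.trans hAB) hρ hu, intervalVar]
  set N := ∫ x in A..B, ρ x
  set I := ∫ x in A..B, u x * ρ x
  have h1 : 0 ≤ (I - c * N) ^ 2 / N := by positivity
  have h2 : (I - c * N) ^ 2 / N = I ^ 2 / N - 2 * c * I + c ^ 2 * N := by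
    field_simp
    ring
  linarith

theorem intervalVar_nonneg {u : ℝ → ℝ} (hA : 0 < A) (hAB : A < B)
    (hρ : ContinuousOn ρ (Ioi 0)) (hρpos : ∀ x, 0 < x → 0 < ρ x) (hu : ContinuousOn u (Ioi 0)) :
    0 ≤ intervalVar A B ρ u := by
  rw [intervalVar_eq hA hAB hρ hρpos hu]
  exact intervalIntegral.integral_nonneg hAB.le fun x hx =>
    mul_nonneg (sq_nonneg _) (hρpos x (hA.trans_le hx.1)).le

/-- `P` is a Poincaré constant for the density `ρ` on `[A, B]`. -/
def IsPoincareConst (A B : ℝ) (ρ : ℝ → ℝ) (P : ℝ) : Prop :=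
  ∀ u h : ℝ → ℝ, (∀ x, 0 < x → HasDerivAt u (h x) x) → ContinuousOn h (Ioi 0) →
    intervalVar A B ρ u ≤ P * ∫ x in A..B, h x ^ 2 * ρ x

/-- Under the curvature bound `θ ≥ κ / x²`, a Poincaré constant may be replaced on the mean of `h`
by `∫ x² ρ / (κ ∫ ρ)`. -/
theorem IsPoincareConst.intervalVar_le {b θ u h : ℝ → ℝ} {κ P : ℝ}
    (hP : IsPoincareConst A B ρ P) (hP0 : 0 < P) (hκ : 0 < κ) (hA : 0 < A) (hAB : A < B)
    (hρ : ∀ x, 0 < x → HasDerivAt ρ (b x * ρ x) x) (hρpos : ∀ x, 0 < x → 0 < ρ x)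
    (hb : ∀ x, 0 < x → HasDerivAt b (-θ x) x)
    (hθ : ContinuousOn θ (Ioi 0)) (hκθ : ∀ x, 0 < x → κ / x ^ 2 ≤ θ x)
    (hu : ∀ x, 0 < x → HasDerivAt u (h x) x) (hh : ContinuousOn h (Ioi 0)) :
    intervalVar A B ρ u ≤ P * intervalVar A B ρ h +
      (∫ x in A..B, x ^ 2 * ρ x) / κ * ((∫ x in A..B, h x * ρ x) / ∫ x in A..B, ρ x) ^ 2 := by
  have hB := hA.trans hAB
  have huc : ContinuousOn u (Ioi 0) := fun x hx => (hu x hx).continuousAt.continuousWithinAt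
  have hρc : ContinuousOn ρ (Ioi 0) := fun x hx => (hρ x hx).continuousAt.continuousWithinAt
  have hN := integral_pos_of_continuousOn_Ioi hA hAB hρc hρpos
  have hS := integral_pos_of_continuousOn_Ioi (ρ := fun x => x ^ 2 * ρ x) hA hAB (by fun_prop)
    fun x hx => mul_pos (by positivity) (hρpos x hx)
  obtain ⟨k, kd, hkdc, hk, e1, e2⟩ := exists_dual_potential hA hB hρc hρpos hρpos hρ hb hθ
    (u := fun x => u x - (∫ x in A..B, u x * ρ x) / ∫ x in A..B, ρ x)
    (fun x hx => (hu x hx).sub_const _) hh (integral_centred hA hAB hρc hρpos huc)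
  rw [← intervalVar_eq hA hAB hρc hρpos huc] at e1 e2
  have hkc : ContinuousOn k (Ioi 0) := fun x hx => (hk x hx).continuousAt.continuousWithinAt
  have hPk := hP k kd hk hkdc
  have hic : ContinuousOn (fun x : ℝ => κ / x ^ 2) (Ioi 0) :=
    ContinuousOn.div (by fun_prop) (by fun_prop) fun x hx => pow_ne_zero 2 (ne_of_gt hx)
  have hρ2 : ContinuousOn (fun x => ρ x ^ 2 / ρ x) (Ioi 0) :=
    ContinuousOn.div (by fun_prop) hρc fun x hx => (hρpos x hx).ne'
  set t := intervalVar A B ρ u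
  -- The Bochner identity with `R = ρ` and the curvature bound inserted; here the term with `k'²` is
  -- kept.
  have l1 : (∫ x in A..B, kd x ^ 2 * ρ x) + 1 * (∫ x in A..B, κ / x ^ 2 * k x ^ 2 * ρ x) ≤ t := by
    rw [e2, ← integral_add_const_mul hA hB (by fun_prop) (by fun_prop)]
    refine integral_mono_of_continuousOn_Ioi hA hAB (by fun_prop) (by fun_prop) fun x hx => ?_
    have r2 := hρpos x hx
    have : ρ x ^ 2 / ρ x = ρ x := by field_simp
    rw [this]
    nlinarith [mul_le_mul_of_nonneg_right (hκθ x hx) (mul_nonneg (sq_nonneg (k x)) r2.le)]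
  set N := ∫ x in A..B, ρ x
  set S := ∫ x in A..B, x ^ 2 * ρ x
  set H1 := ∫ x in A..B, h x * ρ x with hH1
  set K1 := ∫ x in A..B, k x * ρ x with hK1
  -- Cauchy-Schwarz for the weighted second moment of `k`
  have l2 : κ * (K1 ^ 2 / S) ≤ ∫ x in A..B, κ / x ^ 2 * k x ^ 2 * ρ x := by
    have := integral_mono_of_continuousOn_Ioi hA hAB
      (f := fun x => (2 * κ * (K1 / S)) * (k x * ρ x) + (-(κ * (K1 / S) ^ 2)) * (x ^ 2 * ρ x))
      (g := fun x => κ / x ^ 2 * k x ^ 2 * ρ x) (by fun_prop) (by fun_prop) fun x hx => by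
        have r2 := hρpos x hx
        have : 0 ≤ κ * (K1 / S * x - k x / x) ^ 2 * ρ x := by positivity
        have e : κ * (K1 / S * x - k x / x) ^ 2 * ρ x = κ / x ^ 2 * k x ^ 2 * ρ x -
          ((2 * κ * (K1 / S)) * (k x * ρ x) + (-(κ * (K1 / S) ^ 2)) * (x ^ 2 * ρ x)) := by
          field_simp
          ring
        linarith
    rw [integral_add_const_mul hA hB (by fun_prop) (by fun_prop),
      intervalIntegral.integral_const_mul, ← hK1] at this
    have e : 2 * κ * (K1 / S) * K1 + -(κ * (K1 / S) ^ 2) * S = κ * (K1 ^ 2 / S) := by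
      field_simp
      ring
    linarith
  -- The first identity says that `t` is `∫ h k ρ`, so `t - H1 * K1 / N` is the covariance of `h`
  -- and `k`. Nonnegativity of the variance of `P h - k` bounds twice this covariance by `P Var h +
  -- Var k / P`.
  have l3 := intervalVar_nonneg hA hAB hρc hρpos (u := fun x => P * h x - k x) (by fun_prop)
  have e3 : intervalVar A B ρ (fun x => P * h x - k x) =
      P ^ 2 * intervalVar A B ρ h - 2 * P * (t - H1 * K1 / N) + intervalVar A B ρ k := by
    have a1 : ∀ x, (P * h x - k x) ^ 2 * ρ x =
        k x ^ 2 * ρ x + P * (P * (h x ^ 2 * ρ x) + (-2) * (h x * k x * ρ x)) := fun x => by ring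
    have a2 : ∀ x, (P * h x - k x) * ρ x = P * (h x * ρ x) + (-1) * (k x * ρ x) :=
      fun x => by ring
    simp only [intervalVar, a1, a2]
    rw [integral_add_const_mul hA hB (by fun_prop) (by fun_prop),
      integral_add_const_mul hA hB (by fun_prop) (by fun_prop),
      integral_add_const_mul hA hB (by fun_prop) (by fun_prop),
      intervalIntegral.integral_const_mul, intervalIntegral.integral_const_mul, ← e1, ← hK1, ← hH1]
    change _ - _ / N = P ^ 2 * (_ - _ / N) - _ + (_ - _ / N)
    field_simp
    ring
  rw [e3] at l3
  -- The product of the means is split so that its `K1` part is exactly the quantity controlled by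
  -- `l2`.
  have l4 : 2 * (H1 * K1 / N) ≤ S / κ * (H1 / N) ^ 2 + κ * (K1 ^ 2 / S) := by
    have : 0 ≤ κ / S * (S / κ * (H1 / N) - K1) ^ 2 := by positivity
    have e : κ / S * (S / κ * (H1 / N) - K1) ^ 2 =
      S / κ * (H1 / N) ^ 2 + κ * (K1 ^ 2 / S) - 2 * (H1 * K1 / N) := by
      field_simp
      ring
    linarith
  have l5 : 2 * t ≤ P * intervalVar A B ρ h + intervalVar A B ρ k / P + 2 * (H1 * K1 / N) := by
    have : 0 ≤ (P ^ 2 * intervalVar A B ρ h - 2 * P * (t - H1 * K1 / N) +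
      intervalVar A B ρ k) / P := by positivity
    have e : (P ^ 2 * intervalVar A B ρ h - 2 * P * (t - H1 * K1 / N) +
      intervalVar A B ρ k) / P = P * intervalVar A B ρ h + intervalVar A B ρ k / P
        + 2 * (H1 * K1 / N) - 2 * t := by
      field_simp
      ring
    linarith
  -- The Poincaré constant is applied to `k`, not to `u`. The two terms in `k` then add up to at
  -- most `t` by `l1`, and one copy of `t` is absorbed on the left of `l5`.
  have l6 : intervalVar A B ρ k / P ≤ ∫ x in A..B, kd x ^ 2 * ρ x := by
    rw [div_le_iff₀ hP0]
    linarith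
  linarith

/-- A nondecreasing `u` rises by at most `∫ h`, and `ρ` is bounded below on `[A, B]`. The size of
`M` is irrelevant; only its existence is used, to turn a gain in `(∫ h ρ)²` into a gain in the
variance. -/
theorem exists_monotone_bound (hA : 0 < A) (hAB : A < B)
    (hρ : ContinuousOn ρ (Ioi 0)) (hρpos : ∀ x, 0 < x → 0 < ρ x) :
    ∃ M : ℝ, 0 < M ∧ ∀ u h : ℝ → ℝ, (∀ x, 0 < x → HasDerivAt u (h x) x) →
      ContinuousOn h (Ioi 0) → (∀ x, 0 < x → 0 ≤ h x) →
      intervalVar A B ρ u ≤ M * (∫ x in A..B, h x * ρ x) ^ 2 := by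
  have hB := hA.trans hAB
  have hN := integral_pos_of_continuousOn_Ioi hA hAB hρ hρpos
  have hsub : Icc A B ⊆ Ioi 0 := fun x hx => hA.trans_le hx.1
  obtain ⟨x₀, hx₀, hmin⟩ := isCompact_Icc.exists_isMinOn (nonempty_Icc.2 hAB.le) (hρ.mono hsub)
  have hm := hρpos x₀ (hsub hx₀)
  refine ⟨(∫ x in A..B, ρ x) / ρ x₀ ^ 2, by positivity, fun u h hu hh hh0 => ?_⟩
  have huc : ContinuousOn u (Ioi 0) := fun x hx => (hu x hx).continuousAt.continuousWithinAt
  refine (intervalVar_le_integral_sub_sq hA hAB hρ hρpos huc (u A)).trans ?_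
  have hI : ∀ x ∈ Icc A B, u x - u A = ∫ t in A..x, h t := fun x hx =>
    (intervalIntegral.integral_eq_sub_of_hasDerivAt
      (fun y hy => hu y (uIcc_subset_Ioi_zero hA (hsub hx) hy))
      (intervalIntegrable_of_continuousOn_Ioi hh hA (hsub hx))).symm
  have hb : ∀ x ∈ Icc A B, u x - u A ≤ (∫ x in A..B, h x * ρ x) / ρ x₀ := by
    intro x hx
    rw [hI x hx, le_div_iff₀ hm]
    have h1 : ∫ t in A..x, h t ≤ ∫ t in A..B, h t :=
      intervalIntegral.integral_mono_interval le_rfl hx.1 hx.2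
        ((ae_restrict_iff' measurableSet_Ioc).2 (Filter.Eventually.of_forall
          fun y hy => hh0 y (hA.trans hy.1)))
        (intervalIntegrable_of_continuousOn_Ioi hh hA hB)
    have h2 : ∫ t in A..B, h t * ρ x₀ ≤ ∫ t in A..B, h t * ρ t :=
      intervalIntegral.integral_mono_on hAB.le
        (intervalIntegrable_of_continuousOn_Ioi (by fun_prop) hA hB)
        (intervalIntegrable_of_continuousOn_Ioi (by fun_prop) hA hB)
        fun y hy => mul_le_mul_of_nonneg_left (hmin hy) (hh0 y (hsub hy))
    rw [intervalIntegral.integral_mul_const] at h2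
    exact (mul_le_mul_of_nonneg_right h1 hm.le).trans h2
  have hb0 : ∀ x ∈ Icc A B, 0 ≤ u x - u A := fun x hx => by
    rw [hI x hx]
    exact intervalIntegral.integral_nonneg hx.1 fun y hy => hh0 y (hA.trans_le hy.1)
  calc ∫ x in A..B, (u x - u A) ^ 2 * ρ x
      ≤ ∫ x in A..B, ((∫ x in A..B, h x * ρ x) / ρ x₀) ^ 2 * ρ x :=
        intervalIntegral.integral_mono_on hAB.le
          (intervalIntegrable_of_continuousOn_Ioi (by fun_prop) hA hB)
          (intervalIntegrable_of_continuousOn_Ioi (by fun_prop) hA hB)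
          fun x hx => mul_le_mul_of_nonneg_right (pow_le_pow_left₀ (hb0 x hx) (hb x hx) 2)
            (hρpos x (hsub hx)).le
    _ = _ := by
        rw [intervalIntegral.integral_const_mul]
        field_simp

/-- Replacing `h = u'` by `|h|` does not decrease the variance. -/
theorem intervalVar_le_of_abs_deriv {u v h : ℝ → ℝ} (hA : 0 < A) (hAB : A < B)
    (hρ : ContinuousOn ρ (Ioi 0)) (hρpos : ∀ x, 0 < x → 0 < ρ x)
    (hu : ∀ x, 0 < x → HasDerivAt u (h x) x) (hv : ∀ x, 0 < x → HasDerivAt v |h x| x)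
    (hh : ContinuousOn h (Ioi 0)) :
    intervalVar A B ρ u ≤ intervalVar A B ρ v := by
  have hB := hA.trans hAB
  have huc : ContinuousOn u (Ioi 0) := fun x hx => (hu x hx).continuousAt.continuousWithinAt
  have hvc : ContinuousOn v (Ioi 0) := fun x hx => (hv x hx).continuousAt.continuousWithinAt
  have hc := integral_centred hA hAB hρ hρpos hvc
  rw [intervalVar_eq hA hAB hρ hρpos hvc]
  set c := (∫ x in A..B, v x * ρ x) / ∫ x in A..B, ρ x
  have hd : ∀ x, 0 < x → HasDerivAt (fun y => ∫ t in A..y, (v t - c) * ρ t) ((v x - c) * ρ x) x :=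
    fun x hx => hasDerivAt_primitive_of_continuousOn_Ioi (by fun_prop) hA hx
  -- Rolle's theorem for the primitive of the centred density gives a point where `v` equals its
  -- mean. Centring `u` at the same point, `|u x - u x₀| ≤ |v x - v x₀|` holds everywhere.
  obtain ⟨x₀, hx₀, h0⟩ := exists_hasDerivAt_eq_zero hAB
    (fun x hx => (hd x (hA.trans_le hx.1)).continuousAt.continuousWithinAt)
    (by simp [hc]) fun x hx => hd x (hA.trans hx.1)
  have hx0 : 0 < x₀ := hA.trans hx₀.1
  have hvx : v x₀ = c := by
    rcases mul_eq_zero.1 h0 with h | h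
    · linarith
    · exact absurd h (hρpos x₀ hx0).ne'
  refine (intervalVar_le_integral_sub_sq hA hAB hρ hρpos huc (u x₀)).trans ?_
  refine integral_mono_of_continuousOn_Ioi hA hAB (by fun_prop) (by fun_prop) fun x hx => ?_
  refine mul_le_mul_of_nonneg_right ?_ (hρpos x hx).le
  rw [← hvx]
  refine sq_le_sq.2 ?_
  have hsub := uIcc_subset_Ioi_zero hx0 hx
  rw [← intervalIntegral.integral_eq_sub_of_hasDerivAt (fun y hy => hu y (hsub hy))
    (intervalIntegrable_of_continuousOn_Ioi hh hx0 hx),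
    ← intervalIntegral.integral_eq_sub_of_hasDerivAt (fun y hy => hv y (hsub hy))
    (intervalIntegrable_of_continuousOn_Ioi hh.abs hx0 hx)]
  simpa only [Real.norm_eq_abs] using
    intervalIntegral.norm_integral_le_abs_integral_norm (f := h) (μ := volume) (a := x₀) (b := x)

theorem IsPoincareConst.mono {P Q : ℝ} (hP : IsPoincareConst A B ρ P) (hPQ : P ≤ Q) (hA : 0 < A)
    (hAB : A < B) (hρpos : ∀ x, 0 < x → 0 < ρ x) : IsPoincareConst A B ρ Q :=
  fun u h hu hh => (hP u h hu hh).trans (mul_le_mul_of_nonneg_right hPQ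
    (intervalIntegral.integral_nonneg hAB.le fun x hx =>
    mul_nonneg (sq_nonneg _) (hρpos x (hA.trans_le hx.1)).le))

/-- The spectral gap of a one-dimensional density with curvature at least `κ / x²`. -/
theorem isPoincareConst_of_curvature {b θ : ℝ → ℝ} {κ : ℝ} (hκ : 0 < κ) (hA : 0 < A) (hAB : A < B)
    (hρ : ∀ x, 0 < x → HasDerivAt ρ (b x * ρ x) x) (hρpos : ∀ x, 0 < x → 0 < ρ x)
    (hb : ∀ x, 0 < x → HasDerivAt b (-θ x) x)
    (hθ : ContinuousOn θ (Ioi 0)) (hκθ : ∀ x, 0 < x → κ / x ^ 2 ≤ θ x) :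
    IsPoincareConst A B ρ ((∫ x in A..B, x ^ 2 * ρ x) / (κ * ∫ x in A..B, ρ x)) := by
  have hB := hA.trans hAB
  have hρc : ContinuousOn ρ (Ioi 0) := fun x hx => (hρ x hx).continuousAt.continuousWithinAt
  have hN := integral_pos_of_continuousOn_Ioi hA hAB hρc hρpos
  have hS := integral_pos_of_continuousOn_Ioi (ρ := fun x => x ^ 2 * ρ x) hA hAB (by fun_prop)
    fun x hx => mul_pos (by positivity) (hρpos x hx)
  set N := ∫ x in A..B, ρ x
  set S := ∫ x in A..B, x ^ 2 * ρ x
  set C := S / (κ * N) with hC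
  have hC0 : 0 < C := by positivity
  have hEn : ∀ h : ℝ → ℝ, 0 ≤ ∫ x in A..B, h x ^ 2 * ρ x := fun h =>
    intervalIntegral.integral_nonneg hAB.le fun x hx =>
    mul_nonneg (sq_nonneg _) (hρpos x (hA.trans_le hx.1)).le
  set T : Set ℝ := {P | 0 < P ∧ IsPoincareConst A B ρ P} with hT
  -- Some Poincaré constant exists: the weighted inequality with `σ = x² / κ`, and `x ≤ B`.
  have hne : B ^ 2 / κ ∈ T := by
    refine ⟨by positivity, fun u h hu hh => ?_⟩
    have h1 := intervalVar_le_of_curvature (σ := fun x => x ^ 2 / κ) hA hAB hρc hρpos hρpos hρ hb hθ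
      (by fun_prop) (fun x hx => by positivity) (fun x hx => by
        have := mul_le_mul_of_nonneg_right (hκθ x hx) (by positivity : (0:ℝ) ≤ x ^ 2 / κ)
        refine le_trans (le_of_eq ?_) this
        field_simp) hu hh
    refine h1.trans ?_
    rw [← intervalIntegral.integral_const_mul]
    refine intervalIntegral.integral_mono_on hAB.le
      (intervalIntegrable_of_continuousOn_Ioi (by fun_prop) hA hB)
      (intervalIntegrable_of_continuousOn_Ioi (by fun_prop) hA hB) fun x hx => ?_
    have hx0 : 0 < x := hA.trans_le hx.1
    have := hρpos x hx0
    rw [mul_assoc]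
    have hxB : x ≤ B := hx.2
    gcongr
  have hbdd : BddBelow T := ⟨0, fun P hP => hP.1.le⟩
  have hinf : IsPoincareConst A B ρ (sInf T) := by
    intro u h hu hh
    by_contra hlt
    push Not at hlt
    rcases (hEn h).eq_or_lt with h0 | h0
    · have := hne.2 u h hu hh
      rw [← h0] at this hlt
      linarith
    · obtain ⟨P, hP, hPlt⟩ := exists_lt_of_csInf_lt ⟨_, hne⟩ ((lt_div_iff₀ h0).2 hlt)
      rw [lt_div_iff₀ h0] at hPlt
      exact absurd (hP.2 u h hu hh) (not_le.2 hPlt)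
  refine hinf.mono ?_ hA hAB hρpos
  by_contra hlt
  push Not at hlt
  set P := sInf T
  have hP0 : 0 < P := hC0.trans hlt
  obtain ⟨M, hM, hMu⟩ := exists_monotone_bound hA hAB hρc hρpos
  set D := N * M
  have hD : 0 < D := by positivity
  -- This smaller number will be shown to be a Poincaré constant as well, contradicting the choice
  -- of `P` as infimum.
  have hPD : P * D / (D + (P - C)) < P := by
    rw [div_lt_iff₀ (by linarith)]
    nlinarith
  refine absurd (csInf_le hbdd ⟨?_, ?_⟩) (not_le.2 hPD)
  · exact div_pos (by positivity) (by linarith)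
  · intro u h hu hh
    have hv : ∀ x, 0 < x → HasDerivAt (fun y => ∫ t in A..y, |h t|) |h x| x := fun x hx =>
      hasDerivAt_primitive_of_continuousOn_Ioi hh.abs hA hx
    refine (intervalVar_le_of_abs_deriv hA hAB hρc hρpos hu hv hh).trans ?_
    -- For the primitive of `|h|` the refined inequality reads `v ≤ P H2 - (P - C) H1² / N`. Since
    -- `H1²` dominates `v / M`, the variance `v` also appears on the left with the extra factor `(P
    -- - C) / D`.
    have h1 := hinf.intervalVar_le hP0 hκ hA hAB hρ hρpos hb hθ hκθ hv hh.abs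
    have h2 := hMu _ _ hv hh.abs fun x _ => abs_nonneg _
    simp only [intervalVar, sq_abs] at h1 h2 ⊢
    set v := (∫ x in A..B, (∫ t in A..x, |h t|) ^ 2 * ρ x) -
      (∫ x in A..B, (∫ t in A..x, |h t|) * ρ x) ^ 2 / N
    set H1 := ∫ x in A..B, |h x| * ρ x
    set H2 := ∫ x in A..B, h x ^ 2 * ρ x
    change v ≤ P * (H2 - H1 ^ 2 / N) + S / κ * (H1 / N) ^ 2 at h1
    have e : P * (H2 - H1 ^ 2 / N) + S / κ * (H1 / N) ^ 2 =
        P * H2 - (P - C) / D * (M * H1 ^ 2) := by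
      simp only [hC, D]
      field_simp
      ring
    have h3 := mul_le_mul_of_nonneg_left h2
      (div_nonneg (sub_nonneg.2 hlt.le) hD.le : 0 ≤ (P - C) / D)
    rw [e] at h1
    have h4 : v + (P - C) / D * v ≤ P * H2 := by linarith
    have h5 : v + (P - C) / D * v = v * (D + (P - C)) / D := by field_simp
    rw [h5, div_le_iff₀ hD] at h4
    rw [div_mul_eq_mul_div, le_div_iff₀ (by linarith)]
    linarith

end Density

end MultivariateLiouville

/-! ### Gamma densities and log-concave perturbations of powers -/

namespace MultivariateLiouville
open Filter Topology

/-- This is the Laguerre operator. With `R = x ρ` one has `R' = (α - x) ρ`, so `b = α - x` and the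
curvature is `1` for every shape `α`. -/
theorem gamma_intervalVar_le {A B : ℝ} (hA : 0 < A) (hAB : A < B) (α : ℝ) {u h : ℝ → ℝ}
    (hu : ∀ x, 0 < x → HasDerivAt u (h x) x) (hh : ContinuousOn h (Ioi 0)) :
    intervalVar A B (fun x => x ^ (α - 1) * Real.exp (-x)) u ≤
      ∫ x in A..B, x * h x ^ 2 * (x ^ (α - 1) * Real.exp (-x)) := by
  have hpow : ContinuousOn (fun x : ℝ => x ^ (α - 1)) (Ioi 0) := fun x hx =>
    (Real.continuousAt_rpow_const _ _ (Or.inl (ne_of_gt hx))).continuousWithinAt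
  have := intervalVar_le_of_curvature (ρ := fun x => x ^ (α - 1) * Real.exp (-x))
    (R := fun x => x * (x ^ (α - 1) * Real.exp (-x))) (b := fun x => α - x) (θ := fun _ => 1)
    (σ := fun _ => 1) hA hAB (by fun_prop)
    (fun x hx => by positivity) (fun x hx => by positivity)
    (fun x hx => ?_) (fun x hx => by simpa using (hasDerivAt_id x).const_sub α) (by fun_prop)
    (by fun_prop) (fun _ _ => one_pos) (fun _ _ => by norm_num) hu hh
  · refine this.trans (le_of_eq ?_)
    congr 1
    ext x
    ring
  · refine ((hasDerivAt_id x).mul ((Real.hasDerivAt_rpow_const (p := α - 1)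
      (Or.inl hx.ne')).mul ((hasDerivAt_id x).neg.exp))).congr_deriv ?_
    have : x ^ (α - 1 - 1) = x ^ (α - 1) / x := by rw [Real.rpow_sub_one hx.ne' (α - 1)]
    simp only [this, id, Pi.mul_apply, Pi.neg_apply]
    field_simp
    ring

section Smooth

variable {a : ℝ} {V V1 V2 : ℝ → ℝ}

theorem hasDerivAt_rpow_mul_exp_neg (hV : ∀ x, 0 < x → HasDerivAt V (V1 x) x) {x : ℝ}
    (hx : 0 < x) : HasDerivAt (fun x => x ^ (a - 1) * Real.exp (-V x))
      (((a - 1) / x - V1 x) * (x ^ (a - 1) * Real.exp (-V x))) x := by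
  refine ((Real.hasDerivAt_rpow_const (p := a - 1)
      (Or.inl hx.ne')).mul ((hV x hx).neg.exp)).congr_deriv ?_
  have : x ^ (a - 1 - 1) = x ^ (a - 1) / x := by rw [Real.rpow_sub_one hx.ne' (a - 1)]
  simp only [this, Pi.neg_apply]
  field_simp
  ring

theorem hasDerivAt_logDeriv (hV1 : ∀ x, 0 < x → HasDerivAt V1 (V2 x) x) {x : ℝ}
    (hx : 0 < x) : HasDerivAt (fun x => (a - 1) / x - V1 x) (-((a - 1) / x ^ 2 + V2 x)) x := by
  refine (((hasDerivAt_inv hx.ne').const_mul (a - 1)).sub (hV1 x hx)).congr_deriv ?_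
  field_simp
  ring

theorem continuousOn_curvature (hV2 : ContinuousOn V2 (Ioi 0)) :
    ContinuousOn (fun x => (a - 1) / x ^ 2 + V2 x) (Ioi 0) :=
  ContinuousOn.add (ContinuousOn.div (by fun_prop) (by fun_prop)
    fun x hx => pow_ne_zero 2 (ne_of_gt hx)) hV2

/-- The curvature `(a - 1) / x² + V''` is at least `(a - 1) / x²`, and `σ` is the reciprocal of this
lower bound. -/
theorem smooth_intervalVar_le {A B : ℝ} (hA : 0 < A) (hAB : A < B) (ha : 1 < a)
    (hV : ∀ x, 0 < x → HasDerivAt V (V1 x) x) (hV1 : ∀ x, 0 < x → HasDerivAt V1 (V2 x) x)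
    (hV2 : ContinuousOn V2 (Ioi 0)) (hV2n : ∀ x, 0 < x → 0 ≤ V2 x) {u h : ℝ → ℝ}
    (hu : ∀ x, 0 < x → HasDerivAt u (h x) x) (hh : ContinuousOn h (Ioi 0)) :
    intervalVar A B (fun x => x ^ (a - 1) * Real.exp (-V x)) u ≤
      ∫ x in A..B, x ^ 2 / (a - 1) * h x ^ 2 * (x ^ (a - 1) * Real.exp (-V x)) := by
  have ha' : 0 < a - 1 := by linarith
  refine intervalVar_le_of_curvature (σ := fun x => x ^ 2 / (a - 1)) hA hAB
    (fun x hx => (hasDerivAt_rpow_mul_exp_neg hV hx).continuousAt.continuousWithinAt)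
    (fun x hx => by positivity) (fun x hx => by positivity)
    (fun x hx => hasDerivAt_rpow_mul_exp_neg hV hx) (fun x hx => hasDerivAt_logDeriv hV1 hx)
    (continuousOn_curvature hV2) (by fun_prop) (fun x hx => by positivity) (fun x hx => ?_) hu hh
  have : (0:ℝ) ≤ V2 x * (x ^ 2 / (a - 1)) := mul_nonneg (hV2n x hx) (by positivity)
  have e : (a - 1) / x ^ 2 * (x ^ 2 / (a - 1)) = 1 := by field_simp
  rw [add_mul, e]
  linarith

theorem smooth_isPoincareConst {A B : ℝ} (hA : 0 < A) (hAB : A < B) (ha : 1 < a)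
    (hV : ∀ x, 0 < x → HasDerivAt V (V1 x) x) (hV1 : ∀ x, 0 < x → HasDerivAt V1 (V2 x) x)
    (hV2 : ContinuousOn V2 (Ioi 0)) (hV2n : ∀ x, 0 < x → 0 ≤ V2 x) :
    IsPoincareConst A B (fun x => x ^ (a - 1) * Real.exp (-V x))
      ((∫ x in A..B, x ^ 2 * (x ^ (a - 1) * Real.exp (-V x))) /
        ((a - 1) * ∫ x in A..B, x ^ (a - 1) * Real.exp (-V x))) :=
  isPoincareConst_of_curvature (by linarith) hA hAB
    (fun x hx => hasDerivAt_rpow_mul_exp_neg hV hx) (fun x hx => by positivity)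
    (fun x hx => hasDerivAt_logDeriv hV1 hx) (continuousOn_curvature hV2)
    fun x hx => le_add_of_nonneg_right (hV2n x hx)

end Smooth

/-! ### Removing the smoothness of the potential -/

theorem HasDerivAt.comp_add_const' {G g : ℝ → ℝ} (hG : ∀ x, 0 < x → HasDerivAt G (g x) x)
    {c x : ℝ} (hc : 0 ≤ c) (hx : 0 < x) : HasDerivAt (fun y => G (y + c)) (g (x + c)) x :=
  (hG (x + c) (by linarith)).comp_add_const x c

/-- Second difference quotient. -/
noncomputable def secondDiff (ε : ℝ) (f : ℝ → ℝ) (x : ℝ) : ℝ :=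
  (f (x + 2 * ε) - 2 * f (x + ε) + f x) / ε ^ 2

theorem hasDerivAt_secondDiff {G g : ℝ → ℝ} (hG : ∀ x, 0 < x → HasDerivAt G (g x) x)
    {ε x : ℝ} (hε : 0 < ε) (hx : 0 < x) :
    HasDerivAt (secondDiff ε G) (secondDiff ε g x) x :=
  (((HasDerivAt.comp_add_const' hG (by positivity) hx).sub
    ((HasDerivAt.comp_add_const' hG hε.le hx).const_mul 2)).add (hG x hx)).div_const _

/-- The mean value theorem, once for the first difference of `H` and once for `G`. This gives both
the pointwise convergence and the local bound of the regularization. Forward differences are used so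
that all points stay in the half-line. -/
theorem exists_secondDiff_eq {H G V : ℝ → ℝ} (hH : ∀ x, 0 < x → HasDerivAt H (G x) x)
    (hG : ∀ x, 0 < x → HasDerivAt G (V x) x) {ε x : ℝ} (hε : 0 < ε) (hx : 0 < x) :
    ∃ y ∈ Icc x (x + 2 * ε), secondDiff ε H x = V y := by
  have h1 : ∀ y, 0 < y → HasDerivAt (fun y => H (y + ε) - H y) (G (y + ε) - G y) y := fun y hy =>
    (HasDerivAt.comp_add_const' hH hε.le hy).sub (hH y hy)
  obtain ⟨η, hη, e1⟩ := exists_hasDerivAt_eq_slope (fun y => H (y + ε) - H y)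
    (fun y => G (y + ε) - G y) (lt_add_of_pos_right x hε)
    (fun y hy => (h1 y (hx.trans_le hy.1)).continuousAt.continuousWithinAt)
    fun y hy => h1 y (hx.trans hy.1)
  have hη0 : 0 < η := hx.trans hη.1
  obtain ⟨ξ, hξ, e2⟩ := exists_hasDerivAt_eq_slope G V (lt_add_of_pos_right η hε)
    (fun y hy => (hG y (hη0.trans_le hy.1)).continuousAt.continuousWithinAt)
    fun y hy => hG y (hη0.trans hy.1)
  refine ⟨ξ, ⟨(hη.1.trans hξ.1).le, ?_⟩, ?_⟩
  · have := hη.2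
    have := hξ.2
    linarith
  · rw [e2, e1, secondDiff]
    have : x + ε + ε = x + 2 * ε := by ring
    rw [this, add_sub_cancel_left, add_sub_cancel_left, div_div]
    have h2 : H (x + 2 * ε) - 2 * H (x + ε) + H x = H (x + 2 * ε) - H (x + ε) - (H (x + ε) - H x) := by
      ring
    rw [h2, sq]

theorem secondDiff_nonneg {V : ℝ → ℝ} (hV : ConvexOn ℝ (Ioi 0) V) {ε x : ℝ} (hε : 0 < ε)
    (hx : 0 < x) : 0 ≤ secondDiff ε V x := by
  have := hV.2 (show x ∈ Ioi 0 from hx) (show x + 2 * ε ∈ Ioi (0:ℝ) from by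
    simp only [mem_Ioi]; positivity) (by norm_num : (0:ℝ) ≤ 1 / 2) (by norm_num : (0:ℝ) ≤ 1 / 2)
    (by norm_num)
  have e : (1 / 2 : ℝ) • x + (1 / 2 : ℝ) • (x + 2 * ε) = x + ε := by
    simp only [smul_eq_mul]; ring
  rw [e] at this
  simp only [smul_eq_mul] at this
  exact div_nonneg (by linarith) (by positivity)

/-- A convex function on `(0, ∞)` is a locally bounded pointwise limit of `C²` convex functions. -/
theorem exists_smooth_convex_approx {V : ℝ → ℝ} (hV : ConvexOn ℝ (Ioi 0) V) :
    ∃ W W1 W2 : ℕ → ℝ → ℝ, (∀ k x, 0 < x → HasDerivAt (W k) (W1 k x) x) ∧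
      (∀ k x, 0 < x → HasDerivAt (W1 k) (W2 k x) x) ∧ (∀ k, ContinuousOn (W2 k) (Ioi 0)) ∧
      (∀ k x, 0 < x → 0 ≤ W2 k x) ∧ (∀ x, 0 < x → Tendsto (fun k => W k x) atTop (𝓝 (V x))) ∧
      ∀ A B, 0 < A → ∃ M, ∀ k, ∀ x ∈ Icc A B, |W k x| ≤ M := by
  have hVc : ContinuousOn V (Ioi 0) := hV.continuousOn isOpen_Ioi
  -- Since `H'' = V`, the second difference of `H` approximates `V`. Its second derivative is the
  -- second difference of `V`, which is nonnegative by convexity and continuous although `V` is only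
  -- convex.
  set G : ℝ → ℝ := fun x => ∫ t in (1:ℝ)..x, V t
  have hG : ∀ x, 0 < x → HasDerivAt G (V x) x := fun x hx =>
    hasDerivAt_primitive_of_continuousOn_Ioi hVc one_pos hx
  have hGc : ContinuousOn G (Ioi 0) := fun x hx => (hG x hx).continuousAt.continuousWithinAt
  set H : ℝ → ℝ := fun x => ∫ t in (1:ℝ)..x, G t
  have hH : ∀ x, 0 < x → HasDerivAt H (G x) x := fun x hx =>
    hasDerivAt_primitive_of_continuousOn_Ioi hGc one_pos hx
  set ε : ℕ → ℝ := fun k => 1 / ((k : ℝ) + 1)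
  have hε : ∀ k, 0 < ε k := fun k => by positivity
  have hε1 : ∀ k, ε k ≤ 1 := fun k => by
    rw [div_le_one (by positivity)]
    linarith [(Nat.cast_nonneg k : (0:ℝ) ≤ k)]
  have hεt : Tendsto ε atTop (𝓝 0) := tendsto_one_div_add_atTop_nhds_zero_nat
  refine ⟨fun k => secondDiff (ε k) H, fun k => secondDiff (ε k) G, fun k => secondDiff (ε k) V,
    fun k x hx => hasDerivAt_secondDiff hH (hε k) hx,
    fun k x hx => hasDerivAt_secondDiff hG (hε k) hx, fun k => ?_,
    fun k x hx => secondDiff_nonneg hV (hε k) hx, fun x hx => ?_, fun A B hA => ?_⟩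
  · have hs : ∀ c : ℝ, 0 ≤ c → ContinuousOn (fun x => V (x + c)) (Ioi 0) := fun c hc =>
      hVc.comp (by fun_prop) fun x (hx : 0 < x) => show 0 < x + c by linarith
    exact (((hs _ (by have := hε k; positivity)).sub ((hs _ (hε k).le).const_mul 2)).add
      hVc).div_const _
  · choose y hy e using fun k => exists_secondDiff_eq hH hG (hε k) hx
    simp only [e]
    have hyt : Tendsto y atTop (𝓝 x) := by
      refine tendsto_of_tendsto_of_tendsto_of_le_of_le tendsto_const_nhds
        (h := fun k => x + 2 * ε k) ?_ (fun k => (hy k).1) fun k => (hy k).2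
      simpa using (hεt.const_mul 2).const_add x
    exact (hVc.continuousAt (Ioi_mem_nhds hx)).tendsto.comp hyt
  · obtain ⟨M, hM⟩ := (isCompact_Icc (a := A) (b := B + 2)).exists_bound_of_continuousOn
      (hVc.mono fun x hx => hA.trans_le hx.1)
    refine ⟨M, fun k x hx => ?_⟩
    obtain ⟨y, hy, e⟩ := exists_secondDiff_eq hH hG (hε k) (hA.trans_le hx.1)
    change |secondDiff (ε k) H x| ≤ M
    rw [e]
    exact hM y ⟨hx.1.trans hy.1, by linarith [hy.2, hx.2, hε1 k]⟩

theorem tendsto_integral_of_tendsto_potential {a A B : ℝ} (hA : 0 < A) (hAB : A < B) {V : ℝ → ℝ}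
    {W : ℕ → ℝ → ℝ} (hWc : ∀ k, ContinuousOn (W k) (Ioi 0))
    (hW : ∀ x, 0 < x → Tendsto (fun k => W k x) atTop (𝓝 (V x)))
    (hM : ∃ M, ∀ k, ∀ x ∈ Icc A B, |W k x| ≤ M) {f : ℝ → ℝ} (hf : ContinuousOn f (Ioi 0)) :
    Tendsto (fun k => ∫ x in A..B, f x * (x ^ (a - 1) * Real.exp (-W k x))) atTop
      (𝓝 (∫ x in A..B, f x * (x ^ (a - 1) * Real.exp (-V x)))) := by
  obtain ⟨M, hM⟩ := hM
  have hB := hA.trans hAB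
  have hpow : ContinuousOn (fun x : ℝ => x ^ (a - 1)) (Ioi 0) := fun x hx =>
    (Real.continuousAt_rpow_const _ _ (Or.inl (ne_of_gt hx))).continuousWithinAt
  have hsub : uIoc A B ⊆ Ioi 0 := fun x hx => by
    rw [uIoc_of_le hAB.le] at hx
    exact hA.trans hx.1
  refine intervalIntegral.tendsto_integral_filter_of_dominated_convergence
    (fun x => |f x * x ^ (a - 1)| * Real.exp M) (Eventually.of_forall fun k => ?_)
    (Eventually.of_forall fun k => ae_of_all _ fun x hx => ?_) ?_ (ae_of_all _ fun x hx => ?_)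
  · have hk := hWc k
    have hc : ContinuousOn (fun x => f x * (x ^ (a - 1) * Real.exp (-W k x))) (Ioi 0) := by fun_prop
    exact (hc.mono hsub).aestronglyMeasurable measurableSet_uIoc
  · rw [← mul_assoc, norm_mul, Real.norm_eq_abs, Real.norm_eq_abs, Real.abs_exp]
    rw [uIoc_of_le hAB.le] at hx
    have := hM k x ⟨hx.1.le, hx.2⟩
    have := abs_le.1 this
    gcongr
    linarith
  · exact intervalIntegrable_of_continuousOn_Ioi (by fun_prop) hA hB
  · have := (hW x (hsub hx : x ∈ Ioi 0)).neg.rexp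
    exact (this.const_mul _).const_mul _

section Convex

variable {a A B : ℝ} {V : ℝ → ℝ}

theorem tendsto_intervalVar_of_tendsto_potential (hA : 0 < A) (hAB : A < B)
    {W : ℕ → ℝ → ℝ} (hWc : ∀ k, ContinuousOn (W k) (Ioi 0)) (hVc : ContinuousOn V (Ioi 0))
    (hW : ∀ x, 0 < x → Tendsto (fun k => W k x) atTop (𝓝 (V x)))
    (hM : ∃ M, ∀ k, ∀ x ∈ Icc A B, |W k x| ≤ M) {u : ℝ → ℝ} (hu : ContinuousOn u (Ioi 0)) :
    Tendsto (fun k => intervalVar A B (fun x => x ^ (a - 1) * Real.exp (-W k x)) u) atTop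
      (𝓝 (intervalVar A B (fun x => x ^ (a - 1) * Real.exp (-V x)) u)) := by
  have hpow : ContinuousOn (fun x : ℝ => x ^ (a - 1)) (Ioi 0) := fun x hx =>
    (Real.continuousAt_rpow_const _ _ (Or.inl (ne_of_gt hx))).continuousWithinAt
  have h1 := tendsto_integral_of_tendsto_potential (a := a) hA hAB hWc hW hM
    (f := fun _ => 1) (by fun_prop)
  simp only [one_mul] at h1
  have hN := integral_pos_of_continuousOn_Ioi (ρ := fun x => x ^ (a - 1) * Real.exp (-V x)) hA hAB
    (by fun_prop) fun x hx => by positivity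
  exact (tendsto_integral_of_tendsto_potential hA hAB hWc hW hM (by fun_prop)).sub
    (((tendsto_integral_of_tendsto_potential hA hAB hWc hW hM hu).pow 2).div h1 hN.ne')

/-- Only the density changes along the regularization; `u` and `h` stay fixed. Both sides therefore
pass to the limit by dominated convergence on `[A, B]`, using the uniform bound on the potentials.
-/
theorem convex_intervalVar_le (hA : 0 < A) (hAB : A < B) (ha : 1 < a)
    (hV : ConvexOn ℝ (Ioi 0) V) {u h : ℝ → ℝ}
    (hu : ∀ x, 0 < x → HasDerivAt u (h x) x) (hh : ContinuousOn h (Ioi 0)) :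
    intervalVar A B (fun x => x ^ (a - 1) * Real.exp (-V x)) u ≤
      ∫ x in A..B, x ^ 2 / (a - 1) * h x ^ 2 * (x ^ (a - 1) * Real.exp (-V x)) := by
  obtain ⟨W, W1, W2, hW, hW1, hW2, hW2n, hWt, hWM⟩ := exists_smooth_convex_approx hV
  have hWc : ∀ k, ContinuousOn (W k) (Ioi 0) := fun k x hx =>
    (hW k x hx).continuousAt.continuousWithinAt
  exact le_of_tendsto_of_tendsto'
    (tendsto_intervalVar_of_tendsto_potential hA hAB hWc (hV.continuousOn isOpen_Ioi) hWt
      (hWM A B hA) fun x hx => (hu x hx).continuousAt.continuousWithinAt)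
    (tendsto_integral_of_tendsto_potential hA hAB hWc hWt (hWM A B hA) (by fun_prop))
    fun k => smooth_intervalVar_le hA hAB ha (hW k) (hW1 k) (hW2 k) (hW2n k) hu hh

theorem convex_isPoincareConst (hA : 0 < A) (hAB : A < B) (ha : 1 < a)
    (hV : ConvexOn ℝ (Ioi 0) V) :
    IsPoincareConst A B (fun x => x ^ (a - 1) * Real.exp (-V x))
      ((∫ x in A..B, x ^ 2 * (x ^ (a - 1) * Real.exp (-V x))) /
        ((a - 1) * ∫ x in A..B, x ^ (a - 1) * Real.exp (-V x))) := by
  intro u h hu hh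
  obtain ⟨W, W1, W2, hW, hW1, hW2, hW2n, hWt, hWM⟩ := exists_smooth_convex_approx hV
  have hVc : ContinuousOn V (Ioi 0) := hV.continuousOn isOpen_Ioi
  have hWc : ∀ k, ContinuousOn (W k) (Ioi 0) := fun k x hx =>
    (hW k x hx).continuousAt.continuousWithinAt
  have hpow : ContinuousOn (fun x : ℝ => x ^ (a - 1)) (Ioi 0) := fun x hx =>
    (Real.continuousAt_rpow_const _ _ (Or.inl (ne_of_gt hx))).continuousWithinAt
  have h1 := tendsto_integral_of_tendsto_potential (a := a) hA hAB hWc hWt (hWM A B hA)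
    (f := fun _ => 1) (by fun_prop)
  simp only [one_mul] at h1
  have hN := integral_pos_of_continuousOn_Ioi (ρ := fun x => x ^ (a - 1) * Real.exp (-V x)) hA hAB
    (by fun_prop) fun x hx => by positivity
  exact le_of_tendsto_of_tendsto'
    (tendsto_intervalVar_of_tendsto_potential hA hAB hWc hVc hWt
      (hWM A B hA) fun x hx => (hu x hx).continuousAt.continuousWithinAt)
    (((tendsto_integral_of_tendsto_potential hA hAB hWc hWt (hWM A B hA) (by fun_prop)).div
      (h1.const_mul (a - 1)) (mul_ne_zero (by linarith) hN.ne')).mul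
      (tendsto_integral_of_tendsto_potential hA hAB hWc hWt (hWM A B hA) (by fun_prop)))
    fun k => smooth_isPoincareConst hA hAB ha (hW k) (hW1 k) (hW2 k) (hW2n k) u h hu hh

end Convex

end MultivariateLiouville

/-! ### Weighted tensorization of the variance -/

namespace MultivariateLiouville
open Filter Topology

section Variance

variable {X Y : Type*} [MeasurableSpace X] [MeasurableSpace Y] {lam : Measure X} {tau : Measure Y}

/-- Weighted Cauchy-Schwarz inequality. -/
theorem sq_integral_le_weighted {G w : X → ℝ} (hG : AEStronglyMeasurable G lam)
    (hw : ∀ᵐ x ∂lam, 0 < w x) (hwi : Integrable (fun x => (w x)⁻¹) lam)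
    (hwG : Integrable (fun x => w x * G x ^ 2) lam) :
    (∫ x, G x ∂lam) ^ 2 ≤ (∫ x, (w x)⁻¹ ∂lam) * ∫ x, w x * G x ^ 2 ∂lam := by
  have hGi : Integrable G lam := by
    refine (hwi.add hwG).mono' hG ?_
    filter_upwards [hw] with x hx
    rw [Real.norm_eq_abs]
    have h1 : 0 ≤ w x * (|G x| - (w x)⁻¹) ^ 2 := by positivity
    have h2 : w x * (|G x| - (w x)⁻¹) ^ 2 = w x * G x ^ 2 - 2 * |G x| + (w x)⁻¹ := by
      rw [← sq_abs (G x)]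
      field_simp
      ring
    have h3 := abs_nonneg (G x)
    simp only [Pi.add_apply]
    linarith
  -- The quadratic in `c` is `∫ w (G - c / w)²`; its discriminant is nonpositive.
  have key : ∀ c : ℝ, 0 ≤ (∫ x, (w x)⁻¹ ∂lam) * (c * c) + (-2 * ∫ x, G x ∂lam) * c +
      ∫ x, w x * G x ^ 2 ∂lam := by
    intro c
    have h0 : 0 ≤ ∫ x, ((c * c) * (w x)⁻¹ + (-2 * c) * G x + w x * G x ^ 2) ∂lam := by
      refine integral_nonneg_of_ae ?_
      filter_upwards [hw] with x hx
      have h1 : 0 ≤ w x * (G x - c * (w x)⁻¹) ^ 2 := by positivity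
      have h2 : w x * (G x - c * (w x)⁻¹) ^ 2 =
          (c * c) * (w x)⁻¹ + (-2 * c) * G x + w x * G x ^ 2 := by
        field_simp
        ring
      rw [h2] at h1
      exact h1
    have i1 : Integrable (fun x => (c * c) * (w x)⁻¹ + (-2 * c) * G x) lam :=
      (hwi.const_mul _).add (hGi.const_mul _)
    rw [integral_add i1 hwG,
      integral_add (hwi.const_mul _) (hGi.const_mul _), integral_const_mul,
      integral_const_mul] at h0
    linarith
  have := discrim_le_zero key
  rw [discrim] at this
  nlinarith

theorem sq_integral_le [IsProbabilityMeasure lam] {G : X → ℝ} (hG : AEStronglyMeasurable G lam)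
    (hG2 : Integrable (fun x => G x ^ 2) lam) :
    (∫ x, G x ∂lam) ^ 2 ≤ ∫ x, G x ^ 2 ∂lam := by
  have := sq_integral_le_weighted (w := fun _ => 1) hG (ae_of_all _ fun _ => one_pos)
    (integrable_const _) (by simpa using hG2)
  simpa using this

theorem integrable_of_integrable_sq [IsFiniteMeasure lam] {G : X → ℝ}
    (hG : AEStronglyMeasurable G lam) (hG2 : Integrable (fun x => G x ^ 2) lam) :
    Integrable G lam :=
  ((memLp_two_iff_integrable_sq hG).2 hG2).integrable (by norm_num)

theorem integrable_sq_integral_prod_left [SFinite lam] [IsProbabilityMeasure tau] {F : X × Y → ℝ}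
    (hF : AEStronglyMeasurable F (lam.prod tau))
    (hF2 : Integrable (fun z => F z ^ 2) (lam.prod tau)) :
    Integrable (fun x => (∫ y, F (x, y) ∂tau) ^ 2) lam := by
  refine hF2.integral_prod_left.mono' (hF.integral_prod_right'.pow 2) ?_
  filter_upwards [hF2.prod_right_ae, hF.prodMk_left] with x h1 h2
  rw [Real.norm_eq_abs, abs_of_nonneg (sq_nonneg _)]
  exact sq_integral_le h2 h1

theorem integrable_sq_integral_prod_right [IsProbabilityMeasure lam] [SFinite tau] {F : X × Y → ℝ}
    (hF : AEStronglyMeasurable F (lam.prod tau))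
    (hF2 : Integrable (fun z => F z ^ 2) (lam.prod tau)) :
    Integrable (fun y => (∫ x, F (x, y) ∂lam) ^ 2) tau :=
  integrable_sq_integral_prod_left (F := fun z => F z.swap) hF.prod_swap hF2.swap

/-- The variance of the second marginal average is controlled by weighted partial variances. -/
theorem variance_integral_le [IsProbabilityMeasure lam] [IsProbabilityMeasure tau] {F : X × Y → ℝ}
    {w : X → ℝ} {r : X → ℝ} (hF : AEStronglyMeasurable F (lam.prod tau))
    (hF2 : Integrable (fun z => F z ^ 2) (lam.prod tau))
    (hwm : AEStronglyMeasurable w lam) (hw : ∀ᵐ x ∂lam, 0 < w x)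
    (hwi : Integrable (fun x => (w x)⁻¹) lam) (hr : Integrable r lam)
    (hvar : ∀ᵐ x ∂lam, w x * ((∫ y, F (x, y) ^ 2 ∂tau) - (∫ y, F (x, y) ∂tau) ^ 2) ≤ r x) :
    (∫ y, (∫ x, F (x, y) ∂lam) ^ 2 ∂tau) - (∫ z, F z ∂(lam.prod tau)) ^ 2 ≤
      (∫ x, (w x)⁻¹ ∂lam) * ∫ x, r x ∂lam := by
  have hFi := integrable_of_integrable_sq hF hF2
  set b : X → ℝ := fun x => ∫ y, F (x, y) ∂tau with hb
  have hbi : Integrable b lam := hFi.integral_prod_left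
  have hb2 : Integrable (fun x => b x ^ 2) lam := integrable_sq_integral_prod_left hF hF2
  -- Each slice is centred in `y`. Averaging `G` over `x` gives the centred marginal average, so
  -- Cauchy-Schwarz in `x` for fixed `y`, followed by integration in `y`, produces the weighted
  -- partial variances.
  set G : X × Y → ℝ := fun z => F z - b z.1 with hG
  have hbm : AEStronglyMeasurable (fun z : X × Y => b z.1) (lam.prod tau) :=
    hbi.aestronglyMeasurable.comp_fst
  have hGm : AEStronglyMeasurable G (lam.prod tau) := hF.sub hbm
  have hwGm : AEStronglyMeasurable (fun z => w z.1 * G z ^ 2) (lam.prod tau) :=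
    hwm.comp_fst.mul (hGm.pow 2)
  have hslice : ∀ᵐ x ∂lam, Integrable (fun y => G (x, y) ^ 2) tau ∧ ∫ y, G (x, y) ^ 2 ∂tau =
      (∫ y, F (x, y) ^ 2 ∂tau) - b x ^ 2 := by
    filter_upwards [hF2.prod_right_ae, hFi.prod_right_ae] with x h1 h2
    have e : ∀ y, G (x, y) ^ 2 = F (x, y) ^ 2 + (-2 * b x) * F (x, y) + b x ^ 2 := fun y => by
      simp only [hG]; ring
    simp only [e]
    have i1 : Integrable (fun y => F (x, y) ^ 2 + (-2 * b x) * F (x, y)) tau :=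
      h1.add (h2.const_mul (-2 * b x))
    refine ⟨i1.add (integrable_const _), ?_⟩
    rw [integral_add i1 (integrable_const _), integral_add h1 (h2.const_mul _), integral_const_mul]
    simp only [hb, integral_const, probReal_univ, smul_eq_mul]
    ring
  have hnorm : ∀ᵐ x ∂lam, ∫ y, ‖w x * G (x, y) ^ 2‖ ∂tau =
      w x * ((∫ y, F (x, y) ^ 2 ∂tau) - b x ^ 2) := by
    filter_upwards [hslice, hw] with x h1 h2
    have e : ∀ y, ‖w x * G (x, y) ^ 2‖ = w x * G (x, y) ^ 2 := fun y => by
      rw [Real.norm_of_nonneg (by positivity)]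
    simp only [e]
    rw [integral_const_mul, h1.2]
  have hwG : Integrable (fun z => w z.1 * G z ^ 2) (lam.prod tau) := by
    rw [integrable_prod_iff hwGm]
    refine ⟨?_, hr.mono' hwGm.norm.integral_prod_right' ?_⟩
    · filter_upwards [hslice] with x h1
      exact h1.1.const_mul _
    · filter_upwards [hnorm, hvar] with x h1 h2
      rw [Real.norm_of_nonneg (integral_nonneg fun _ => norm_nonneg _), h1]
      exact h2
  set I := ∫ z, F z ∂(lam.prod tau) with hI
  have hIb : ∫ x, b x ∂lam = I := (integral_prod F hFi).symm
  set a : Y → ℝ := fun y => ∫ x, F (x, y) ∂lam with ha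
  have hIa : ∫ y, a y ∂tau = I := (integral_prod_symm F hFi).symm
  have ha2 : Integrable (fun y => a y ^ 2) tau := integrable_sq_integral_prod_right hF hF2
  have hai : Integrable a tau := hFi.integral_prod_right
  have e1 : ∀ y, (a y - I) ^ 2 = a y ^ 2 + (-2 * I) * a y + I ^ 2 := fun y => by ring
  have i1 : Integrable (fun y => a y ^ 2 + (-2 * I) * a y) tau := ha2.add (hai.const_mul _)
  have e2 : ∫ y, (a y - I) ^ 2 ∂tau = (∫ y, a y ^ 2 ∂tau) - I ^ 2 := by
    simp only [e1]
    rw [integral_add i1 (integrable_const _), integral_add ha2 (hai.const_mul _),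
      integral_const_mul, hIa]
    simp only [integral_const, probReal_univ, smul_eq_mul]
    ring
  rw [← e2]
  calc ∫ y, (a y - I) ^ 2 ∂tau
      ≤ ∫ y, (∫ x, (w x)⁻¹ ∂lam) * ∫ x, w x * G (x, y) ^ 2 ∂lam ∂tau := by
        refine integral_mono_ae ?_ (hwG.integral_prod_right.const_mul _) ?_
        · simp only [e1]
          exact i1.add (integrable_const _)
        · filter_upwards [hwG.prod_left_ae, hFi.prod_left_ae] with y h1 h2
          have e3 : a y - I = ∫ x, G (x, y) ∂lam := by
            simp only [hG]
            rw [integral_sub h2 hbi, hIb]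
          rw [e3]
          exact sq_integral_le_weighted (h2.sub hbi).aestronglyMeasurable hw hwi h1
    _ = (∫ x, (w x)⁻¹ ∂lam) * ∫ x, w x * ((∫ y, F (x, y) ^ 2 ∂tau) - b x ^ 2) ∂lam := by
        rw [integral_const_mul, ← integral_prod_symm _ hwG, integral_prod _ hwG]
        congr 1
        refine integral_congr_ae ?_
        filter_upwards [hslice] with x h1
        rw [integral_const_mul, h1.2]
    _ ≤ (∫ x, (w x)⁻¹ ∂lam) * ∫ x, r x ∂lam := by
        refine mul_le_mul_of_nonneg_left (integral_mono_ae ?_ hr hvar) (integral_nonneg_of_ae ?_)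
        · refine hwG.norm.integral_prod_left.congr ?_
          filter_upwards [hnorm] with x h1
          exact h1
        · filter_upwards [hw] with x hx using (inv_pos.2 hx).le

/-- Tensorization of variance with weights. -/
theorem variance_prod_le [IsProbabilityMeasure lam] [IsProbabilityMeasure tau] {F : X × Y → ℝ}
    {w : X → ℝ} {r : X → ℝ} {p : Y → ℝ} (hF : AEStronglyMeasurable F (lam.prod tau))
    (hF2 : Integrable (fun z => F z ^ 2) (lam.prod tau))
    (hp : Integrable p tau)
    (hvar' : ∀ᵐ y ∂tau, (∫ x, F (x, y) ^ 2 ∂lam) - (∫ x, F (x, y) ∂lam) ^ 2 ≤ p y)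
    (hwm : AEStronglyMeasurable w lam) (hw : ∀ᵐ x ∂lam, 0 < w x)
    (hwi : Integrable (fun x => (w x)⁻¹) lam) (hr : Integrable r lam)
    (hvar : ∀ᵐ x ∂lam, w x * ((∫ y, F (x, y) ^ 2 ∂tau) - (∫ y, F (x, y) ∂tau) ^ 2) ≤ r x) :
    (∫ z, F z ^ 2 ∂(lam.prod tau)) - (∫ z, F z ∂(lam.prod tau)) ^ 2 ≤
      (∫ y, p y ∂tau) + (∫ x, (w x)⁻¹ ∂lam) * ∫ x, r x ∂lam := by
  -- The total variance is the mean of the variances in `x` plus the variance of the mean over `x`.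
  -- The first part is controlled by `p` and the second by the weighted estimate.
  have h1 := variance_integral_le hF hF2 hwm hw hwi hr hvar
  have i1 := integrable_sq_integral_prod_right hF hF2
  have h2 := integral_mono_ae (hF2.integral_prod_right.sub i1) hp hvar'
  have h3 := integral_sub hF2.integral_prod_right i1
  have h4 := integral_prod_symm _ hF2
  simp only [Pi.sub_apply] at h2
  linarith

end Variance

/-! ### Product measures on boxes -/

section Box

theorem isOpen_orthant (n : ℕ) : IsOpen (orthant n) := by
  have : orthant n = Set.pi univ fun _ => Ioi 0 := by ext x; simp [orthant]
  rw [this]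
  exact isOpen_set_pi finite_univ fun _ _ => isOpen_Ioi

/-- The cube `[A, B]ⁿ`. -/
def cube (n : ℕ) (A B : ℝ) : Set (Fin n → ℝ) := Set.pi univ fun _ => Icc A B

theorem isCompact_cube (n : ℕ) (A B : ℝ) : IsCompact (cube n A B) :=
  isCompact_univ_pi fun _ => isCompact_Icc

theorem measurableSet_cube (n : ℕ) (A B : ℝ) : MeasurableSet (cube n A B) :=
  (isCompact_cube n A B).measurableSet

theorem cube_subset_orthant {n : ℕ} {A B : ℝ} (hA : 0 < A) : cube n A B ⊆ orthant n :=
  fun _ hx i => hA.trans_le (hx i (mem_univ i)).1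

theorem ae_mem_cube {n : ℕ} {A B : ℝ} {P : Fin n → Measure ℝ} [∀ i, IsProbabilityMeasure (P i)]
    (hP : ∀ i, ∀ᵐ x ∂P i, x ∈ Icc A B) : ∀ᵐ x ∂Measure.pi P, x ∈ cube n A B := by
  have : ∀ i, ∀ᵐ x ∂Measure.pi P, x i ∈ Icc A B := fun i =>
    (Measure.tendsto_eval_ae_ae (μ := P) (i := i)).eventually (hP i)
  filter_upwards [eventually_all.2 this] with x hx i _ using hx i

theorem integrable_pi_of_continuousOn {n : ℕ} {A B : ℝ} {P : Fin n → Measure ℝ}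
    [∀ i, IsProbabilityMeasure (P i)] (hA : 0 < A) (hP : ∀ i, ∀ᵐ x ∂P i, x ∈ Icc A B)
    {f : (Fin n → ℝ) → ℝ} (hf : ContinuousOn f (orthant n)) : Integrable f (Measure.pi P) := by
  have := (hf.mono (cube_subset_orthant (B := B) hA)).integrableOn_compact (isCompact_cube n A B)
    (μ := Measure.pi P)
  rwa [IntegrableOn, Measure.restrict_eq_self_of_ae_mem (ae_mem_cube hP)] at this

theorem cons_mem_orthant {n : ℕ} {t : ℝ} {y : Fin n → ℝ} (ht : 0 < t) (hy : y ∈ orthant n) :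
    (Fin.cons t y : Fin (n + 1) → ℝ) ∈ orthant (n + 1) := fun i => by
  refine Fin.cases ?_ (fun j => ?_) i
  · simpa using ht
  · simpa using hy j

/-- Induction on `n`: the first coordinate is split off and variance is tensorized with the constant
weight `1`. Concentration on a cube inside the orthant makes every continuous integrand integrable.
-/
theorem pi_variance_le {A B : ℝ} (hA : 0 < A) : ∀ (n : ℕ) (P : Fin n → Measure ℝ)
    [∀ i, IsProbabilityMeasure (P i)], (∀ i, ∀ᵐ x ∂P i, x ∈ Icc A B) →
    (∀ i, ∀ u h : ℝ → ℝ, (∀ x, 0 < x → HasDerivAt u (h x) x) → ContinuousOn h (Ioi 0) →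
      (∫ x, u x ^ 2 ∂P i) - (∫ x, u x ∂P i) ^ 2 ≤ ∫ x, x * h x ^ 2 ∂P i) →
    ∀ (F : (Fin n → ℝ) → ℝ) (D : Fin n → (Fin n → ℝ) → ℝ), ContinuousOn F (orthant n) →
      (∀ i, ContinuousOn (D i) (orthant n)) →
      (∀ i, ∀ x ∈ orthant n, HasDerivAt (fun t => F (Function.update x i t)) (D i x) (x i)) →
      (∫ x, F x ^ 2 ∂Measure.pi P) - (∫ x, F x ∂Measure.pi P) ^ 2 ≤
        ∑ i, ∫ x, x i * D i x ^ 2 ∂Measure.pi P := by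
  intro n
  induction n with
  | zero =>
    intro P _ _ _ F D _ _ _
    have e : ∀ x, F x = F 0 := fun x => by rw [Subsingleton.elim x 0]
    simp [e]
  | succ n ih =>
    intro P _ hP hgap F D hF hD hFD
    set Q : Fin n → Measure ℝ := fun j => P ((0 : Fin (n + 1)).succAbove j) with hQ
    have hmp := measurePreserving_piFinSuccAbove P 0
    have hQc : ∀ i, ∀ᵐ x ∂Q i, x ∈ Icc A B := fun i => hP _
    have hcons : ∀ z : ℝ × (Fin n → ℝ),
        (MeasurableEquiv.piFinSuccAbove (fun _ : Fin (n + 1) => ℝ) 0).symm z = Fin.cons z.1 z.2 :=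
      fun z => by
        simp [MeasurableEquiv.piFinSuccAbove, Fin.insertNthEquiv]
    have hint : ∀ f : (Fin (n + 1) → ℝ) → ℝ, ∫ x, f x ∂Measure.pi P =
        ∫ z : ℝ × (Fin n → ℝ), f (Fin.cons z.1 z.2) ∂((P 0).prod (Measure.pi Q)) := fun f => by
      rw [← hmp.symm.integral_comp (MeasurableEquiv.measurableEmbedding _)]
      simp only [hcons]
      rfl
    have hinte : ∀ f : (Fin (n + 1) → ℝ) → ℝ, ContinuousOn f (orthant (n + 1)) →
        Integrable (fun z : ℝ × (Fin n → ℝ) => f (Fin.cons z.1 z.2))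
          ((P 0).prod (Measure.pi Q)) := fun f hf => by
      have := (hmp.symm.integrable_comp_emb (MeasurableEquiv.measurableEmbedding _)).2
        (integrable_pi_of_continuousOn hA hP hf)
      refine this.congr (ae_of_all _ fun z => ?_)
      simp only [Function.comp, hcons]
    have hpos : ∀ᵐ x ∂P 0, 0 < x := (hP 0).mono fun x hx => hA.trans_le hx.1
    have hposQ : ∀ᵐ y ∂Measure.pi Q, y ∈ orthant n :=
      (ae_mem_cube hQc).mono fun y hy => cube_subset_orthant hA hy
    have hx : ∀ i : Fin (n + 1), ContinuousOn (fun x : Fin (n + 1) → ℝ => x i * D i x ^ 2)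
        (orthant (n + 1)) := fun i => (continuous_apply i).continuousOn.mul ((hD i).pow 2)
    have hc1 : ∀ y ∈ orthant n, ContinuousOn (fun t : ℝ => (Fin.cons t y : Fin (n + 1) → ℝ))
        (Ioi 0) := fun y _ =>
      (Continuous.finCons (A := fun _ => ℝ) continuous_id continuous_const).continuousOn
    have hc2 : ∀ t : ℝ, ContinuousOn (fun y : Fin n → ℝ => (Fin.cons t y : Fin (n + 1) → ℝ))
        (orthant n) := fun t =>
      (Continuous.finCons (A := fun _ => ℝ) continuous_const continuous_id).continuousOn
    have key := variance_prod_le (lam := P 0) (tau := Measure.pi Q)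
      (F := fun z => F (Fin.cons z.1 z.2)) (w := fun _ => 1)
      (p := fun y => ∫ x, x * D 0 (Fin.cons x y) ^ 2 ∂P 0)
      (r := fun x => ∑ j : Fin n, ∫ y : Fin n → ℝ, y j * D j.succ (Fin.cons x y) ^ 2 ∂Measure.pi Q)
      (hinte F hF).aestronglyMeasurable (hinte _ (hF.pow 2))
      ((hinte _ (hx 0)).integral_prod_right.congr (ae_of_all _ fun y => by simp)) ?_
      aestronglyMeasurable_const (ae_of_all _ fun _ => one_pos) (integrable_const _)
      (integrable_finsetSum _ fun j _ =>
        ((hinte _ (hx j.succ)).integral_prod_left.congr (ae_of_all _ fun y => by simp))) ?_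
    · rw [hint, hint]
      refine key.trans (le_of_eq ?_)
      rw [Fin.sum_univ_succ]
      congr 1
      · rw [hint, integral_prod_symm _ (hinte _ (hx 0))]
        simp
      · simp only [inv_one, integral_const, probReal_univ, smul_eq_mul, one_mul]
        rw [integral_finsetSum _ fun j _ =>
          ((hinte _ (hx j.succ)).integral_prod_left.congr (ae_of_all _ fun y => by simp))]
        refine Finset.sum_congr rfl fun j _ => ?_
        rw [hint, integral_prod _ (hinte _ (hx j.succ))]
        simp
    · filter_upwards [hposQ] with y hy
      refine hgap 0 (fun t => F (Fin.cons t y)) (fun t => D 0 (Fin.cons t y)) (fun t ht => ?_) ?_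
      · have := hFD 0 (Fin.cons t y) (cons_mem_orthant ht hy)
        simpa using this
      · exact (hD 0).comp (hc1 y hy) fun t ht => cons_mem_orthant ht hy
    · filter_upwards [hpos] with t ht
      rw [one_mul]
      refine ih Q hQc (fun j => hgap _) (fun y => F (Fin.cons t y))
        (fun j y => D j.succ (Fin.cons t y)) (hF.comp (hc2 t) fun y hy => cons_mem_orthant ht hy)
        (fun j => (hD j.succ).comp (hc2 t) fun y hy => cons_mem_orthant ht hy) fun j y hy => ?_
      have := hFD j.succ (Fin.cons t y) (cons_mem_orthant ht hy)
      simpa only [← Fin.cons_update, Fin.cons_succ] using this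

end Box

end MultivariateLiouville

/-! ### Radial laws and products of Gamma laws on compact sets -/

namespace MultivariateLiouville
open Filter Topology ENNReal

/-- The measure on `(0, ∞)` with density `c s ^ (a - 1) exp (-V s)`. -/
noncomputable def radial (c a : ℝ) (V : ℝ → ℝ) : Measure ℝ :=
  (volume.restrict (Ioi 0)).withDensity
    fun s => ENNReal.ofReal (c * (s ^ (a - 1) * Real.exp (-V s)))

section Radial

variable {c a A B : ℝ} {V : ℝ → ℝ}

theorem continuousOn_radial_density (hV : ContinuousOn V (Ioi 0)) :
    ContinuousOn (fun s => s ^ (a - 1) * Real.exp (-V s)) (Ioi 0) := by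
  have hpow : ContinuousOn (fun x : ℝ => x ^ (a - 1)) (Ioi 0) := fun x hx =>
    (Real.continuousAt_rpow_const _ _ (Or.inl (ne_of_gt hx))).continuousWithinAt
  fun_prop

theorem ae_radial_pos : ∀ᵐ s ∂radial c a V, 0 < s :=
  (withDensity_absolutelyContinuous _ _).ae_le (ae_restrict_mem measurableSet_Ioi)

theorem setIntegral_radial (hc : 0 ≤ c) (hA : 0 < A) (hAB : A < B) (hV : ContinuousOn V (Ioi 0))
    (f : ℝ → ℝ) : ∫ s in Icc A B, f s ∂radial c a V =
      c * ∫ s in A..B, f s * (s ^ (a - 1) * Real.exp (-V s)) := by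
  have hsub : Icc A B ⊆ Ioi 0 := fun x hx => hA.trans_le hx.1
  have hm : AEMeasurable (fun s => ENNReal.ofReal (c * (s ^ (a - 1) * Real.exp (-V s))))
      (volume.restrict (Icc A B)) :=
    (((continuousOn_radial_density hV).const_mul c).mono hsub).aemeasurable
      measurableSet_Icc |>.ennreal_ofReal
  rw [radial, restrict_withDensity measurableSet_Icc, Measure.restrict_restrict measurableSet_Icc,
    inter_eq_left.2 hsub,
    integral_withDensity_eq_integral_toReal_smul₀ hm (ae_of_all _ fun _ => ofReal_lt_top),
    intervalIntegral.integral_of_le hAB.le, ← integral_Icc_eq_integral_Ioc, ← integral_const_mul]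
  refine setIntegral_congr_fun measurableSet_Icc fun s hs => ?_
  have hs0 : 0 < s := hsub hs
  simp only [smul_eq_mul]
  rw [ENNReal.toReal_ofReal (by positivity)]
  ring

theorem measureReal_Icc_radial (hc : 0 ≤ c) (hA : 0 < A) (hAB : A < B)
    (hV : ContinuousOn V (Ioi 0)) : (radial c a V).real (Icc A B) =
      c * ∫ s in A..B, s ^ (a - 1) * Real.exp (-V s) := by
  have := setIntegral_radial (a := a) hc hA hAB hV fun _ => 1
  simpa using this

/-- The restricted measure is not normalized, so the variance is written as mass times second moment
minus squared mean. This form needs no division and converges to the true variance as the interval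
exhausts the half-line. -/
theorem radial_variance_eq (hc : 0 ≤ c) (hA : 0 < A) (hAB : A < B) (hV : ContinuousOn V (Ioi 0))
    (u : ℝ → ℝ) :
    (radial c a V).real (Icc A B) * (∫ s in Icc A B, u s ^ 2 ∂radial c a V) -
      (∫ s in Icc A B, u s ∂radial c a V) ^ 2 = c ^ 2 *
      (∫ s in A..B, s ^ (a - 1) * Real.exp (-V s)) *
        intervalVar A B (fun s => s ^ (a - 1) * Real.exp (-V s)) u := by
  have hN := integral_pos_of_continuousOn_Ioi hA hAB (continuousOn_radial_density (a := a) hV)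
    fun x hx => by positivity
  rw [measureReal_Icc_radial hc hA hAB hV, setIntegral_radial hc hA hAB hV,
    setIntegral_radial hc hA hAB hV, intervalVar]
  field_simp

theorem radial_variance_le_sq (hc : 0 ≤ c) (hA : 0 < A) (hAB : A < B) (ha : 1 < a)
    (hV : ConvexOn ℝ (Ioi 0) V) {u h : ℝ → ℝ}
    (hu : ∀ x, 0 < x → HasDerivAt u (h x) x) (hh : ContinuousOn h (Ioi 0)) :
    (radial c a V).real (Icc A B) * (∫ s in Icc A B, u s ^ 2 ∂radial c a V) -
      (∫ s in Icc A B, u s ∂radial c a V) ^ 2 ≤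
      (∫ _s in Icc A B, 1 ∂radial c a V) / (a - 1) *
        ∫ s in Icc A B, s ^ 2 * h s ^ 2 ∂radial c a V := by
  have hVc : ContinuousOn V (Ioi 0) := hV.continuousOn isOpen_Ioi
  have hN := integral_pos_of_continuousOn_Ioi hA hAB (continuousOn_radial_density (a := a) hVc)
    fun x hx => by positivity
  rw [radial_variance_eq hc hA hAB hVc, setIntegral_radial hc hA hAB hVc,
    setIntegral_radial hc hA hAB hVc]
  refine (mul_le_mul_of_nonneg_left (convex_intervalVar_le hA hAB ha hV hu hh)
    (by positivity)).trans (le_of_eq ?_)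
  have e : ∀ s, s ^ 2 / (a - 1) * h s ^ 2 * (s ^ (a - 1) * Real.exp (-V s)) =
      (a - 1)⁻¹ * (s ^ 2 * h s ^ 2 * (s ^ (a - 1) * Real.exp (-V s))) := fun s => by ring
  simp only [e, intervalIntegral.integral_const_mul, one_mul]
  ring

theorem radial_variance_le (hc : 0 ≤ c) (hA : 0 < A) (hAB : A < B) (ha : 1 < a)
    (hV : ConvexOn ℝ (Ioi 0) V) {u h : ℝ → ℝ}
    (hu : ∀ x, 0 < x → HasDerivAt u (h x) x) (hh : ContinuousOn h (Ioi 0)) :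
    (radial c a V).real (Icc A B) * (∫ s in Icc A B, u s ^ 2 ∂radial c a V) -
      (∫ s in Icc A B, u s ∂radial c a V) ^ 2 ≤
      (∫ s in Icc A B, s ^ 2 ∂radial c a V) / (a - 1) *
        ∫ s in Icc A B, h s ^ 2 ∂radial c a V := by
  have hVc : ContinuousOn V (Ioi 0) := hV.continuousOn isOpen_Ioi
  have hN := integral_pos_of_continuousOn_Ioi hA hAB (continuousOn_radial_density (a := a) hVc)
    fun x hx => by positivity
  have ha' : 0 < a - 1 := by linarith
  rw [radial_variance_eq hc hA hAB hVc, setIntegral_radial hc hA hAB hVc,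
    setIntegral_radial hc hA hAB hVc]
  refine (mul_le_mul_of_nonneg_left (convex_isPoincareConst hA hAB ha hV u h hu hh)
    (by positivity)).trans (le_of_eq ?_)
  field_simp

theorem radial_id_variance_le (hc : 0 ≤ c) (hA : 0 < A) (hAB : A < B) {u h : ℝ → ℝ}
    (hu : ∀ x, 0 < x → HasDerivAt u (h x) x) (hh : ContinuousOn h (Ioi 0)) :
    (radial c a id).real (Icc A B) * (∫ s in Icc A B, u s ^ 2 ∂radial c a id) -
      (∫ s in Icc A B, u s ∂radial c a id) ^ 2 ≤
      (radial c a id).real (Icc A B) * ∫ s in Icc A B, s * h s ^ 2 ∂radial c a id := by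
  have hVc : ContinuousOn (id : ℝ → ℝ) (Ioi 0) := continuousOn_id
  have hN := integral_pos_of_continuousOn_Ioi hA hAB (continuousOn_radial_density (a := a) hVc)
    fun x hx => by positivity
  rw [radial_variance_eq hc hA hAB hVc, setIntegral_radial hc hA hAB hVc,
    measureReal_Icc_radial hc hA hAB hVc]
  refine (mul_le_mul_of_nonneg_left (gamma_intervalVar_le hA hAB a hu hh)
    (by positivity)).trans (le_of_eq ?_)
  simp only [id]
  ring

end Radial

/-- The Gamma distribution with shape `a` and unit scale. -/
noncomputable def gammaOne (a : ℝ) : Measure ℝ := radial (Real.Gamma a)⁻¹ a id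

theorem lintegral_gammaOne_density {a : ℝ} (ha : 0 < a) :
    ∫⁻ s in Ioi (0:ℝ), ENNReal.ofReal (s ^ (a - 1) * Real.exp (-s)) =
      ENNReal.ofReal (Real.Gamma a) := by
  have hi := Real.GammaIntegral_convergent ha
  have e : ∀ s : ℝ, s ^ (a - 1) * Real.exp (-s) = Real.exp (-s) * s ^ (a - 1) :=
    fun s => mul_comm _ _
  simp only [e]
  rw [Real.Gamma_eq_integral ha, ofReal_integral_eq_lintegral_ofReal hi]
  filter_upwards [ae_restrict_mem measurableSet_Ioi] with s (hs : 0 < s)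
  simp only [Pi.zero_apply]
  positivity

theorem isProbabilityMeasure_gammaOne {a : ℝ} (ha : 0 < a) :
    IsProbabilityMeasure (gammaOne a) := by
  have hG := Real.Gamma_pos_of_pos ha
  constructor
  rw [gammaOne, radial, withDensity_apply _ MeasurableSet.univ, Measure.restrict_univ]
  have e : ∀ s : ℝ, ENNReal.ofReal ((Real.Gamma a)⁻¹ * (s ^ (a - 1) * Real.exp (-id s))) =
      ENNReal.ofReal (Real.Gamma a)⁻¹ * ENNReal.ofReal (s ^ (a - 1) * Real.exp (-s)) := fun s => by
    rw [ENNReal.ofReal_mul (by positivity), id]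
  simp only [e]
  rw [lintegral_const_mul' _ _ ofReal_ne_top, lintegral_gammaOne_density ha,
    ← ENNReal.ofReal_mul (by positivity), inv_mul_cancel₀ hG.ne', ofReal_one]

section Cube

variable {n : ℕ} {α : Fin n → ℝ}

/-- The product of unit scale Gamma distributions. -/
noncomputable def gammaPi (α : Fin n → ℝ) : Measure (Fin n → ℝ) :=
  Measure.pi fun i => gammaOne (α i)

theorem isProbabilityMeasure_gammaPi (hα : ∀ i, 0 < α i) :
    IsProbabilityMeasure (gammaPi α) := by
  have := fun i => isProbabilityMeasure_gammaOne (hα i)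
  unfold gammaPi
  infer_instance

theorem gammaOne_Icc_pos {a A B : ℝ} (ha : 0 < a) (hA : 0 < A) (hAB : A < B) :
    0 < (gammaOne a).real (Icc A B) := by
  have hG := Real.Gamma_pos_of_pos ha
  have hVc : ContinuousOn (id : ℝ → ℝ) (Ioi 0) := continuousOn_id
  rw [gammaOne, measureReal_Icc_radial (by positivity) hA hAB hVc]
  have := integral_pos_of_continuousOn_Ioi hA hAB (continuousOn_radial_density (a := a) hVc)
    fun x hx => by positivity
  positivity

/-- Conditioning a product measure on a cube conditions each factor, so the box inequality applies
to the normalized restrictions. Multiplying by the square of the mass of the cube removes the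
normalization. -/
theorem gammaPi_cube_variance_le (hα : ∀ i, 0 < α i) {A B : ℝ} (hA : 0 < A) (hAB : A < B)
    {F : (Fin n → ℝ) → ℝ} {D : Fin n → (Fin n → ℝ) → ℝ} (hF : ContinuousOn F (orthant n))
    (hD : ∀ i, ContinuousOn (D i) (orthant n))
    (hFD : ∀ i, ∀ x ∈ orthant n, HasDerivAt (fun t => F (Function.update x i t)) (D i x) (x i)) :
    (gammaPi α).real (cube n A B) * (∫ x in cube n A B, F x ^ 2 ∂gammaPi α) -
      (∫ x in cube n A B, F x ∂gammaPi α) ^ 2 ≤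
      (gammaPi α).real (cube n A B) *
        ∑ i, ∫ x in cube n A B, x i * D i x ^ 2 ∂gammaPi α := by
  have hprob := fun i => isProbabilityMeasure_gammaOne (hα i)
  have hpos := fun i => gammaOne_Icc_pos (hα i) hA hAB
  have hne : ∀ i, gammaOne (α i) (Icc A B) ≠ 0 := fun i h => by
    have := hpos i
    simp [Measure.real, h] at this
  set P : Fin n → Measure ℝ := fun i =>
    (gammaOne (α i) (Icc A B))⁻¹ • (gammaOne (α i)).restrict (Icc A B) with hP
  have hPp : ∀ i, IsProbabilityMeasure (P i) := fun i => ⟨by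
    simp only [hP, Measure.smul_apply, Measure.restrict_apply_univ, smul_eq_mul]
    exact ENNReal.inv_mul_cancel (hne i) (measure_ne_top _ _)⟩
  have hPi : Measure.pi P =
      (gammaPi α (cube n A B))⁻¹ • (gammaPi α).restrict (cube n A B) := by
    refine Measure.pi_eq fun s hs => ?_
    rw [Measure.smul_apply, Measure.restrict_apply (MeasurableSet.univ_pi hs), cube,
      ← Set.pi_inter_distrib, gammaPi, Measure.pi_pi, Measure.pi_pi, smul_eq_mul,
      ENNReal.prod_inv_distrib, ← Finset.prod_mul_distrib]
    · refine Finset.prod_congr rfl fun i _ => ?_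
      simp only [hP, Measure.smul_apply, Measure.restrict_apply (hs i), smul_eq_mul]
    · intro i _ j _ _
      exact Or.inl (hne i)
  have hreal : ∀ i (f : ℝ → ℝ), ∫ x, f x ∂P i =
      ((gammaOne (α i)).real (Icc A B))⁻¹ * ∫ x in Icc A B, f x ∂gammaOne (α i) := fun i f => by
    simp only [hP, integral_smul_measure, smul_eq_mul, ENNReal.toReal_inv, Measure.real]
  have hrealPi : ∀ f : (Fin n → ℝ) → ℝ, ∫ x, f x ∂Measure.pi P =
      ((gammaPi α).real (cube n A B))⁻¹ * ∫ x in cube n A B, f x ∂gammaPi α := fun f => by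
    simp only [hPi, integral_smul_measure, smul_eq_mul, ENNReal.toReal_inv, Measure.real]
  have hN : 0 < (gammaPi α).real (cube n A B) := by
    simp only [Measure.real, gammaPi, cube, Measure.pi_pi, ENNReal.toReal_prod]
    exact Finset.prod_pos fun i _ => hpos i
  have key := pi_variance_le hA n P (fun i => by
      have : (gammaOne (α i)).restrict (Icc A B) (Icc A B)ᶜ = 0 := by
        rw [Measure.restrict_apply measurableSet_Icc.compl]; simp
      rw [ae_iff]
      simp only [hP, Measure.smul_apply, smul_eq_mul]
      change _ * (gammaOne (α i)).restrict (Icc A B) (Icc A B)ᶜ = 0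
      rw [this, mul_zero])
    (fun i u h hu hh => by
      have h1 := radial_id_variance_le (a := α i) (inv_nonneg.2 (Real.Gamma_pos_of_pos (hα i)).le)
        hA hAB hu hh
      have h2 := hpos i
      rw [hreal, hreal, hreal]
      simp only [gammaOne] at h2 ⊢
      set N := (radial (Real.Gamma (α i))⁻¹ (α i) id).real (Icc A B)
      have h3 := mul_le_mul_of_nonneg_left h1 (by positivity : 0 ≤ (N ^ 2)⁻¹)
      refine le_trans (le_of_eq ?_) (h3.trans (le_of_eq ?_))
      · field_simp
      · field_simp)
    F D hF hD hFD
  simp only [hrealPi] at key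
  rw [← Finset.mul_sum] at key
  set N := (gammaPi α).real (cube n A B)
  have h3 := mul_le_mul_of_nonneg_left key (by positivity : 0 ≤ N ^ 2)
  refine le_trans (le_of_eq ?_) (h3.trans (le_of_eq ?_))
  · field_simp
  · field_simp

end Cube

end MultivariateLiouville

/-! ### Polar integration on the orthant -/

namespace MultivariateLiouville
open Filter Topology ENNReal

theorem lintegral_pi_prod : ∀ (n : ℕ) (m : Fin n → Measure ℝ) [∀ i, SigmaFinite (m i)]
    (f : Fin n → ℝ → ℝ≥0∞), (∀ i, Measurable (f i)) →
    ∫⁻ x, ∏ i, f i (x i) ∂Measure.pi m = ∏ i, ∫⁻ t, f i t ∂m i := by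
  intro n
  induction n with
  | zero =>
    intro m _ f _
    simp
  | succ n ih =>
    intro m _ f hf
    have hmp := measurePreserving_piFinSuccAbove m 0
    have hcons : ∀ z : ℝ × (Fin n → ℝ),
        (MeasurableEquiv.piFinSuccAbove (fun _ : Fin (n + 1) => ℝ) 0).symm z = Fin.cons z.1 z.2 :=
      fun z => by
        simp [MeasurableEquiv.piFinSuccAbove, Fin.insertNthEquiv]
    rw [← hmp.symm.lintegral_comp_emb (MeasurableEquiv.measurableEmbedding _)]
    simp only [hcons, Fin.prod_univ_succ, Fin.cons_zero, Fin.cons_succ]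
    rw [lintegral_prod_mul (f := f 0) (g := fun y : Fin n → ℝ => ∏ i : Fin n, f i.succ (y i))
      (hf 0).aemeasurable (Finset.measurable_prod _ fun i _ =>
        (hf i.succ).comp (measurable_pi_apply i)).aemeasurable]
    congr 1
    exact ih _ _ fun i => hf i.succ

theorem pi_withDensity {n : ℕ} (m : Fin n → Measure ℝ) [∀ i, SigmaFinite (m i)]
    (f : Fin n → ℝ → ℝ≥0∞) (hf : ∀ i, Measurable (f i))
    [∀ i, SigmaFinite ((m i).withDensity (f i))] :
    Measure.pi (fun i => (m i).withDensity (f i)) =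
      (Measure.pi m).withDensity fun x => ∏ i, f i (x i) := by
  refine Measure.pi_eq fun s hs => ?_
  rw [withDensity_apply _ (MeasurableSet.univ_pi hs), Measure.restrict_pi_pi,
    lintegral_pi_prod _ _ _ hf]
  exact Finset.prod_congr rfl fun i _ => (withDensity_apply _ (hs i)).symm

section Polar

variable {n : ℕ} {α : Fin n → ℝ}

/-- The projection of the orthant onto the standard simplex. -/
noncomputable def proj (x : Fin n → ℝ) : Fin n → ℝ := (∑ i, x i)⁻¹ • x

theorem measurable_proj : Measurable (proj : (Fin n → ℝ) → Fin n → ℝ) := by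
  unfold proj
  fun_prop

theorem sum_pos_of_mem_orthant (hn : 0 < n) {x : Fin n → ℝ} (hx : x ∈ orthant n) :
    0 < ∑ i, x i := by
  have : Nonempty (Fin n) := ⟨⟨0, hn⟩⟩
  exact Finset.sum_pos (fun i _ => hx i) Finset.univ_nonempty

theorem smul_mem_orthant {x : Fin n → ℝ} (hx : x ∈ orthant n) {t : ℝ} (ht : 0 < t) :
    t • x ∈ orthant n := fun i => mul_pos ht (hx i)

theorem sum_proj (hn : 0 < n) {x : Fin n → ℝ} (hx : x ∈ orthant n) : ∑ i, proj x i = 1 := by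
  have := sum_pos_of_mem_orthant hn hx
  simp only [proj, Pi.smul_apply, smul_eq_mul]
  rw [← Finset.mul_sum, inv_mul_cancel₀ this.ne']

theorem proj_mem_orthant (hn : 0 < n) {x : Fin n → ℝ} (hx : x ∈ orthant n) :
    proj x ∈ orthant n :=
  smul_mem_orthant hx (inv_pos.2 (sum_pos_of_mem_orthant hn hx))

theorem sum_smul_proj (hn : 0 < n) {x : Fin n → ℝ} (hx : x ∈ orthant n) (s : ℝ) :
    ∑ i, (s • proj x) i = s := by
  simp only [Pi.smul_apply, smul_eq_mul]
  rw [← Finset.mul_sum, sum_proj hn hx, mul_one]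

theorem proj_smul {x : Fin n → ℝ} {t : ℝ} (ht : t ≠ 0) : proj (t • x) = proj x := by
  ext i
  simp only [proj, Pi.smul_apply, smul_eq_mul, ← Finset.mul_sum, mul_inv]
  field_simp

theorem proj_proj (hn : 0 < n) {x : Fin n → ℝ} (hx : x ∈ orthant n) : proj (proj x) = proj x := by
  rw [show proj x = (∑ i, x i)⁻¹ • x from rfl,
    proj_smul (inv_ne_zero (sum_pos_of_mem_orthant hn hx).ne')]
  rfl

theorem lintegral_Ioi_scale {t : ℝ} (ht : 0 < t) (φ : ℝ → ℝ≥0∞) :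
    ∫⁻ r in Ioi (0:ℝ), φ r = ∫⁻ v in Ioi (0:ℝ), ENNReal.ofReal t * φ (t * v) := by
  have himg : (fun v => t * v) '' Ioi (0:ℝ) = Ioi 0 := by
    ext y
    simp only [mem_image, mem_Ioi]
    exact ⟨fun ⟨v, hv, e⟩ => e ▸ mul_pos ht hv, fun hy => ⟨y / t, div_pos hy ht, by field_simp⟩⟩
  have := lintegral_image_eq_lintegral_abs_deriv_mul (s := Ioi (0:ℝ)) (f := fun v => t * v)
    (f' := fun _ => t) measurableSet_Ioi
    (fun v _ => by simpa using ((hasDerivAt_id v).const_mul t).hasDerivWithinAt)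
    (fun v _ w _ h => mul_left_cancel₀ ht.ne' h) φ
  rw [himg, abs_of_pos ht] at this
  exact this

theorem lintegral_Ioi_inv {t : ℝ} (ht : 0 < t) (φ : ℝ → ℝ≥0∞) :
    ∫⁻ r in Ioi (0:ℝ), φ r = ∫⁻ v in Ioi (0:ℝ), ENNReal.ofReal (t / v ^ 2) * φ (t / v) := by
  have himg : (fun v => t / v) '' Ioi (0:ℝ) = Ioi 0 := by
    ext y
    simp only [mem_image, mem_Ioi]
    exact ⟨fun ⟨v, hv, e⟩ => e ▸ div_pos ht hv, fun hy => ⟨t / y, div_pos ht hy, by field_simp⟩⟩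
  have := lintegral_image_eq_lintegral_abs_deriv_mul (s := Ioi (0:ℝ)) (f := fun v => t / v)
    (f' := fun v => t * -(v ^ 2)⁻¹) measurableSet_Ioi
    (fun v (hv : 0 < v) => ((hasDerivAt_inv hv.ne').const_mul t).hasDerivWithinAt)
    (fun v (hv : 0 < v) w (hw : 0 < w) h => by
      simp only at h
      field_simp at h
      linarith) φ
  rw [himg] at this
  rw [this]
  refine setLIntegral_congr_fun measurableSet_Ioi fun v (hv : 0 < v) => ?_
  rw [mul_neg, abs_neg, abs_of_pos (by positivity)]
  rfl

theorem lintegral_orthant_scale {v : ℝ} (hv : 0 < v) {φ : (Fin n → ℝ) → ℝ≥0∞}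
    (hφ : Measurable φ) :
    ∫⁻ x in orthant n, φ x = ∫⁻ z in orthant n, ENNReal.ofReal (v ^ n) * φ (v • z) := by
  have hm : MeasurableSet (orthant n) := (isOpen_orthant n).measurableSet
  have h1 := Measure.map_addHaar_smul (volume : Measure (Fin n → ℝ)) hv.ne'
  have h2 : ∫⁻ z in orthant n, φ (v • z) =
      ∫⁻ x in orthant n, φ x ∂(Measure.map (v • ·) (volume : Measure (Fin n → ℝ))) := by
    rw [setLIntegral_map hm hφ (measurable_const_smul v)]
    congr 2
    ext z
    simp only [mem_preimage, orthant, mem_ofPred_eq, Pi.smul_apply, smul_eq_mul]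
    exact forall_congr' fun i => (mul_pos_iff_of_pos_left hv).symm
  rw [lintegral_const_mul' _ _ ofReal_ne_top, h2, h1, Measure.restrict_smul,
    lintegral_smul_measure, smul_eq_mul, ← mul_assoc, ← ENNReal.ofReal_mul (by positivity)]
  have : v ^ n * |(v ^ Module.finrank ℝ (Fin n → ℝ))⁻¹| = 1 := by
    rw [Module.finrank_fin_fun, abs_of_pos (by positivity), mul_inv_cancel₀ (by positivity)]
  rw [this, ofReal_one, one_mul]

/-- The density of independent powers. -/
noncomputable def powProd (α : Fin n → ℝ) (x : Fin n → ℝ) : ℝ := ∏ i, x i ^ (α i - 1)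

theorem measurable_powProd : Measurable (powProd α) := by
  unfold powProd
  fun_prop

theorem powProd_pos {x : Fin n → ℝ} (hx : x ∈ orthant n) : 0 < powProd α x :=
  Finset.prod_pos fun i _ => Real.rpow_pos_of_pos (hx i) _

/-- The factor `v ^ n` is the Jacobian of the dilation; together they are homogeneous of degree
`|α|`. -/
theorem powProd_smul {x : Fin n → ℝ} (hx : x ∈ orthant n) {v : ℝ} (hv : 0 < v) :
    v ^ n * powProd α (v • x) = v ^ (∑ i, α i) * powProd α x := by
  have h : ∀ i, (v • x) i ^ (α i - 1) = v ^ (α i - 1) * x i ^ (α i - 1) := fun i => by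
    rw [Pi.smul_apply, smul_eq_mul, Real.mul_rpow hv.le (hx i).le]
  simp only [powProd, h, Finset.prod_mul_distrib]
  rw [← Real.rpow_sum_of_pos hv, Finset.sum_sub_distrib, Real.rpow_sub hv, ← mul_assoc]
  congr 1
  simp only [Finset.sum_const, Finset.card_univ, Fintype.card_fin, nsmul_eq_mul, mul_one,
    Real.rpow_natCast]
  field_simp

/-- Substituting first `s = (∑ xᵢ) / v` and then `x = v z` turns `s • proj x` into `z`. What remains
in `v` is a Gamma integral in the variable `(∑ zᵢ) v`. Only Lebesgue measure on the orthant appears,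
so no surface measure on the simplex is needed. -/
theorem lintegral_polar (hn : 0 < n) (hα : ∀ i, 0 < α i) {H : (Fin n → ℝ) → ℝ≥0∞}
    (hH : Measurable H) :
    ∫⁻ x in orthant n, ∫⁻ s in Ioi (0:ℝ), H (s • proj x) * ENNReal.ofReal (s ^ ((∑ i, α i) - 1)) *
      ENNReal.ofReal (powProd α x * Real.exp (-∑ i, x i)) =
    ENNReal.ofReal (Real.Gamma (∑ i, α i)) *
      ∫⁻ x in orthant n, H x * ENNReal.ofReal (powProd α x) := by
  have : Nonempty (Fin n) := ⟨⟨0, hn⟩⟩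
  set a := ∑ i, α i with ha
  have ha0 : 0 < a := Finset.sum_pos (fun i _ => hα i) Finset.univ_nonempty
  have hm : MeasurableSet (orthant n) := (isOpen_orthant n).measurableSet
  have hpm := measurable_powProd (α := α)
  have hsum : Measurable fun x : Fin n → ℝ => ∑ i, x i := by fun_prop
  calc _ = ∫⁻ x in orthant n, ∫⁻ v in Ioi (0:ℝ), H (v⁻¹ • x) * ENNReal.ofReal
          ((∑ i, x i) ^ a * (v ^ (-a - 1)) * powProd α x * Real.exp (-∑ i, x i)) := by
        refine setLIntegral_congr_fun hm fun x hx => ?_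
        have hx0 := sum_pos_of_mem_orthant hn hx
        rw [lintegral_Ioi_inv hx0]
        refine setLIntegral_congr_fun measurableSet_Ioi fun v (hv : 0 < v) => ?_
        have hp := powProd_pos (α := α) hx
        set t := ∑ i, x i
        have e1 : (t / v) • proj x = v⁻¹ • x := by
          rw [proj, smul_smul]
          congr 1
          change t / v * t⁻¹ = v⁻¹
          field_simp
        rw [e1, mul_assoc, mul_left_comm, ← ENNReal.ofReal_mul (by positivity),
          ← ENNReal.ofReal_mul (by positivity)]
        congr 2
        rw [Real.div_rpow hx0.le hv.le, Real.rpow_sub_one hx0.ne', Real.rpow_sub_one hv.ne',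
          Real.rpow_sub_one hv.ne', Real.rpow_neg hv.le]
        field_simp
    _ = ∫⁻ v in Ioi (0:ℝ), ∫⁻ x in orthant n, H (v⁻¹ • x) * ENNReal.ofReal
          ((∑ i, x i) ^ a * (v ^ (-a - 1)) * powProd α x * Real.exp (-∑ i, x i)) := by
        refine lintegral_lintegral_swap (Measurable.aemeasurable ?_)
        have h1 : Measurable fun z : (Fin n → ℝ) × ℝ => H (z.2⁻¹ • z.1) :=
          hH.comp (measurable_snd.inv.smul measurable_fst)
        have h2 : Measurable fun z : (Fin n → ℝ) × ℝ => ∑ i, z.1 i := hsum.comp measurable_fst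
        have h3 : Measurable fun z : (Fin n → ℝ) × ℝ => powProd α z.1 := hpm.comp measurable_fst
        exact h1.mul ((((h2.pow_const a).mul (measurable_snd.pow_const _)).mul h3).mul
          h2.neg.exp).ennreal_ofReal
    _ = ∫⁻ v in Ioi (0:ℝ), ∫⁻ z in orthant n, H z * ENNReal.ofReal (powProd α z) *
          ENNReal.ofReal ((∑ i, z i) * ((∑ i, z i) * v) ^ (a - 1) *
            Real.exp (-((∑ i, z i) * v))) := by
        refine setLIntegral_congr_fun measurableSet_Ioi fun v (hv : 0 < v) => ?_
        rw [lintegral_orthant_scale hv (by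
          refine (hH.comp (measurable_const_smul _)).mul (Measurable.ennreal_ofReal ?_)
          fun_prop)]
        refine setLIntegral_congr_fun hm fun z hz => ?_
        have hz0 := sum_pos_of_mem_orthant hn hz
        have hp := powProd_pos (α := α) hz
        have hp' := powProd_pos (α := α) (smul_mem_orthant hz hv)
        have e := powProd_smul (α := α) hz hv
        rw [← ha] at e
        have e0 : ∑ i, (v • z) i = v * ∑ i, z i := by
          simp only [Pi.smul_apply, smul_eq_mul, Finset.mul_sum]
        rw [e0]
        set t := ∑ i, z i
        rw [smul_smul, inv_mul_cancel₀ hv.ne', one_smul, mul_left_comm, mul_assoc (H z),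
          ← ENNReal.ofReal_mul (by positivity), ← ENNReal.ofReal_mul (by positivity)]
        congr 2
        have e2 : v ^ n * ((v * t) ^ a * v ^ (-a - 1) * powProd α (v • z) * Real.exp (-(v * t))) =
          (v * t) ^ a * v ^ (-a - 1) * (v ^ n * powProd α (v • z)) * Real.exp (-(v * t)) := by ring
        rw [e2, e, mul_comm v t, Real.mul_rpow hz0.le hv.le, Real.mul_rpow hz0.le hv.le,
          Real.rpow_sub_one hz0.ne', Real.rpow_sub_one hv.ne', Real.rpow_sub_one hv.ne',
          Real.rpow_neg hv.le]
        field_simp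
    _ = ∫⁻ z in orthant n, ∫⁻ v in Ioi (0:ℝ), H z * ENNReal.ofReal (powProd α z) *
          ENNReal.ofReal ((∑ i, z i) * ((∑ i, z i) * v) ^ (a - 1) *
            Real.exp (-((∑ i, z i) * v))) := by
        refine lintegral_lintegral_swap (Measurable.aemeasurable ?_)
        have h1 : Measurable fun z : ℝ × (Fin n → ℝ) => H z.2 := hH.comp measurable_snd
        have h2 : Measurable fun z : ℝ × (Fin n → ℝ) => ∑ i, z.2 i := hsum.comp measurable_snd
        have h3 : Measurable fun z : ℝ × (Fin n → ℝ) => powProd α z.2 := hpm.comp measurable_snd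
        exact (h1.mul h3.ennreal_ofReal).mul (((h2.mul ((h2.mul measurable_fst).pow_const _)).mul
          (h2.mul measurable_fst).neg.exp).ennreal_ofReal)
    _ = ∫⁻ z in orthant n, H z * ENNReal.ofReal (powProd α z) *
          ENNReal.ofReal (Real.Gamma a) := by
        refine setLIntegral_congr_fun hm fun z hz => ?_
        have hz0 := sum_pos_of_mem_orthant hn hz
        rw [lintegral_const_mul _ (Measurable.ennreal_ofReal (by fun_prop)),
          ← lintegral_gammaOne_density ha0,
          lintegral_Ioi_scale hz0 (fun s => ENNReal.ofReal (s ^ (a - 1) * Real.exp (-s)))]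
        congr 1
        refine setLIntegral_congr_fun measurableSet_Ioi fun v (hv : 0 < v) => ?_
        rw [← ENNReal.ofReal_mul hz0.le, mul_assoc]
    _ = _ := by
        rw [lintegral_mul_const' _ _ ofReal_ne_top, mul_comm]

end Polar

end MultivariateLiouville

/-! ### The Liouville law as a product of radius and direction -/

namespace MultivariateLiouville
open Filter Topology ENNReal

section Representation

variable {n : ℕ} {α : Fin n → ℝ}

theorem gammaPi_eq_withDensity (hα : ∀ i, 0 < α i) :
    gammaPi α = (volume.restrict (orthant n)).withDensity fun x => ENNReal.ofReal
      ((∏ i, (Real.Gamma (α i))⁻¹) * (powProd α x * Real.exp (-∑ i, x i))) := by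
  have hprob := fun i => isProbabilityMeasure_gammaOne (hα i)
  simp only [gammaOne, radial] at hprob
  have hpi : (volume.restrict (orthant n) : Measure (Fin n → ℝ)) =
      Measure.pi fun _ : Fin n => (volume : Measure ℝ).restrict (Ioi 0) := by
    rw [← Measure.restrict_pi_pi, volume_pi]
    congr 1
    ext x
    simp [orthant]
  simp only [gammaPi, gammaOne, radial]
  rw [pi_withDensity _ _ fun i => Measurable.ennreal_ofReal (by fun_prop), ← hpi]
  refine withDensity_congr_ae ?_
  filter_upwards [ae_restrict_mem (isOpen_orthant n).measurableSet] with x hx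
  rw [← ENNReal.ofReal_prod_of_nonneg]
  · congr 1
    simp only [Finset.prod_mul_distrib, id, ← Real.exp_sum, Finset.sum_neg_distrib, powProd]
  · intro i _
    have h1 := Real.Gamma_pos_of_pos (hα i)
    have h2 := hx i
    positivity

theorem ae_gammaPi_mem_orthant (hα : ∀ i, 0 < α i) : ∀ᵐ x ∂gammaPi α, x ∈ orthant n := by
  rw [gammaPi_eq_withDensity hα]
  exact (withDensity_absolutelyContinuous _ _).ae_le
    (ae_restrict_mem (isOpen_orthant n).measurableSet)

theorem lintegral_gammaPi (hα : ∀ i, 0 < α i) (H : (Fin n → ℝ) → ℝ≥0∞) :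
    ∫⁻ x, H x ∂gammaPi α = ENNReal.ofReal (∏ i, (Real.Gamma (α i))⁻¹) *
      ∫⁻ x in orthant n, H x * ENNReal.ofReal (powProd α x * Real.exp (-∑ i, x i)) := by
  have hG : 0 < ∏ i, (Real.Gamma (α i))⁻¹ :=
    Finset.prod_pos fun i _ => inv_pos.2 (Real.Gamma_pos_of_pos (hα i))
  have hm : Measurable fun x : Fin n → ℝ => ENNReal.ofReal
      ((∏ i, (Real.Gamma (α i))⁻¹) * (powProd α x * Real.exp (-∑ i, x i))) := by
    have := measurable_powProd (α := α)
    exact Measurable.ennreal_ofReal (by fun_prop)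
  rw [gammaPi_eq_withDensity hα, lintegral_withDensity_eq_lintegral_mul_non_measurable _ hm
    (ae_of_all _ fun _ => ofReal_lt_top), ← lintegral_const_mul' _ _ ofReal_ne_top]
  refine lintegral_congr fun x => ?_
  rw [Pi.mul_apply, ENNReal.ofReal_mul hG.le]
  ring

theorem lintegral_radial {c a : ℝ} (hc : 0 < c) {V : ℝ → ℝ} (hV : Measurable V)
    (H : ℝ → ℝ≥0∞) : ∫⁻ s, H s ∂radial c a V = ENNReal.ofReal c *
      ∫⁻ s in Ioi (0:ℝ), H s * ENNReal.ofReal (s ^ (a - 1) * Real.exp (-V s)) := by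
  have hm : Measurable fun s : ℝ => ENNReal.ofReal (c * (s ^ (a - 1) * Real.exp (-V s))) :=
    Measurable.ennreal_ofReal (by fun_prop)
  rw [radial, lintegral_withDensity_eq_lintegral_mul_non_measurable _ hm
    (ae_of_all _ fun _ => ofReal_lt_top), ← lintegral_const_mul' _ _ ofReal_ne_top]
  refine lintegral_congr fun x => ?_
  rw [Pi.mul_apply, ENNReal.ofReal_mul hc.le]
  ring

theorem setLIntegral_orthant_swap {H : (Fin n → ℝ) → ℝ → ℝ≥0∞}
    (hH : Measurable fun z : (Fin n → ℝ) × ℝ => H z.1 z.2) :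
    ∫⁻ x in orthant n, ∫⁻ s in Ioi (0:ℝ), H x s = ∫⁻ s in Ioi (0:ℝ), ∫⁻ x in orthant n, H x s :=
  lintegral_lintegral_swap hH.aemeasurable

/-- The map `(s, x) ↦ s x / |x|`. -/
noncomputable def polarMap (z : ℝ × (Fin n → ℝ)) : Fin n → ℝ := z.1 • proj z.2

theorem measurable_polarMap : Measurable (polarMap : ℝ × (Fin n → ℝ) → Fin n → ℝ) :=
  measurable_fst.smul (measurable_proj.comp measurable_snd)

/-- Polar decomposition of a Liouville distribution. -/
theorem map_polarMap (hn : 0 < n) (hα : ∀ i, 0 < α i) {c Z : ℝ} (hZ : 0 < Z)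
    (hc : c = (∏ i, Real.Gamma (α i)) / (Real.Gamma (∑ i, α i) * Z)) {V : ℝ → ℝ}
    (hV : Measurable V) :
    Measure.map polarMap ((radial c (∑ i, α i) V).prod (gammaPi α)) =
      (volume.restrict (orthant n)).withDensity
        fun x => ENNReal.ofReal (Z⁻¹ * powProd α x * Real.exp (-V (∑ i, x i))) := by
  have : Nonempty (Fin n) := ⟨⟨0, hn⟩⟩
  have hprob := isProbabilityMeasure_gammaPi hα
  have ha0 : 0 < ∑ i, α i := Finset.sum_pos (fun i _ => hα i) Finset.univ_nonempty
  have hΓ := Real.Gamma_pos_of_pos ha0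
  have hG : 0 < ∏ i, Real.Gamma (α i) := Finset.prod_pos fun i _ => Real.Gamma_pos_of_pos (hα i)
  have hc0 : 0 < c := by rw [hc]; positivity
  have hpm := measurable_powProd (α := α)
  refine Measure.ext_of_lintegral _ fun H hH => ?_
  rw [lintegral_map hH measurable_polarMap,
    lintegral_prod (fun z => H (polarMap z)) (hH.comp measurable_polarMap).aemeasurable, lintegral_radial hc0 hV]
  simp only [polarMap, lintegral_gammaPi hα]
  have hm1 : Measurable fun z : (Fin n → ℝ) × ℝ => H (z.2 • proj z.1) :=
    hH.comp (measurable_snd.smul (measurable_proj.comp measurable_fst))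
  have hm2 : Measurable fun z : (Fin n → ℝ) × ℝ => powProd α z.1 * Real.exp (-∑ i, z.1 i) := by
    have h1 : Measurable fun z : (Fin n → ℝ) × ℝ => powProd α z.1 := hpm.comp measurable_fst
    fun_prop
  have hm3 : Measurable fun z : (Fin n → ℝ) × ℝ =>
      z.2 ^ ((∑ i, α i) - 1) * Real.exp (-V z.2) := by fun_prop
  have e1 : ∀ s : ℝ, (ENNReal.ofReal (∏ i, (Real.Gamma (α i))⁻¹) *
      ∫⁻ x in orthant n, H (s • proj x) * ENNReal.ofReal (powProd α x * Real.exp (-∑ i, x i))) *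
      ENNReal.ofReal (s ^ ((∑ i, α i) - 1) * Real.exp (-V s)) =
      ENNReal.ofReal (∏ i, (Real.Gamma (α i))⁻¹) *
      ∫⁻ x in orthant n, H (s • proj x) * ENNReal.ofReal (powProd α x * Real.exp (-∑ i, x i)) *
        ENNReal.ofReal (s ^ ((∑ i, α i) - 1) * Real.exp (-V s)) := fun s => by
    rw [lintegral_mul_const' _ _ ofReal_ne_top, mul_assoc]
  simp only [e1]
  rw [lintegral_const_mul' _ _ ofReal_ne_top, ← setLIntegral_orthant_swap
    (H := fun x s => H (s • proj x) * ENNReal.ofReal (powProd α x * Real.exp (-∑ i, x i)) *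
        ENNReal.ofReal (s ^ ((∑ i, α i) - 1) * Real.exp (-V s)))
    ((hm1.mul hm2.ennreal_ofReal).mul hm3.ennreal_ofReal)]
  -- The coordinates of `s • proj x` sum to `s`, so the factor `exp (-V s)` can be absorbed into the
  -- test function before polar integration.
  have e2 : ∫⁻ x in orthant n, ∫⁻ s in Ioi (0:ℝ), H (s • proj x) *
        ENNReal.ofReal (powProd α x * Real.exp (-∑ i, x i)) *
        ENNReal.ofReal (s ^ ((∑ i, α i) - 1) * Real.exp (-V s)) =
      ∫⁻ x in orthant n, ∫⁻ s in Ioi (0:ℝ), (H (s • proj x) *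
        ENNReal.ofReal (Real.exp (-V (∑ i, (s • proj x) i)))) *
        ENNReal.ofReal (s ^ ((∑ i, α i) - 1)) *
        ENNReal.ofReal (powProd α x * Real.exp (-∑ i, x i)) := by
    refine setLIntegral_congr_fun (isOpen_orthant n).measurableSet fun x hx =>
      setLIntegral_congr_fun measurableSet_Ioi fun s (hs : 0 < s) => ?_
    rw [sum_smul_proj hn hx, ENNReal.ofReal_mul (p := s ^ ((∑ i, α i) - 1)) (by positivity)]
    ring
  have hm4 : Measurable fun x : Fin n → ℝ =>
      ENNReal.ofReal (Z⁻¹ * powProd α x * Real.exp (-V (∑ i, x i))) :=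
    Measurable.ennreal_ofReal (by fun_prop)
  rw [e2, lintegral_polar hn hα (H := fun x => H x * ENNReal.ofReal (Real.exp (-V (∑ i, x i))))
    (hH.mul (Measurable.ennreal_ofReal (by fun_prop))),
    lintegral_withDensity_eq_lintegral_mul_non_measurable _ hm4
    (ae_of_all _ fun _ => ofReal_lt_top), ← mul_assoc, ← mul_assoc,
    ← ENNReal.ofReal_mul hc0.le, ← ENNReal.ofReal_mul (by rw [Finset.prod_inv_distrib]; positivity),
    ← lintegral_const_mul' _ _ ofReal_ne_top]
  refine setLIntegral_congr_fun (isOpen_orthant n).measurableSet fun x hx => ?_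
  have hp := powProd_pos (α := α) hx
  have e3 : c * (∏ i, (Real.Gamma (α i))⁻¹) * Real.Gamma (∑ i, α i) = Z⁻¹ := by
    rw [hc, Finset.prod_inv_distrib]
    field_simp
  rw [e3, Pi.mul_apply, ENNReal.ofReal_mul (by positivity), ENNReal.ofReal_mul (by positivity)]
  ring

/-- Independence of the direction and the total mass under a product of Gamma distributions. -/
theorem map_proj_gammaPi_withDensity (hn : 0 < n) (hα : ∀ i, 0 < α i) (p : ℝ) (hp : 0 ≤ p) :
    Measure.map proj ((gammaPi α).withDensity fun x => ENNReal.ofReal ((∑ i, x i) ^ p)) =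
      ENNReal.ofReal (Real.Gamma ((∑ i, α i) + p) / Real.Gamma (∑ i, α i)) •
        Measure.map proj (gammaPi α) := by
  have : Nonempty (Fin n) := ⟨⟨0, hn⟩⟩
  have ha0 : 0 < ∑ i, α i := Finset.sum_pos (fun i _ => hα i) Finset.univ_nonempty
  have hΓ := Real.Gamma_pos_of_pos ha0
  have hΓp := Real.Gamma_pos_of_pos (by linarith : 0 < (∑ i, α i) + p)
  have hpm := measurable_powProd (α := α)
  refine Measure.ext_of_lintegral _ fun F hF => ?_
  have hFp : Measurable fun x : Fin n → ℝ => F (proj x) := hF.comp measurable_proj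
  rw [lintegral_smul_measure, lintegral_map hF measurable_proj, lintegral_map hF measurable_proj,
    lintegral_withDensity_eq_lintegral_mul_non_measurable _ (Measurable.ennreal_ofReal
      (by fun_prop)) (ae_of_all _ fun _ => ofReal_lt_top), lintegral_gammaPi hα,
    lintegral_gammaPi hα, smul_eq_mul]
  have e1 : ENNReal.ofReal (Real.Gamma (∑ i, α i)) *
      ∫⁻ x in orthant n, ((fun x : Fin n → ℝ => ENNReal.ofReal ((∑ i, x i) ^ p)) * fun x => F (proj x)) x *
        ENNReal.ofReal (powProd α x * Real.exp (-∑ i, x i)) =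
      ENNReal.ofReal (Real.Gamma ((∑ i, α i) + p)) *
      ∫⁻ x in orthant n, F (proj x) * ENNReal.ofReal (powProd α x * Real.exp (-∑ i, x i)) := by
    -- For this test function the inner integral in `s` no longer involves the direction and equals
    -- `Γ(|α| + p)`.
    have hl := lintegral_polar hn hα (H := fun x => F (proj x) *
      ENNReal.ofReal ((∑ i, x i) ^ p * Real.exp (-∑ i, x i)))
      (hFp.mul (Measurable.ennreal_ofReal (by fun_prop)))
    have e2 : ∫⁻ x in orthant n, ((fun x : Fin n → ℝ => ENNReal.ofReal ((∑ i, x i) ^ p)) *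
        fun x => F (proj x)) x * ENNReal.ofReal (powProd α x * Real.exp (-∑ i, x i)) =
        ∫⁻ x in orthant n, F (proj x) *
        ENNReal.ofReal ((∑ i, x i) ^ p * Real.exp (-∑ i, x i)) * ENNReal.ofReal (powProd α x) := by
      refine setLIntegral_congr_fun (isOpen_orthant n).measurableSet fun x hx => ?_
      have h1 := powProd_pos (α := α) hx
      have h2 := sum_pos_of_mem_orthant hn hx
      rw [Pi.mul_apply, ENNReal.ofReal_mul (by positivity), ENNReal.ofReal_mul (by positivity)]
      ring
    rw [e2, ← hl, ← lintegral_const_mul' _ _ ofReal_ne_top]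
    refine setLIntegral_congr_fun (isOpen_orthant n).measurableSet fun x hx => ?_
    rw [← lintegral_gammaOne_density (by linarith : 0 < (∑ i, α i) + p),
      ← lintegral_mul_const _ (Measurable.ennreal_ofReal (by fun_prop))]
    refine setLIntegral_congr_fun measurableSet_Ioi fun s (hs : 0 < s) => ?_
    rw [sum_smul_proj hn hx, proj_smul hs.ne', proj_proj hn hx, ← mul_assoc]
    congr 1
    rw [mul_assoc, ← ENNReal.ofReal_mul (by positivity), mul_comm]
    have : (∑ i, α i) + p - 1 = p + ((∑ i, α i) - 1) := by ring
    rw [this, Real.rpow_add hs]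
    congr 2
    ring
  rw [ENNReal.ofReal_div_of_pos hΓ, mul_left_comm, div_eq_mul_inv]
  congr 1
  rw [mul_right_comm, ← div_eq_mul_inv, ← e1, mul_comm, mul_div_assoc, mul_comm]
  rw [ENNReal.mul_div_cancel (by simpa using hΓ) ofReal_ne_top]

end Representation

end MultivariateLiouville

/-! ### Mollification of weakly differentiable functions -/

namespace MultivariateLiouville
open Filter Topology ENNReal
open scoped Convolution

section Mollify

theorem lintegral_enorm_sq {X : Type*} [MeasurableSpace X] (m : Measure X) (f : X → ℝ) :
    ∫⁻ x, ‖f x‖ₑ ^ 2 ∂m = eLpNorm f 2 m ^ 2 := by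
  have := eLpNorm_nnreal_pow_eq_lintegral (f := f) (μ := m) (p := 2) (by norm_num)
  simp only [NNReal.coe_ofNat, ENNReal.rpow_ofNat, ENNReal.coe_ofNat] at this
  exact this.symm

variable {n : ℕ}

/-- Translations act continuously on `L²`; the integral is the squared distance to the translate. -/
theorem tendsto_lintegral_translate_sub {u : (Fin n → ℝ) → ℝ} (hu : MemLp u 2 volume) :
    Tendsto (fun t : Fin n → ℝ => ∫⁻ x, ‖u (x - t) - u x‖ₑ ^ 2) (𝓝 0) (𝓝 0) := by
  have hmp : ∀ t : Fin n → ℝ, MeasurePreserving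
      (⇑(⟨fun x => x - t, by fun_prop⟩ : C(Fin n → ℝ, Fin n → ℝ))) volume volume := fun t =>
    measurePreserving_sub_right volume t
  have hc : Continuous fun t : Fin n → ℝ => Lp.compMeasurePreserving
      (⇑(⟨fun x => x - t, by fun_prop⟩ : C(Fin n → ℝ, Fin n → ℝ))) (hmp t) (hu.toLp u) :=
    Continuous.compMeasurePreservingLp continuous_const
      (ContinuousMap.continuous_of_continuous_uncurry _ (by
        simp only [Function.uncurry_def, ContinuousMap.coe_mk]
        fun_prop)) hmp (by norm_num)
  have h0 := (hc.tendsto 0).edist (tendsto_const_nhds (x := hu.toLp u))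
  have e0 : Lp.compMeasurePreserving
      (⇑(⟨fun x => x - 0, by fun_prop⟩ : C(Fin n → ℝ, Fin n → ℝ))) (hmp 0) (hu.toLp u) =
      hu.toLp u := by
    rw [Lp.toLp_compMeasurePreserving]
    exact MemLp.toLp_congr _ _ (ae_of_all _ fun x => by simp)
  rw [e0, edist_self] at h0
  have h1 := (ENNReal.continuous_pow 2).tendsto (0:ℝ≥0∞) |>.comp h0
  simp only [ne_eq, OfNat.ofNat_ne_zero, not_false_eq_true, zero_pow] at h1
  refine h1.congr fun t => ?_
  rw [Function.comp_apply, Lp.toLp_compMeasurePreserving, Lp.edist_toLp_toLp, ← lintegral_enorm_sq]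
  rfl

/-- Jensen's inequality for the probability measure with density `w`. -/
theorem enorm_sq_integral_le {X : Type*} [MeasurableSpace X] (m : Measure X) {w d : X → ℝ}
    (hw : Measurable w) (hw0 : ∀ x, 0 ≤ w x) (hw1 : ∫⁻ x, ENNReal.ofReal (w x) ∂m = 1)
    (hd : Measurable d) :
    ‖∫ x, w x * d x ∂m‖ₑ ^ 2 ≤ ∫⁻ x, ENNReal.ofReal (w x) * ‖d x‖ₑ ^ 2 ∂m := by
  have hm : Measurable fun x => ENNReal.ofReal (w x) := hw.ennreal_ofReal
  have hp : IsProbabilityMeasure (m.withDensity fun x => ENNReal.ofReal (w x)) := ⟨by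
    rw [withDensity_apply _ MeasurableSet.univ, Measure.restrict_univ, hw1]⟩
  have h1 : ‖∫ x, w x * d x ∂m‖ₑ ≤
      eLpNorm d 1 (m.withDensity fun x => ENNReal.ofReal (w x)) := by
    rw [eLpNorm_one_eq_lintegral_enorm, lintegral_withDensity_eq_lintegral_mul _ hm hd.enorm]
    refine (enorm_integral_le_lintegral_enorm _).trans (le_of_eq (lintegral_congr fun x => ?_))
    rw [enorm_mul, Pi.mul_apply, Real.enorm_eq_ofReal (hw0 x)]
  have h2 := eLpNorm_le_eLpNorm_of_exponent_le (μ := m.withDensity fun x => ENNReal.ofReal (w x))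
    (p := 1) (q := 2) (by norm_num) hd.aestronglyMeasurable
  calc _ ≤ eLpNorm d 2 (m.withDensity fun x => ENNReal.ofReal (w x)) ^ 2 := by
        gcongr
        exact h1.trans h2
    _ = _ := by
        rw [← lintegral_enorm_sq, lintegral_withDensity_eq_lintegral_mul _ hm (hd.enorm.pow_const 2)]
        rfl

/-- Convolution against a normed bump function. -/
noncomputable def mollify (φ : ContDiffBump (0 : Fin n → ℝ)) (u : (Fin n → ℝ) → ℝ)
    (x : Fin n → ℝ) : ℝ := ∫ t, u t * φ.normed volume (x - t)

theorem mollify_eq_convolution (φ : ContDiffBump (0 : Fin n → ℝ)) (u : (Fin n → ℝ) → ℝ) :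
    mollify φ u = u ⋆[ContinuousLinearMap.mul ℝ ℝ, volume] φ.normed volume := rfl

/-- The error is the average of `u (x - t) - u x` over `t` in the support of the bump; Jensen and
Tonelli reduce it to the translation estimate. -/
theorem lintegral_mollify_sub_le {u : (Fin n → ℝ) → ℝ} (hum : Measurable u)
    (hu : MemLp u 2 volume) {φ : ContDiffBump (0 : Fin n → ℝ)} {ε : ℝ≥0∞}
    (hε : ∀ t ∈ Metric.ball (0 : Fin n → ℝ) φ.rOut, ∫⁻ x, ‖u (x - t) - u x‖ₑ ^ 2 ≤ ε) :
    ∫⁻ x, ‖mollify φ u x - u x‖ₑ ^ 2 ≤ ε := by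
  have hφc : Continuous (φ.normed volume) := φ.continuous_normed
  have hφi := φ.integrable_normed (μ := volume)
  have hφ1 : ∫⁻ t, ENNReal.ofReal (φ.normed volume t) = 1 := by
    rw [← ofReal_integral_eq_lintegral_ofReal hφi (ae_of_all _ φ.nonneg_normed),
      φ.integral_normed, ofReal_one]
  have hloc : LocallyIntegrable u volume := hu.locallyIntegrable (by norm_num)
  have key : ∀ x, ‖mollify φ u x - u x‖ₑ ^ 2 ≤
      ∫⁻ t, ENNReal.ofReal (φ.normed volume t) * ‖u (x - t) - u x‖ₑ ^ 2 := fun x => by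
    have e : mollify φ u x - u x = ∫ t, φ.normed volume t * (u (x - t) - u x) := by
      have e1 : mollify φ u x = ∫ t, φ.normed volume t * u (x - t) := by
        rw [mollify, ← integral_sub_left_eq_self _ volume x]
        simp [mul_comm]
      have hex : Integrable fun t => φ.normed volume t * u (x - t) :=
        φ.hasCompactSupport_normed.convolutionExists_left (ContinuousLinearMap.mul ℝ ℝ) hφc hloc x
      simp only [mul_sub]
      rw [integral_sub hex (hφi.mul_const _), integral_mul_const, φ.integral_normed, one_mul, e1]
    rw [e]
    exact enorm_sq_integral_le volume hφc.measurable φ.nonneg_normed hφ1 (by fun_prop)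
  calc _ ≤ ∫⁻ x, ∫⁻ t, ENNReal.ofReal (φ.normed volume t) * ‖u (x - t) - u x‖ₑ ^ 2 :=
        lintegral_mono key
    _ = ∫⁻ t, ∫⁻ x, ENNReal.ofReal (φ.normed volume t) * ‖u (x - t) - u x‖ₑ ^ 2 := by
        refine lintegral_lintegral_swap (Measurable.aemeasurable ?_)
        have := hφc.measurable
        fun_prop
    _ ≤ ∫⁻ t, ENNReal.ofReal (φ.normed volume t) * ε := by
        refine lintegral_mono fun t => ?_
        rw [lintegral_const_mul' _ _ ofReal_ne_top]
        by_cases ht : t ∈ Metric.ball (0 : Fin n → ℝ) φ.rOut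
        · gcongr
          exact hε t ht
        · have : φ.normed volume t = 0 := by
            rw [← Function.notMem_support, φ.support_normed_eq]
            exact ht
          simp [this]
    _ = ε := by rw [lintegral_mul_const _ hφc.measurable.ennreal_ofReal, hφ1, one_mul]

theorem contDiff_mollify {u : (Fin n → ℝ) → ℝ} (hu : LocallyIntegrable u volume)
    (φ : ContDiffBump (0 : Fin n → ℝ)) : ContDiff ℝ 1 (mollify φ u) := by
  rw [mollify_eq_convolution]
  exact φ.hasCompactSupport_normed.contDiff_convolution_right (n := 1) _ hu φ.contDiff_normed

theorem fderiv_mollify {u : (Fin n → ℝ) → ℝ} (hu : LocallyIntegrable u volume)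
    (φ : ContDiffBump (0 : Fin n → ℝ)) (x v : Fin n → ℝ) :
    fderiv ℝ (mollify φ u) x v = ∫ t, u t * fderiv ℝ (φ.normed volume) (x - t) v := by
  have hφ1 : ContDiff ℝ 1 (φ.normed (volume : Measure (Fin n → ℝ))) := φ.contDiff_normed
  rw [mollify_eq_convolution,
    (φ.hasCompactSupport_normed.hasFDerivAt_convolution_right _ hu hφ1 x).fderiv,
    convolution_precompR_apply _ hu (φ.hasCompactSupport_normed.fderiv ℝ)
      (hφ1.continuous_fderiv one_ne_zero)]
  rfl

/-- The test function `t ↦ φ (x - t)` lives in the ball around `x`, hence inside `K'`, so the cutoff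
is invisible. The sign from differentiating in `t` cancels the sign in the weak derivative. -/
theorem fderiv_mollify_indicator {Ω K' : Set (Fin n → ℝ)} {f : (Fin n → ℝ) → ℝ}
    {Df : Fin n → (Fin n → ℝ) → ℝ} (hf : HasWeakGradientOn Ω f Df)
    (hK'Ω : K' ⊆ Ω) (hu : LocallyIntegrable (K'.indicator f) volume)
    (φ : ContDiffBump (0 : Fin n → ℝ)) {x : Fin n → ℝ} (hx : Metric.closedBall x φ.rOut ⊆ K')
    (i : Fin n) :
    fderiv ℝ (mollify φ (K'.indicator f)) x (Pi.single i 1) =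
      mollify φ (K'.indicator (Df i)) x := by
  rw [fderiv_mollify hu]
  set ψ : (Fin n → ℝ) → ℝ := fun t => φ.normed volume (x - t) with hψ
  have hts : tsupport (φ.normed (volume : Measure (Fin n → ℝ))) = Metric.closedBall 0 φ.rOut :=
    φ.tsupport_normed_eq
  have hout : ∀ t, t ∉ K' → x - t ∉ tsupport (φ.normed (volume : Measure (Fin n → ℝ))) :=
    fun t ht h => ht (hx (by
      rw [hts, mem_closedBall_zero_iff] at h
      rwa [Metric.mem_closedBall, dist_comm, dist_eq_norm]))
  have hφ1 : ContDiff ℝ (⊤ : ℕ∞) (φ.normed (volume : Measure (Fin n → ℝ))) := φ.contDiff_normed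
  have hψd : ContDiff ℝ (⊤ : ℕ∞) ψ := hφ1.comp (contDiff_const.sub contDiff_id)
  have hsub : Function.support ψ ⊆ Metric.closedBall x φ.rOut := fun t ht => by
    have : x - t ∈ Metric.closedBall (0 : Fin n → ℝ) φ.rOut := by
      rw [← hts]
      exact subset_tsupport _ ht
    rw [mem_closedBall_zero_iff] at this
    rwa [Metric.mem_closedBall, dist_comm, dist_eq_norm]
  have htsub : tsupport ψ ⊆ Metric.closedBall x φ.rOut :=
    closure_minimal hsub Metric.isClosed_closedBall
  have hcs : HasCompactSupport ψ :=
    (isCompact_closedBall x φ.rOut).of_isClosed_subset (isClosed_tsupport _) htsub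
  have hfd : ∀ t, fderiv ℝ ψ t (Pi.single i 1) =
      -fderiv ℝ (φ.normed volume) (x - t) (Pi.single i 1) := fun t => by
    have h1 : HasFDerivAt ψ ((fderiv ℝ (φ.normed volume) (x - t)).comp
        (-ContinuousLinearMap.id ℝ (Fin n → ℝ))) t :=
      ((hφ1.differentiable (by simp)) (x - t)).hasFDerivAt.comp t ((hasFDerivAt_id t).const_sub x)
    rw [h1.fderiv]
    simp
  have hw := hf.integral_eq ψ hψd hcs ((htsub.trans hx).trans hK'Ω) i
  simp only [hfd, mul_neg, integral_neg, neg_inj] at hw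
  have h0 : ∀ t, t ∉ K' → φ.normed volume (x - t) = 0 := fun t ht =>
    image_eq_zero_of_notMem_tsupport (hout t ht)
  have h0' : ∀ t, t ∉ K' → fderiv ℝ (φ.normed volume) (x - t) (Pi.single i 1) = 0 := fun t ht => by
    have : fderiv ℝ (φ.normed volume) (x - t) = 0 :=
      image_eq_zero_of_notMem_tsupport fun h => hout t ht (tsupport_fderiv_subset ℝ h)
    rw [this]
    rfl
  rw [setIntegral_eq_integral_of_forall_compl_eq_zero
      (fun t ht => by rw [h0' t fun h => ht (hK'Ω h), mul_zero]),
    setIntegral_eq_integral_of_forall_compl_eq_zero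
      (fun t ht => by simp only [hψ]; rw [h0 t fun h => ht (hK'Ω h), mul_zero])] at hw
  calc _ = ∫ t, f t * fderiv ℝ (φ.normed volume) (x - t) (Pi.single i 1) := by
        refine integral_congr_ae (ae_of_all _ fun t => ?_)
        by_cases ht : t ∈ K'
        · simp [ht]
        · simp [h0' t ht]
    _ = ∫ t, Df i t * ψ t := hw
    _ = _ := by
        refine integral_congr_ae (ae_of_all _ fun t => ?_)
        by_cases ht : t ∈ K'
        · simp [ht, hψ]
        · simp [h0 t ht, hψ]

/-- Local approximation of weakly differentiable functions by smooth ones. -/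
theorem exists_smooth_approx {Ω K : Set (Fin n → ℝ)} (hΩ : IsOpen Ω) (hK : IsCompact K)
    (hKΩ : K ⊆ Ω) {f : (Fin n → ℝ) → ℝ} {Df : Fin n → (Fin n → ℝ) → ℝ} (hfm : Measurable f)
    (hDm : ∀ i, Measurable (Df i)) (hf : HasWeakGradientOn Ω f Df)
    (hf2 : ∀ K' ⊆ Ω, IsCompact K' → IntegrableOn (fun x => f x ^ 2) K')
    (hD2 : ∀ i, ∀ K' ⊆ Ω, IsCompact K' → IntegrableOn (fun x => Df i x ^ 2) K')
    {ε : ℝ≥0∞} (hε : 0 < ε) :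
    ∃ F : (Fin n → ℝ) → ℝ, ContDiff ℝ 1 F ∧ ∫⁻ x in K, ‖F x - f x‖ₑ ^ 2 ≤ ε ∧
      ∀ i, ∫⁻ x in K, ‖fderiv ℝ F x (Pi.single i 1) - Df i x‖ₑ ^ 2 ≤ ε := by
  obtain ⟨δ, hδ, hδΩ⟩ := hK.exists_cthickening_subset_open hΩ hKΩ
  set K' := Metric.cthickening δ K
  have hK' : IsCompact K' := hK.cthickening
  have hind : ∀ g : (Fin n → ℝ) → ℝ, Measurable g → IntegrableOn (fun x => g x ^ 2) K' →
      Measurable (K'.indicator g) ∧ MemLp (K'.indicator g) 2 volume := fun g hg hg2 => by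
    refine ⟨hg.indicator hK'.measurableSet, ?_⟩
    rw [memLp_indicator_iff_restrict hK'.measurableSet]
    exact (memLp_two_iff_integrable_sq hg.aestronglyMeasurable).2 hg2
  have hu := hind f hfm (hf2 K' hδΩ hK')
  have hv := fun i => hind (Df i) (hDm i) (hD2 i K' hδΩ hK')
  have hev : ∀ᶠ t in 𝓝 (0 : Fin n → ℝ),
      (∫⁻ x, ‖K'.indicator f (x - t) - K'.indicator f x‖ₑ ^ 2 ≤ ε) ∧
      ∀ i, ∫⁻ x, ‖K'.indicator (Df i) (x - t) - K'.indicator (Df i) x‖ₑ ^ 2 ≤ ε :=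
    ((tendsto_lintegral_translate_sub hu.2).eventually_le_const hε).and
      (eventually_all.2 fun i =>
        (tendsto_lintegral_translate_sub (hv i).2).eventually_le_const hε)
  obtain ⟨r, hr, hball⟩ := Metric.eventually_nhds_iff_ball.1 hev
  have hρ : 0 < min r δ := lt_min hr hδ
  -- The radius is below `r` for the `L²` estimates and below `δ` so that balls around points of `K`
  -- remain in the thickening `K'`.
  set φ : ContDiffBump (0 : Fin n → ℝ) := ⟨min r δ / 2, min r δ, by positivity, by linarith⟩
  have hφr : φ.rOut = min r δ := rfl
  have hsub : ∀ t ∈ Metric.ball (0 : Fin n → ℝ) φ.rOut, t ∈ Metric.ball (0 : Fin n → ℝ) r :=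
    fun t ht => Metric.ball_subset_ball (by rw [hφr]; exact min_le_left _ _) ht
  have hKK' : K ⊆ K' := Metric.self_subset_cthickening K
  have hloc := hu.2.locallyIntegrable (by norm_num)
  refine ⟨mollify φ (K'.indicator f), contDiff_mollify hloc φ, ?_, fun i => ?_⟩
  · refine le_trans ?_ (lintegral_mollify_sub_le hu.1 hu.2 fun t ht => (hball t (hsub t ht)).1)
    refine (setLIntegral_congr_fun hK.measurableSet fun x hx => ?_).trans_le
      (setLIntegral_le_lintegral K _)
    simp [hKK' hx]
  · refine le_trans ?_
      (lintegral_mollify_sub_le (hv i).1 (hv i).2 fun t ht => (hball t (hsub t ht)).2 i)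
    refine (setLIntegral_congr_fun hK.measurableSet fun x hx => ?_).trans_le
      (setLIntegral_le_lintegral K _)
    have hcb : Metric.closedBall x φ.rOut ⊆ K' :=
      (Metric.closedBall_subset_closedBall (by rw [hφr]; exact min_le_right _ _)).trans
        (Metric.closedBall_subset_cthickening hx δ)
    rw [fderiv_mollify_indicator hf hδΩ hloc φ hcb i]
    simp [hKK' hx]

end Mollify

end MultivariateLiouville

/-! ### Convergence in `L²` and approximation along slices -/

namespace MultivariateLiouville
open Filter Topology ENNReal

section L2

variable {X : Type*} [MeasurableSpace X] {m : Measure X}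

/-- Convergence in `L²(m)` of square integrable functions. -/
structure L2Tendsto (m : Measure X) (u : ℕ → X → ℝ) (v : X → ℝ) : Prop where
  memLp : ∀ k, MemLp (u k) 2 m
  memLp_lim : MemLp v 2 m
  tendsto : Tendsto (fun k => eLpNorm (u k - v) 2 m) atTop (𝓝 0)

theorem L2Tendsto.of_lintegral {u : ℕ → X → ℝ} {v : X → ℝ} (hu : ∀ k, MemLp (u k) 2 m)
    (hv : AEStronglyMeasurable v m)
    (h : Tendsto (fun k => ∫⁻ x, ‖u k x - v x‖ₑ ^ 2 ∂m) atTop (𝓝 0)) : L2Tendsto m u v := by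
  have ht : Tendsto (fun k => eLpNorm (u k - v) 2 m) atTop (𝓝 0) := by
    have h1 := (ENNReal.continuous_rpow_const (y := 1 / 2)).tendsto (0:ℝ≥0∞) |>.comp h
    rw [ENNReal.zero_rpow_of_pos (by norm_num)] at h1
    refine h1.congr fun k => ?_
    have := lintegral_enorm_sq m (u k - v)
    simp only [Pi.sub_apply] at this
    rw [Function.comp_apply, this, ← ENNReal.rpow_natCast, ← ENNReal.rpow_mul]
    norm_num
  refine ⟨hu, ?_, ht⟩
  -- The limit is square integrable because it differs from one `u k` by a function of finite norm.
  obtain ⟨k, hk⟩ := (ht.eventually_lt_const (zero_lt_one' ℝ≥0∞)).exists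
  have h1 : MemLp (u k - v) 2 m :=
    ⟨(hu k).aestronglyMeasurable.sub hv, hk.trans one_lt_top⟩
  have h2 := (hu k).sub h1
  have h3 : u k - (u k - v) = v := by ext; simp
  rwa [h3] at h2

theorem L2Tendsto.add {u u' : ℕ → X → ℝ} {v v' : X → ℝ} (h : L2Tendsto m u v)
    (h' : L2Tendsto m u' v') : L2Tendsto m (fun k => u k + u' k) (v + v') := by
  refine ⟨fun k => (h.memLp k).add (h'.memLp k), h.memLp_lim.add h'.memLp_lim, ?_⟩
  have := h.tendsto.add h'.tendsto
  rw [add_zero] at this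
  refine tendsto_of_tendsto_of_tendsto_of_le_of_le tendsto_const_nhds this (fun _ => zero_le)
    fun k => ?_
  simp only
  rw [add_sub_add_comm]
  exact eLpNorm_add_le ((h.memLp k).sub h.memLp_lim).aestronglyMeasurable
    ((h'.memLp k).sub h'.memLp_lim).aestronglyMeasurable (by norm_num)

theorem L2Tendsto.zero : L2Tendsto m (fun _ => (0 : X → ℝ)) 0 :=
  ⟨fun _ => MemLp.zero, MemLp.zero, by simp⟩

theorem L2Tendsto.sum {ι : Type*} (t : Finset ι) {u : ι → ℕ → X → ℝ} {v : ι → X → ℝ}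
    (h : ∀ i, L2Tendsto m (u i) (v i)) :
    L2Tendsto m (fun k => ∑ i ∈ t, u i k) (∑ i ∈ t, v i) := by
  classical
  induction t using Finset.induction_on with
  | empty => simpa using L2Tendsto.zero
  | insert i t hi ih => simpa only [Finset.sum_insert hi] using (h i).add ih

theorem L2Tendsto.mul_bounded {u : ℕ → X → ℝ} {v w : X → ℝ} (h : L2Tendsto m u v)
    (hw : AEStronglyMeasurable w m) {M : ℝ} (hM : ∀ᵐ x ∂m, |w x| ≤ M) :
    L2Tendsto m (fun k => w * u k) (w * v) := by
  have hb : ∀ g : X → ℝ, ∀ᵐ x ∂m, ‖(w * g) x‖ ≤ M * ‖g x‖ := fun g => by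
    filter_upwards [hM] with x hx
    rw [Pi.mul_apply, norm_mul]
    exact mul_le_mul_of_nonneg_right hx (norm_nonneg _)
  refine ⟨fun k => (h.memLp k).of_le_mul (hw.mul (h.memLp k).aestronglyMeasurable) (hb _),
    h.memLp_lim.of_le_mul (hw.mul h.memLp_lim.aestronglyMeasurable) (hb _), ?_⟩
  have := ENNReal.Tendsto.const_mul (a := ENNReal.ofReal M) h.tendsto (Or.inr ofReal_ne_top)
  rw [mul_zero] at this
  refine tendsto_of_tendsto_of_tendsto_of_le_of_le tendsto_const_nhds this (fun _ => zero_le)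
    fun k => ?_
  simp only
  rw [← mul_sub]
  exact eLpNorm_le_mul_eLpNorm_of_ae_le_mul (hb _) 2

theorem integral_sq_eq_eLpNorm {v : X → ℝ} (hv : AEStronglyMeasurable v m) :
    ∫ x, v x ^ 2 ∂m = (eLpNorm v 2 m).toReal ^ 2 := by
  rw [integral_eq_lintegral_of_nonneg_ae (ae_of_all _ fun _ => sq_nonneg _) (hv.pow 2),
    ← ENNReal.toReal_pow, ← lintegral_enorm_sq]
  congr 1
  refine lintegral_congr fun x => ?_
  rw [← Real.enorm_eq_ofReal (sq_nonneg _), enorm_pow]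

theorem L2Tendsto.integral_sq {u : ℕ → X → ℝ} {v : X → ℝ} (h : L2Tendsto m u v) :
    Tendsto (fun k => ∫ x, u k x ^ 2 ∂m) atTop (𝓝 (∫ x, v x ^ 2 ∂m)) := by
  have h1 := (Lp.tendsto_Lp_iff_tendsto_eLpNorm'' u h.memLp v h.memLp_lim).2 h.tendsto
  have h2 := (h1.norm).pow 2
  simp only [Lp.norm_toLp] at h2
  rw [integral_sq_eq_eLpNorm h.memLp_lim.aestronglyMeasurable]
  exact h2.congr fun k => (integral_sq_eq_eLpNorm (h.memLp k).aestronglyMeasurable).symm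

theorem L2Tendsto.integral [IsFiniteMeasure m] {u : ℕ → X → ℝ} {v : X → ℝ}
    (h : L2Tendsto m u v) :
    Tendsto (fun k => ∫ x, u k x ∂m) atTop (𝓝 (∫ x, v x ∂m)) := by
  refine tendsto_integral_of_L1' v h.memLp_lim.aestronglyMeasurable
    (Eventually.of_forall fun k => (h.memLp k).integrable (by norm_num)) ?_
  have h1 := ENNReal.Tendsto.mul_const (b := m univ ^ (1 / (1:ℝ≥0∞).toReal - 1 / (2:ℝ≥0∞).toReal))
    h.tendsto (Or.inr (ENNReal.rpow_ne_top_of_nonneg (by norm_num) (measure_ne_top _ _)))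
  rw [zero_mul] at h1
  refine tendsto_of_tendsto_of_tendsto_of_le_of_le tendsto_const_nhds h1 (fun _ => zero_le)
    fun k => eLpNorm_le_eLpNorm_mul_rpow_measure_univ (by norm_num)
      ((h.memLp k).sub h.memLp_lim).aestronglyMeasurable

theorem L2Tendsto.congr {u u' : ℕ → X → ℝ} {v v' : X → ℝ} (h : L2Tendsto m u v)
    (hu : ∀ k, u k =ᵐ[m] u' k) (hv : v =ᵐ[m] v') : L2Tendsto m u' v' :=
  ⟨fun k => (h.memLp k).ae_eq (hu k), h.memLp_lim.ae_eq hv,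
    h.tendsto.congr fun k => eLpNorm_congr_ae ((hu k).sub hv)⟩

end L2

section Slices

variable {n : ℕ} {α : Fin n → ℝ}

theorem continuousOn_proj (hn : 0 < n) : ContinuousOn (proj : (Fin n → ℝ) → _) (orthant n) :=
  ContinuousOn.smul (ContinuousOn.inv₀ (by fun_prop) fun _ hx =>
    (sum_pos_of_mem_orthant hn hx).ne') continuousOn_id

theorem isCompact_polarMap_image (hn : 0 < n) {A B : ℝ} (hA : 0 < A) :
    IsCompact (polarMap '' (Icc A B ×ˢ cube n A B)) := by
  refine (isCompact_Icc.prod (isCompact_cube n A B)).image_of_continuousOn ?_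
  exact continuousOn_fst.smul ((continuousOn_proj hn).comp continuousOn_snd
    fun z hz => cube_subset_orthant hA hz.2)

theorem polarMap_image_subset (hn : 0 < n) {A B : ℝ} (hA : 0 < A) :
    polarMap '' (Icc A B ×ˢ cube n A B) ⊆ orthant n := by
  rintro _ ⟨z, hz, rfl⟩
  exact smul_mem_orthant (proj_mem_orthant hn (cube_subset_orthant hA hz.2)) (hA.trans_le hz.1.1)

/-- A positive continuous density has a bounded reciprocal on a compact set. -/
theorem integrableOn_of_integrable_density {d : (Fin n → ℝ) → ℝ} (hd : ContinuousOn d (orthant n))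
    (hd0 : ∀ x ∈ orthant n, 0 < d x) (hdm : Measurable d) {φ : (Fin n → ℝ) → ℝ}
    (hi : Integrable φ ((volume.restrict (orthant n)).withDensity fun x => ENNReal.ofReal (d x)))
    {K : Set (Fin n → ℝ)} (hK : IsCompact K) (hKΩ : K ⊆ orthant n) : IntegrableOn φ K := by
  have h1 : IntegrableOn (fun x => (ENNReal.ofReal (d x)).toReal • φ x) (orthant n) :=
    (integrable_withDensity_iff_integrable_smul' hdm.ennreal_ofReal
      (ae_of_all _ fun _ => ofReal_lt_top)).1 hi
  have h2 : ContinuousOn (fun x => (d x)⁻¹) K :=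
    (hd.mono hKΩ).inv₀ fun x hx => (hd0 x (hKΩ hx)).ne'
  have h3 := (h1.mono_set hKΩ).continuousOn_mul h2 hK
  refine h3.congr ?_
  filter_upwards [ae_restrict_mem hK.measurableSet] with x hx
  have := hd0 x (hKΩ hx)
  rw [ENNReal.toReal_ofReal this.le, smul_eq_mul, inv_mul_cancel_left₀ this.ne']

theorem exists_lintegral_density_le {d : (Fin n → ℝ) → ℝ} (hd : ContinuousOn d (orthant n))
    (hdm : Measurable d) {K : Set (Fin n → ℝ)} (hK : IsCompact K) (hKΩ : K ⊆ orthant n) :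
    ∃ M : ℝ, 0 < M ∧ ∀ φ : (Fin n → ℝ) → ℝ≥0∞, Measurable φ →
      ∫⁻ x in K, φ x ∂((volume.restrict (orthant n)).withDensity fun x => ENNReal.ofReal (d x)) ≤
        ENNReal.ofReal M * ∫⁻ x in K, φ x := by
  obtain ⟨M, hM⟩ := hK.exists_bound_of_continuousOn (hd.mono hKΩ)
  refine ⟨max M 1, by positivity, fun φ hφ => ?_⟩
  rw [restrict_withDensity hK.measurableSet, Measure.restrict_restrict hK.measurableSet,
    inter_eq_left.2 hKΩ, lintegral_withDensity_eq_lintegral_mul _ hdm.ennreal_ofReal hφ,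
    ← lintegral_const_mul' _ _ ofReal_ne_top]
  refine setLIntegral_mono' hK.measurableSet fun x hx => ?_
  rw [Pi.mul_apply]
  gcongr
  exact (le_abs_self _).trans ((hM x hx).trans (le_max_left _ _))

/-- Approximation of weakly differentiable functions by `C¹` functions along almost every
radial and almost every angular slice. -/
theorem exists_approx_slices (hn : 0 < n) {nu : Measure ℝ} {gam : Measure (Fin n → ℝ)}
    [SFinite nu] [SFinite gam] {d : (Fin n → ℝ) → ℝ} (hd : ContinuousOn d (orthant n))
    (hdm : Measurable d)
    (hmap : Measure.map polarMap (nu.prod gam) =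
      (volume.restrict (orthant n)).withDensity fun x => ENNReal.ofReal (d x))
    {f : (Fin n → ℝ) → ℝ} {Df : Fin n → (Fin n → ℝ) → ℝ} (hfm : Measurable f)
    (hDm : ∀ i, Measurable (Df i)) (hf : HasWeakGradientOn (orthant n) f Df)
    (hf2 : ∀ K' ⊆ orthant n, IsCompact K' → IntegrableOn (fun x => f x ^ 2) K')
    (hD2 : ∀ i, ∀ K' ⊆ orthant n, IsCompact K' → IntegrableOn (fun x => Df i x ^ 2) K')
    {A B : ℝ} (hA : 0 < A) :
    ∃ F : ℕ → (Fin n → ℝ) → ℝ, (∀ k, ContDiff ℝ 1 (F k)) ∧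
      (∀ᵐ x ∂gam.restrict (cube n A B), Tendsto (fun k => ∫⁻ s in Icc A B,
        ‖F k (s • proj x) - f (s • proj x)‖ₑ ^ 2 + ∑ i,
          ‖fderiv ℝ (F k) (s • proj x) (Pi.single i 1) - Df i (s • proj x)‖ₑ ^ 2 ∂nu)
        atTop (𝓝 0)) ∧
      (∀ᵐ s ∂nu.restrict (Icc A B), Tendsto (fun k => ∫⁻ x in cube n A B,
        ‖F k (s • proj x) - f (s • proj x)‖ₑ ^ 2 + ∑ i,
          ‖fderiv ℝ (F k) (s • proj x) (Pi.single i 1) - Df i (s • proj x)‖ₑ ^ 2 ∂gam)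
        atTop (𝓝 0)) := by
  set K := polarMap '' (Icc A B ×ˢ cube n A B)
  have hK : IsCompact K := isCompact_polarMap_image hn hA
  have hKΩ : K ⊆ orthant n := polarMap_image_subset hn hA
  obtain ⟨M, hM, hMφ⟩ := exists_lintegral_density_le hd hdm hK hKΩ
  -- Squared errors of size `2⁻ᵏ` are summable, so the series of errors is integrable over the
  -- product. By Tonelli the series of slice errors is finite on almost every slice in either
  -- direction; hence its terms tend to zero along the full sequence, and one sequence serves both
  -- kinds of slices.
  have hε : ∀ k : ℕ, (0:ℝ≥0∞) < 2⁻¹ ^ k := fun k => by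
    exact ENNReal.pow_pos (by simp) k
  choose F hF hF0 hF1 using fun k : ℕ =>
    exists_smooth_approx (isOpen_orthant n) hK hKΩ hfm hDm hf hf2 hD2 (hε k)
  set e : ℕ → (Fin n → ℝ) → ℝ≥0∞ := fun k x => ‖F k x - f x‖ₑ ^ 2 + ∑ i,
          ‖fderiv ℝ (F k) x (Pi.single i 1) - Df i x‖ₑ ^ 2 with he
  have hem : ∀ k, Measurable (e k) := fun k => by
    have h1 := (hF k).continuous.measurable
    have h2 : ∀ i, Measurable fun x => fderiv ℝ (F k) x (Pi.single i (1:ℝ)) := fun i =>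
      (((hF k).continuous_fderiv one_ne_zero).clm_apply continuous_const).measurable
    exact ((h1.sub hfm).enorm.pow_const 2).add
      (Finset.measurable_sum _ fun i _ => ((h2 i).sub (hDm i)).enorm.pow_const 2)
  have hek : ∀ k, ∫⁻ x in K, e k x ≤ ((n : ℝ≥0∞) + 1) * 2⁻¹ ^ k := fun k => by
    have h1 := (hF k).continuous.measurable
    have h2 : ∀ i, Measurable fun x => fderiv ℝ (F k) x (Pi.single i (1:ℝ)) := fun i =>
      (((hF k).continuous_fderiv one_ne_zero).clm_apply continuous_const).measurable
    have h3 : Measurable fun x => ‖F k x - f x‖ₑ ^ 2 := (h1.sub hfm).enorm.pow_const 2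
    have h4 : ∀ i, Measurable fun x => ‖fderiv ℝ (F k) x (Pi.single i 1) - Df i x‖ₑ ^ 2 :=
      fun i => ((h2 i).sub (hDm i)).enorm.pow_const 2
    simp only [he]
    rw [lintegral_add_left h3, lintegral_finsetSum _ fun i _ => h4 i, add_comm, add_mul, one_mul]
    refine add_le_add ((Finset.sum_le_sum fun i _ => hF1 k i).trans (by simp)) (hF0 k)
  have hprod : ∀ k, ∫⁻ z in Icc A B ×ˢ cube n A B, e k (polarMap z) ∂(nu.prod gam) ≤
      ENNReal.ofReal M * (((n : ℝ≥0∞) + 1) * 2⁻¹ ^ k) := fun k => by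
    calc _ ≤ ∫⁻ z in polarMap ⁻¹' K, e k (polarMap z) ∂(nu.prod gam) :=
          lintegral_mono_set (subset_preimage_image _ _)
      _ = ∫⁻ x in K, e k x ∂(Measure.map polarMap (nu.prod gam)) :=
          (setLIntegral_map hK.measurableSet (hem k) measurable_polarMap).symm
      _ ≤ ENNReal.ofReal M * ∫⁻ x in K, e k x := by
          rw [hmap]
          exact hMφ _ (hem k)
      _ ≤ _ := by
          gcongr
          exact hek k
  have hsum : ∫⁻ z in Icc A B ×ˢ cube n A B, ∑' k, e k (polarMap z) ∂(nu.prod gam) ≠ ⊤ := by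
    rw [lintegral_tsum (f := fun k z => e k (polarMap z))
      fun k => ((hem k).comp measurable_polarMap).aemeasurable]
    refine ne_top_of_le_ne_top ?_ (ENNReal.tsum_le_tsum hprod)
    rw [ENNReal.tsum_mul_left, ENNReal.tsum_mul_left, ENNReal.tsum_geometric]
    refine ENNReal.mul_ne_top ofReal_ne_top (ENNReal.mul_ne_top (by finiteness) ?_)
    simp
  have hSm : Measurable fun z : ℝ × (Fin n → ℝ) => ∑' k, e k (polarMap z) :=
    Measurable.tsum fun k => (hem k).comp measurable_polarMap
  rw [← Measure.prod_restrict] at hsum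
  refine ⟨F, hF, ?_, ?_⟩
  · rw [lintegral_prod_symm _ hSm.aemeasurable] at hsum
    filter_upwards [ae_lt_top (hSm.lintegral_prod_left' (μ := nu.restrict (Icc A B))) hsum]
      with x hx
    rw [lintegral_tsum (f := fun k s => e k (polarMap (s, x)))
      fun k => ((hem k).comp (measurable_polarMap.comp
      measurable_prodMk_right)).aemeasurable] at hx
    have := ENNReal.tendsto_cofinite_zero_of_tsum_ne_top hx.ne
    rwa [Nat.cofinite_eq_atTop] at this
  · rw [lintegral_prod _ hSm.aemeasurable] at hsum
    filter_upwards [ae_lt_top (hSm.lintegral_prod_right' (ν := gam.restrict (cube n A B))) hsum]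
      with s hs
    rw [lintegral_tsum (f := fun k x => e k (polarMap (s, x)))
      fun k => ((hem k).comp (measurable_polarMap.comp
      measurable_prodMk_left)).aemeasurable] at hs
    have := ENNReal.tendsto_cofinite_zero_of_tsum_ne_top hs.ne
    rwa [Nat.cofinite_eq_atTop] at this

end Slices

end MultivariateLiouville

/-! ### Exhaustion and the inequality on rays -/

namespace MultivariateLiouville
open Filter Topology ENNReal

theorem memLp_two_restrict_of_continuousOn {X : Type*} [TopologicalSpace X] [MeasurableSpace X]
    [OpensMeasurableSpace X] [T2Space X] {m : Measure X} [IsFiniteMeasure m]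
    {K : Set X} (hK : IsCompact K) {g : X → ℝ} (hg : ContinuousOn g K) :
    MemLp g 2 (m.restrict K) := by
  obtain ⟨M, hM⟩ := hK.exists_bound_of_continuousOn hg
  refine MemLp.of_bound (hg.aestronglyMeasurable_of_isCompact hK hK.measurableSet) M ?_
  filter_upwards [ae_restrict_mem hK.measurableSet] with x hx using hM x hx

variable {n : ℕ} {α : Fin n → ℝ}

theorem clm_apply_eq_sum (L : (Fin n → ℝ) →L[ℝ] ℝ) (v : Fin n → ℝ) :
    L v = ∑ i, v i * L (Pi.single i 1) := by
  conv_lhs => rw [pi_eq_sum_univ' v]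
  simp [map_sum]

theorem proj_apply_le_one (hn : 0 < n) {x : Fin n → ℝ} (hx : x ∈ orthant n) (i : Fin n) :
    proj x i ≤ 1 := by
  rw [← sum_proj hn hx]
  exact Finset.single_le_sum (f := fun i => proj x i) (fun j _ => (proj_mem_orthant hn hx j).le)
    (Finset.mem_univ i)

theorem sum_mul_proj (hn : 0 < n) {x : Fin n → ℝ} (hx : x ∈ orthant n) (i : Fin n) :
    (∑ j, x j) * proj x i = x i := by
  have := sum_pos_of_mem_orthant hn hx
  simp only [proj, Pi.smul_apply, smul_eq_mul]
  field_simp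

/-- Moments of the total mass under independent Gamma variables factor from the direction. -/
theorem sum_rpow_mul_proj_gammaPi (hn : 0 < n) (hα : ∀ i, 0 < α i) {p : ℝ} (hp : 0 ≤ p)
    {φ : (Fin n → ℝ) → ℝ} (hφ : Measurable φ)
    (hi : Integrable (fun x => φ (proj x)) (gammaPi α)) :
    Integrable (fun x => (∑ i, x i) ^ p * φ (proj x)) (gammaPi α) ∧
      ∫ x, (∑ i, x i) ^ p * φ (proj x) ∂gammaPi α =
        Real.Gamma ((∑ i, α i) + p) / Real.Gamma (∑ i, α i) * ∫ x, φ (proj x) ∂gammaPi α := by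
  have hprob := isProbabilityMeasure_gammaPi hα
  have : Nonempty (Fin n) := ⟨⟨0, hn⟩⟩
  have ha0 : 0 < ∑ i, α i := Finset.sum_pos (fun i _ => hα i) Finset.univ_nonempty
  have hΓ := Real.Gamma_pos_of_pos ha0
  have hΓp := Real.Gamma_pos_of_pos (by linarith : 0 < (∑ i, α i) + p)
  have hm := map_proj_gammaPi_withDensity hn hα p hp
  have hwm : Measurable fun x : Fin n → ℝ => ENNReal.ofReal ((∑ i, x i) ^ p) := by fun_prop
  have hae : (fun x : Fin n → ℝ => (ENNReal.ofReal ((∑ i, x i) ^ p)).toReal • φ (proj x))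
      =ᵐ[gammaPi α] fun x => (∑ i, x i) ^ p * φ (proj x) := by
    filter_upwards [ae_gammaPi_mem_orthant hα] with x hx
    rw [ENNReal.toReal_ofReal (Real.rpow_nonneg (sum_pos_of_mem_orthant hn hx).le _), smul_eq_mul]
  constructor
  · have h1 : Integrable φ (Measure.map proj (gammaPi α)) :=
      (integrable_map_measure hφ.aestronglyMeasurable measurable_proj.aemeasurable).2 hi
    have h2 := h1.smul_measure (c := ENNReal.ofReal
      (Real.Gamma ((∑ i, α i) + p) / Real.Gamma (∑ i, α i))) ofReal_ne_top
    rw [← hm, integrable_map_measure hφ.aestronglyMeasurable measurable_proj.aemeasurable,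
      integrable_withDensity_iff_integrable_smul' hwm (ae_of_all _ fun _ => ofReal_lt_top)] at h2
    exact h2.congr hae
  · have h1 := congrArg (fun m => ∫ y, φ y ∂m) hm
    rw [integral_map measurable_proj.aemeasurable hφ.aestronglyMeasurable, integral_smul_measure,
      integral_map measurable_proj.aemeasurable hφ.aestronglyMeasurable,
      integral_withDensity_eq_integral_toReal_smul hwm (ae_of_all _ fun _ => ofReal_lt_top),
      integral_congr_ae hae, ENNReal.toReal_ofReal (by positivity), smul_eq_mul] at h1
    exact h1

section Exhaustion

/-- The shift by `2` makes every interval nondegenerate; with shift `1` the first would be the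
single point `1`. -/
theorem one_div_lt_add_two (j : ℕ) : 1 / ((j : ℝ) + 2) < j + 2 := by
  rw [div_lt_iff₀ (by positivity)]
  nlinarith [(Nat.cast_nonneg j : (0:ℝ) ≤ j)]

theorem eventually_mem_Icc_exhaustion {s : ℝ} (hs : 0 < s) :
    ∀ᶠ j : ℕ in atTop, s ∈ Icc (1 / ((j : ℝ) + 2)) (j + 2) := by
  have h1 : ∀ᶠ j : ℕ in atTop, s ≤ j := tendsto_natCast_atTop_atTop.eventually_ge_atTop s
  have h2 : ∀ᶠ j : ℕ in atTop, 1 / s ≤ j := tendsto_natCast_atTop_atTop.eventually_ge_atTop _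
  filter_upwards [h1, h2] with j hj1 hj2
  refine ⟨?_, by linarith⟩
  rw [div_le_iff₀ (by positivity)]
  rw [div_le_iff₀ hs] at hj2
  nlinarith

theorem aecover_Icc_exhaustion {m : Measure ℝ} (hm : ∀ᵐ s ∂m, 0 < s) :
    AECover m atTop fun j : ℕ => Icc (1 / ((j : ℝ) + 2)) (j + 2) :=
  ⟨hm.mono fun _ => eventually_mem_Icc_exhaustion, fun _ => measurableSet_Icc⟩

theorem eventually_mem_cube_exhaustion {x : Fin n → ℝ} (hx : x ∈ orthant n) :
    ∀ᶠ j : ℕ in atTop, x ∈ cube n (1 / ((j : ℝ) + 2)) (j + 2) := by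
  filter_upwards [eventually_all.2 fun i => eventually_mem_Icc_exhaustion (hx i)] with j hj i _
    using hj i

theorem aecover_cube_exhaustion {m : Measure (Fin n → ℝ)} (hm : ∀ᵐ x ∂m, x ∈ orthant n) :
    AECover m atTop fun j : ℕ => cube n (1 / ((j : ℝ) + 2)) (j + 2) :=
  ⟨hm.mono fun _ => eventually_mem_cube_exhaustion, fun _ => measurableSet_cube n _ _⟩

theorem tendsto_setIntegral_of_aecover {X : Type*} [MeasurableSpace X] {m : Measure X}
    [IsProbabilityMeasure m] {S : ℕ → Set X} (hS : AECover m atTop S) :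
    Tendsto (fun j => m.real (S j)) atTop (𝓝 1) := by
  have := hS.integral_tendsto_of_countably_generated (integrable_const (1:ℝ))
  simpa using this

end Exhaustion

section Radial

variable {c a : ℝ} {V : ℝ → ℝ}

/-- The radial inequality on an interval for `L²` limits of `C¹` functions. -/
theorem radial_variance_le_of_tendsto [IsFiniteMeasure (radial c a V)] {τ κ : ℝ → ℝ}
    (hτ : Continuous τ) {A B : ℝ}
    (hP : ∀ u h : ℝ → ℝ, (∀ x, 0 < x → HasDerivAt u (h x) x) → ContinuousOn h (Ioi 0) →
      (radial c a V).real (Icc A B) * (∫ s in Icc A B, u s ^ 2 ∂radial c a V) -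
        (∫ s in Icc A B, u s ∂radial c a V) ^ 2 ≤
      (∫ s in Icc A B, κ s ∂radial c a V) / (a - 1) *
        ∫ s in Icc A B, τ s ^ 2 * h s ^ 2 ∂radial c a V)
    {uk hk : ℕ → ℝ → ℝ} {u h : ℝ → ℝ} (huk : ∀ k x, 0 < x → HasDerivAt (uk k) (hk k x) x)
    (hhk : ∀ k, ContinuousOn (hk k) (Ioi 0))
    (hu : L2Tendsto ((radial c a V).restrict (Icc A B)) uk u)
    (hh : L2Tendsto ((radial c a V).restrict (Icc A B)) hk h) :
    (radial c a V).real (Icc A B) * (∫ s in Icc A B, u s ^ 2 ∂radial c a V) -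
        (∫ s in Icc A B, u s ∂radial c a V) ^ 2 ≤
      (∫ s in Icc A B, κ s ∂radial c a V) / (a - 1) *
        ∫ s in Icc A B, τ s ^ 2 * h s ^ 2 ∂radial c a V := by
  obtain ⟨M, hM⟩ := (isCompact_Icc (a := A) (b := B)).exists_bound_of_continuousOn hτ.continuousOn
  have hw := (hh.mul_bounded hτ.aestronglyMeasurable (M := M) (by
    filter_upwards [ae_restrict_mem measurableSet_Icc] with x hx using hM x hx)).integral_sq
  simp only [Pi.mul_apply, mul_pow] at hw
  exact le_of_tendsto_of_tendsto' ((hu.integral_sq.const_mul _).sub (hu.integral.pow 2))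
    (hw.const_mul _) fun k => hP _ _ (huk k) (hhk k)

/-- Along a ray the derivative of `f` is `∑ yᵢ Dᵢ`, a limit of derivatives of the smooth
restrictions. First `k → ∞` on a fixed interval, then the interval exhausts the half-line;
integrability on the ray justifies the second limit. -/
theorem radial_variance_le_of_slice [IsProbabilityMeasure (radial c a V)] {τ κ : ℝ → ℝ}
    (hτ : Continuous τ) (hκ : Integrable κ (radial c a V))
    (hP : ∀ A B, 0 < A → A < B →
      ∀ u h : ℝ → ℝ, (∀ x, 0 < x → HasDerivAt u (h x) x) → ContinuousOn h (Ioi 0) →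
      (radial c a V).real (Icc A B) * (∫ s in Icc A B, u s ^ 2 ∂radial c a V) -
        (∫ s in Icc A B, u s ∂radial c a V) ^ 2 ≤
      (∫ s in Icc A B, κ s ∂radial c a V) / (a - 1) *
        ∫ s in Icc A B, τ s ^ 2 * h s ^ 2 ∂radial c a V)
    {f : (Fin n → ℝ) → ℝ} {Df : Fin n → (Fin n → ℝ) → ℝ} (hfm : Measurable f)
    (hDm : ∀ i, Measurable (Df i)) {F : ℕ → ℕ → (Fin n → ℝ) → ℝ}
    (hF : ∀ j k, ContDiff ℝ 1 (F j k)) {y : Fin n → ℝ}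
    (hy : ∀ᶠ j : ℕ in atTop, Tendsto (fun k => ∫⁻ s in Icc (1 / ((j : ℝ) + 2)) (j + 2),
        ‖F j k (s • y) - f (s • y)‖ₑ ^ 2 + ∑ i,
          ‖fderiv ℝ (F j k) (s • y) (Pi.single i 1) - Df i (s • y)‖ₑ ^ 2 ∂radial c a V)
        atTop (𝓝 0))
    (hf2 : Integrable (fun s => f (s • y) ^ 2) (radial c a V))
    (hD2 : Integrable (fun s => τ s ^ 2 * (∑ i, y i * Df i (s • y)) ^ 2) (radial c a V)) :
    (∫ s, f (s • y) ^ 2 ∂radial c a V) - (∫ s, f (s • y) ∂radial c a V) ^ 2 ≤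
      (∫ s, κ s ∂radial c a V) / (a - 1) *
        ∫ s, τ s ^ 2 * (∑ i, y i * Df i (s • y)) ^ 2 ∂radial c a V := by
  have hcov := aecover_Icc_exhaustion (ae_radial_pos (c := c) (a := a) (V := V))
  have hsm : Measurable fun s : ℝ => s • y := by fun_prop
  have hf1 : Integrable (fun s => f (s • y)) (radial c a V) :=
    ((memLp_two_iff_integrable_sq (hfm.comp hsm).aestronglyMeasurable).2 hf2).integrable
      (by norm_num)
  have hl := ((tendsto_setIntegral_of_aecover hcov).mul
    (hcov.integral_tendsto_of_countably_generated hf2)).sub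
    ((hcov.integral_tendsto_of_countably_generated hf1).pow 2)
  rw [one_mul] at hl
  refine le_of_tendsto_of_tendsto hl (((hcov.integral_tendsto_of_countably_generated hκ).div_const
    (a - 1)).mul (hcov.integral_tendsto_of_countably_generated hD2)) ?_
  filter_upwards [hy] with j hj
  have hdF : ∀ k i, Continuous fun s : ℝ => fderiv ℝ (F j k) (s • y) (Pi.single i 1) := fun k i =>
    (((hF j k).continuous_fderiv one_ne_zero).comp (by fun_prop)).clm_apply continuous_const
  have hu : L2Tendsto ((radial c a V).restrict (Icc (1 / ((j : ℝ) + 2)) (j + 2)))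
      (fun k s => F j k (s • y)) (fun s => f (s • y)) := by
    refine L2Tendsto.of_lintegral (fun k => memLp_two_restrict_of_continuousOn isCompact_Icc
      ((hF j k).continuous.comp (by fun_prop)).continuousOn)
      (hfm.comp hsm).aestronglyMeasurable ?_
    exact tendsto_of_tendsto_of_tendsto_of_le_of_le tendsto_const_nhds hj (fun _ => zero_le)
      fun k => lintegral_mono fun s => le_self_add
  have hD : ∀ i, L2Tendsto ((radial c a V).restrict (Icc (1 / ((j : ℝ) + 2)) (j + 2)))
      (fun k s => fderiv ℝ (F j k) (s • y) (Pi.single i 1)) (fun s => Df i (s • y)) := fun i => by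
    refine L2Tendsto.of_lintegral (fun k => memLp_two_restrict_of_continuousOn isCompact_Icc
      (hdF k i).continuousOn) ((hDm i).comp hsm).aestronglyMeasurable ?_
    refine tendsto_of_tendsto_of_tendsto_of_le_of_le tendsto_const_nhds hj (fun _ => zero_le)
      fun k => lintegral_mono fun s => le_trans ?_ le_add_self
    exact Finset.single_le_sum (f := fun i => ‖fderiv ℝ (F j k) (s • y) (Pi.single i 1) -
      Df i (s • y)‖ₑ ^ 2) (fun _ _ => zero_le) (Finset.mem_univ i)
  have hh := L2Tendsto.sum Finset.univ fun i => (hD i).mul_bounded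
    (w := fun _ => y i) aestronglyMeasurable_const (M := |y i|) (ae_of_all _ fun _ => le_rfl)
  have key := radial_variance_le_of_tendsto hτ
    (hP _ _ (by positivity) (one_div_lt_add_two j)) (fun k s hs => ?_) (fun k => ?_) hu hh
  · simpa only [Finset.sum_apply, Pi.mul_apply] using key
  · have h1 := ((hF j k).differentiable one_ne_zero (s • y)).hasFDerivAt.comp_hasDerivAt s
      ((hasDerivAt_id s).smul_const y)
    refine h1.congr_deriv ?_
    simp only [Finset.sum_apply, Pi.mul_apply, one_smul]
    exact clm_apply_eq_sum _ y
  · simp only [Finset.sum_fn, Pi.mul_def]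
    exact (continuous_finsetSum _ fun i _ => continuous_const.mul (hdF k i)).continuousOn

end Radial

end MultivariateLiouville

/-! ### The angular inequality -/

namespace MultivariateLiouville
open Filter Topology ENNReal

section Angular

variable {n : ℕ} {α : Fin n → ℝ}

theorem sum_mul_sub_sum_sq {y G : Fin n → ℝ} (hy : ∑ i, y i = 1) :
    ∑ i, y i * (G i - ∑ j, y j * G j) ^ 2 = ∑ i, y i * G i ^ 2 - (∑ j, y j * G j) ^ 2 := by
  set D := ∑ j, y j * G j with hD
  have h : ∀ i, y i * (G i - D) ^ 2 = y i * G i ^ 2 - 2 * D * (y i * G i) + D ^ 2 * y i :=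
    fun i => by ring
  simp only [h, Finset.sum_add_distrib, Finset.sum_sub_distrib, ← Finset.mul_sum, hy, ← hD]
  ring

/-- The weights `y` form a probability vector and the deviations of `G` have mean zero, so the cross
term vanishes. -/
theorem sum_mul_add_mul_sub_sum_sq {y G : Fin n → ℝ} (hy : ∑ i, y i = 1) (v s : ℝ) :
    ∑ i, y i * (v + s * (G i - ∑ j, y j * G j)) ^ 2 =
      v ^ 2 + s ^ 2 * ∑ i, y i * (G i - ∑ j, y j * G j) ^ 2 := by
  set D := ∑ j, y j * G j with hD
  have h : ∀ i, y i * (v + s * (G i - D)) ^ 2 = v ^ 2 * y i + 2 * v * s * (y i * G i) -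
      2 * v * s * D * y i + s ^ 2 * (y i * (G i - D) ^ 2) := fun i => by ring
  simp only [h, Finset.sum_add_distrib, Finset.sum_sub_distrib, ← Finset.mul_sum, hy, ← hD]
  ring

/-- The prefactor cancels the `1 / ∑ xⱼ` produced by differentiating the projection. The function is
homogeneous of degree one, so its gradient depends on `x` only through the direction. -/
theorem hasDerivAt_sum_mul_comp_proj (hn : 0 < n) {F : (Fin n → ℝ) → ℝ} (hF : ContDiff ℝ 1 F)
    (s : ℝ) (i : Fin n) {x : Fin n → ℝ} (hx : x ∈ orthant n) :
    HasDerivAt (fun t => (∑ j, Function.update x i t j) * F (s • proj (Function.update x i t)))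
      (F (s • proj x) + s * (fderiv ℝ F (s • proj x) (Pi.single i 1) -
        ∑ j, proj x j * fderiv ℝ F (s • proj x) (Pi.single j 1))) (x i) := by
  have hx0 := (sum_pos_of_mem_orthant hn hx).ne'
  have hu : HasDerivAt (Function.update x i) (Pi.single i 1) (x i) := hasDerivAt_update x i (x i)
  have hs : HasDerivAt (fun t => ∑ j, Function.update x i t j) 1 (x i) := by
    have := HasDerivAt.fun_sum (u := Finset.univ) fun j _ => (hasDerivAt_pi.1 hu) j
    refine this.congr_deriv ?_
    simp
  have hp : HasDerivAt (fun t => proj (Function.update x i t)) _ (x i) :=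
    (hs.fun_inv (by simpa using hx0)).smul hu
  have hF' := ((hF.differentiable one_ne_zero (s • proj x)).hasFDerivAt)
  have hc : HasDerivAt (fun t => F (s • proj (Function.update x i t))) _ (x i) :=
    HasFDerivAt.comp_hasDerivAt (x i) (by simpa using hF') (hp.const_smul s)
  refine (hs.mul hc).congr_deriv ?_
  simp only [Function.update_eq_self, ← clm_apply_eq_sum, map_smul, map_add, smul_eq_mul, one_mul]
  have : x = (∑ j, x j) • proj x := by
    rw [proj, smul_smul, mul_inv_cancel₀ hx0, one_smul]
  conv_lhs => enter [2, 2, 2, 2, 2, 2]; rw [this]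
  rw [map_smul, smul_eq_mul]
  field_simp
  ring

/-- The angular inequality on a cube for `L²` limits of `C¹` functions. -/
theorem angular_cube_variance_le_of_slice (hn : 0 < n) (hα : ∀ i, 0 < α i) {A B : ℝ} (hA : 0 < A)
    (hAB : A < B) {f : (Fin n → ℝ) → ℝ} {Df : Fin n → (Fin n → ℝ) → ℝ} (hfm : Measurable f)
    (hDm : ∀ i, Measurable (Df i)) {F : ℕ → (Fin n → ℝ) → ℝ} (hF : ∀ k, ContDiff ℝ 1 (F k)) {s : ℝ}
    (hs : Tendsto (fun k => ∫⁻ x in cube n A B,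
        ‖F k (s • proj x) - f (s • proj x)‖ₑ ^ 2 + ∑ i,
          ‖fderiv ℝ (F k) (s • proj x) (Pi.single i 1) - Df i (s • proj x)‖ₑ ^ 2 ∂gammaPi α)
        atTop (𝓝 0)) :
    (gammaPi α).real (cube n A B) *
        (∫ x in cube n A B, ((∑ i, x i) * f (s • proj x)) ^ 2 ∂gammaPi α) -
      (∫ x in cube n A B, (∑ i, x i) * f (s • proj x) ∂gammaPi α) ^ 2 ≤
      (gammaPi α).real (cube n A B) * ∫ x in cube n A B, (∑ i, x i) * (f (s • proj x) ^ 2 +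
        s ^ 2 * ∑ i, proj x i * (Df i (s • proj x) -
          ∑ j, proj x j * Df j (s • proj x)) ^ 2) ∂gammaPi α := by
  have hprob := isProbabilityMeasure_gammaPi hα
  have hcubeΩ : cube n A B ⊆ orthant n := cube_subset_orthant hA
  have hmem : ∀ᵐ x ∂(gammaPi α).restrict (cube n A B), x ∈ cube n A B :=
    ae_restrict_mem (measurableSet_cube n A B)
  have hpc : ContinuousOn (fun x : Fin n → ℝ => s • proj x) (orthant n) :=
    (continuousOn_proj hn).const_smul s
  have hpm : Measurable fun x : Fin n → ℝ => s • proj x := measurable_proj.const_smul s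
  have hpi : ∀ i, Measurable fun x : Fin n → ℝ => proj x i := fun i =>
    (measurable_pi_apply i).comp measurable_proj
  have hpic : ∀ i, ContinuousOn (fun x : Fin n → ℝ => proj x i) (orthant n) := fun i =>
    (continuous_apply i).comp_continuousOn (continuousOn_proj hn)
  have hFc : ∀ k, ContinuousOn (fun x => F k (s • proj x)) (orthant n) := fun k =>
    (hF k).continuous.comp_continuousOn hpc
  have hdF : ∀ k i, ContinuousOn (fun x => fderiv ℝ (F k) (s • proj x) (Pi.single i 1))
      (orthant n) := fun k i =>
    (((hF k).continuous_fderiv one_ne_zero).comp_continuousOn hpc).clm_apply continuousOn_const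
  have hu : L2Tendsto ((gammaPi α).restrict (cube n A B))
      (fun k x => F k (s • proj x)) (fun x => f (s • proj x)) := by
    refine L2Tendsto.of_lintegral (fun k => memLp_two_restrict_of_continuousOn
      (isCompact_cube n A B) ((hFc k).mono hcubeΩ)) (hfm.comp hpm).aestronglyMeasurable ?_
    exact tendsto_of_tendsto_of_tendsto_of_le_of_le tendsto_const_nhds hs (fun _ => zero_le)
      fun k => lintegral_mono fun s => le_self_add
  have hD : ∀ i, L2Tendsto ((gammaPi α).restrict (cube n A B))
      (fun k x => fderiv ℝ (F k) (s • proj x) (Pi.single i 1)) (fun x => Df i (s • proj x)) :=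
    fun i => by
    refine L2Tendsto.of_lintegral (fun k => memLp_two_restrict_of_continuousOn
      (isCompact_cube n A B) ((hdF k i).mono hcubeΩ))
      ((hDm i).comp hpm).aestronglyMeasurable ?_
    refine tendsto_of_tendsto_of_tendsto_of_le_of_le tendsto_const_nhds hs (fun _ => zero_le)
      fun k => lintegral_mono fun x => le_trans ?_ le_add_self
    exact Finset.single_le_sum (f := fun i => ‖fderiv ℝ (F k) (s • proj x) (Pi.single i 1) -
      Df i (s • proj x)‖ₑ ^ 2) (fun _ _ => zero_le) (Finset.mem_univ i)
  have hR := L2Tendsto.sum Finset.univ fun i => (hD i).mul_bounded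
    (w := fun x => proj x i) (hpi i).aestronglyMeasurable (M := 1) (by
      filter_upwards [hmem] with x hx
      rw [abs_of_pos (proj_mem_orthant hn (hcubeΩ hx) i)]
      exact proj_apply_le_one hn (hcubeΩ hx) i)
  have hbound : ∀ g : (Fin n → ℝ) → ℝ, Continuous g → ∃ M, ∀ᵐ x ∂(gammaPi α).restrict (cube n A B),
      |g x| ≤ M := fun g hg => by
    obtain ⟨M, hM⟩ := (isCompact_cube n A B).exists_bound_of_continuousOn hg.continuousOn
    exact ⟨M, hmem.mono fun x hx => hM x hx⟩
  obtain ⟨M, hM⟩ := hbound (fun x => ∑ i, x i) (by fun_prop)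
  have hSm : Continuous fun x : Fin n → ℝ => ∑ i, x i := by fun_prop
  have hh := hu.mul_bounded hSm.aestronglyMeasurable hM
  -- The factor `√(x i)` turns the Gamma energy into a plain squared norm; all multipliers are
  -- bounded on the cube.
  have hE : ∀ i, L2Tendsto ((gammaPi α).restrict (cube n A B))
      (fun k x => √(x i) * (F k (s • proj x) + s * (fderiv ℝ (F k) (s • proj x) (Pi.single i 1) -
        ∑ j, proj x j * fderiv ℝ (F k) (s • proj x) (Pi.single j 1))))
      (fun x => √(x i) * (f (s • proj x) + s * (Df i (s • proj x) -
        ∑ j, proj x j * Df j (s • proj x)))) := fun i => by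
    have hc : Continuous fun x : Fin n → ℝ => √(x i) := by fun_prop
    obtain ⟨M', hM'⟩ := hbound _ hc
    have h1 := (hu.add (((hD i).add (hR.mul_bounded (w := fun _ => -1) (M := 1)
      aestronglyMeasurable_const (by simp))).mul_bounded (w := fun _ => s)
      aestronglyMeasurable_const (M := |s|) (by simp))).mul_bounded hc.aestronglyMeasurable hM'
    refine h1.congr (fun k => ae_of_all _ fun x => ?_) (ae_of_all _ fun x => ?_)
    all_goals
      simp only [Pi.mul_apply, Pi.add_apply, Finset.sum_apply]
      ring
  have hsq : ∀ i, ∀ G : (Fin n → ℝ) → ℝ, (fun x => (√(x i) * G x) ^ 2)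
      =ᵐ[(gammaPi α).restrict (cube n A B)] fun x => x i * G x ^ 2 := fun i G => by
    filter_upwards [hmem] with x hx
    rw [mul_pow, Real.sq_sqrt (hcubeΩ hx i).le]
  have key := fun k => gammaPi_cube_variance_le hα hA hAB (hSm.continuousOn.mul (hFc k))
    (fun i => (hFc k).add (continuousOn_const.mul ((hdF k i).sub
      (continuousOn_finsetSum _ fun j _ => (hpic j).mul (hdF k j)))))
    fun i x hx => hasDerivAt_sum_mul_comp_proj hn (hF k) s i hx
  have hlim := le_of_tendsto_of_tendsto' ((hh.integral_sq.const_mul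
    ((gammaPi α).real (cube n A B))).sub (hh.integral.pow 2))
    ((tendsto_finsetSum Finset.univ fun i _ => (hE i).integral_sq).const_mul
      ((gammaPi α).real (cube n A B))) fun k => by
      refine (key k).trans (le_of_eq ?_)
      congr 1
      exact Finset.sum_congr rfl fun i _ => (integral_congr_ae (hsq i _)).symm
  refine hlim.trans (le_of_eq ?_)
  congr 1
  rw [← integral_finsetSum _ fun i _ => (hE i).memLp_lim.integrable_sq]
  refine integral_congr_ae ?_
  filter_upwards [hmem] with x hx
  have hx' := hcubeΩ hx
  rw [← sum_mul_add_mul_sub_sum_sq (sum_proj hn hx'), Finset.mul_sum]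
  refine Finset.sum_congr rfl fun i _ => ?_
  rw [mul_pow, Real.sq_sqrt (hx' i).le, ← mul_assoc, sum_mul_proj hn hx']

/-- The angular inequality on almost every sphere. -/
theorem angular_variance_le_of_slice (hn : 0 < n) (hα : ∀ i, 0 < α i)
    {f : (Fin n → ℝ) → ℝ} {Df : Fin n → (Fin n → ℝ) → ℝ} (hfm : Measurable f)
    (hDm : ∀ i, Measurable (Df i)) {F : ℕ → ℕ → (Fin n → ℝ) → ℝ}
    (hF : ∀ j k, ContDiff ℝ 1 (F j k)) {s : ℝ}
    (hs : ∀ᶠ j : ℕ in atTop, Tendsto (fun k => ∫⁻ x in cube n (1 / ((j : ℝ) + 2)) (j + 2),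
        ‖F j k (s • proj x) - f (s • proj x)‖ₑ ^ 2 + ∑ i,
          ‖fderiv ℝ (F j k) (s • proj x) (Pi.single i 1) - Df i (s • proj x)‖ₑ ^ 2 ∂gammaPi α)
        atTop (𝓝 0))
    (hf2 : Integrable (fun x => f (s • proj x) ^ 2) (gammaPi α))
    (hD2 : Integrable (fun x => ∑ i, proj x i * Df i (s • proj x) ^ 2) (gammaPi α)) :
    (∑ i, α i) * ((∫ x, f (s • proj x) ^ 2 ∂gammaPi α) -
      (∫ x, f (s • proj x) ∂gammaPi α) ^ 2) ≤
      s ^ 2 * ∫ x, ∑ i, proj x i * (Df i (s • proj x) -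
          ∑ j, proj x j * Df j (s • proj x)) ^ 2 ∂gammaPi α := by
  have hprob := isProbabilityMeasure_gammaPi hα
  have : Nonempty (Fin n) := ⟨⟨0, hn⟩⟩
  have ha0 : 0 < ∑ i, α i := Finset.sum_pos (fun i _ => hα i) Finset.univ_nonempty
  set a := ∑ i, α i
  have hΓ := (Real.Gamma_pos_of_pos ha0).ne'
  have hΓ1 : Real.Gamma (a + 1) / Real.Gamma a = a := by
    rw [Real.Gamma_add_one ha0.ne', mul_div_cancel_right₀ _ hΓ]
  have hΓ2 : Real.Gamma (a + 2) / Real.Gamma a = (a + 1) * a := by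
    rw [show a + 2 = a + 1 + 1 by ring, Real.Gamma_add_one (by positivity),
      Real.Gamma_add_one ha0.ne', ← mul_assoc, mul_div_cancel_right₀ _ hΓ]
  have hcov := aecover_cube_exhaustion (ae_gammaPi_mem_orthant hα)
  have hpm : Measurable fun x : Fin n → ℝ => s • proj x := measurable_proj.const_smul s
  have hsm : Measurable fun y : Fin n → ℝ => s • y := measurable_const_smul s
  set φ : (Fin n → ℝ) → ℝ := fun y => ∑ i, y i * (Df i (s • y) - ∑ j, y j * Df j (s • y)) ^ 2
    with hφ
  have hφm : Measurable φ := by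
    have h1 : ∀ i, Measurable fun y : Fin n → ℝ => Df i (s • y) := fun i => (hDm i).comp hsm
    exact Finset.measurable_sum _ fun i _ => (measurable_pi_apply i).mul (((h1 i).sub
      (Finset.measurable_sum _ fun j _ => (measurable_pi_apply j).mul (h1 j))).pow_const 2)
  have hφi : Integrable (fun x => φ (proj x)) (gammaPi α) := by
    refine hD2.mono' (hφm.comp measurable_proj).aestronglyMeasurable ?_
    filter_upwards [ae_gammaPi_mem_orthant hα] with x hx
    rw [Real.norm_of_nonneg (Finset.sum_nonneg fun i _ =>
      mul_nonneg (proj_mem_orthant hn hx i).le (sq_nonneg _)), sum_mul_sub_sum_sq (sum_proj hn hx)]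
    exact sub_le_self _ (sq_nonneg _)
  have hf1 : Integrable (fun x => f (s • proj x)) (gammaPi α) :=
    ((memLp_two_iff_integrable_sq (hfm.comp hpm).aestronglyMeasurable).2 hf2).integrable
      (by norm_num)
  -- Direction and total mass are independent under the Gamma product, and the total mass has first
  -- moment `a` and second moment `a (a + 1)`.
  obtain ⟨i2, e2⟩ := sum_rpow_mul_proj_gammaPi hn hα (p := 2) (by norm_num)
    (φ := fun y => f (s • y) ^ 2) ((hfm.comp hsm).pow_const 2) hf2
  obtain ⟨i1, e1⟩ := sum_rpow_mul_proj_gammaPi hn hα (p := 1) (by norm_num)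
    (φ := fun y => f (s • y)) (hfm.comp hsm) hf1
  obtain ⟨i0, e0⟩ := sum_rpow_mul_proj_gammaPi hn hα (p := 1) (by norm_num)
    (φ := fun y => f (s • y) ^ 2 + s ^ 2 * φ y)
    (((hfm.comp hsm).pow_const 2).add (hφm.const_mul _)) (hf2.add (hφi.const_mul _))
  simp only [Real.rpow_two, Real.rpow_one, ← mul_pow] at i2 e2 i1 e1 i0 e0
  rw [integral_add hf2 (hφi.const_mul _), integral_const_mul] at e0
  rw [hΓ2] at e2
  rw [hΓ1] at e1 e0
  have h1 := tendsto_setIntegral_of_aecover hcov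
  have hle := le_of_tendsto_of_tendsto
    ((h1.mul (hcov.integral_tendsto_of_countably_generated i2)).sub
      ((hcov.integral_tendsto_of_countably_generated i1).pow 2))
    (h1.mul (hcov.integral_tendsto_of_countably_generated i0)) (hs.mono fun j hj =>
      angular_cube_variance_le_of_slice hn hα (by positivity) (one_div_lt_add_two j) hfm hDm
        (hF j) hj)
  -- The limit reads `a (a + 1) E f² - a² (E f)² ≤ a (E f² + s² E φ)`. The terms `a E f²` cancel,
  -- and a common factor `a` is divided out.
  rw [e2, e1, e0, one_mul, one_mul] at hle
  refine le_of_mul_le_mul_left ?_ ha0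
  linarith

end Angular

end MultivariateLiouville

/-! ### Combining radius and direction -/

namespace MultivariateLiouville
open Filter Topology ENNReal

section Polar

variable {n : ℕ} {α : Fin n → ℝ} {c : ℝ} {V : ℝ → ℝ}

/-- The function `τ` describes the weight: the energy is `τ(s)² ∑ yᵢ Dᵢ²`, and the constant is the
integral of `s² / τ²` divided by `a - 1`. Keeping `τ` free lets one argument give both weighted
inequalities. -/
theorem variance_le_of_map_polarMap (hn : 0 < n) (hα : ∀ i, 0 < α i) (ha : 1 < ∑ i, α i)
    [IsProbabilityMeasure (radial c (∑ i, α i) V)] {d : (Fin n → ℝ) → ℝ}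
    (hd : ContinuousOn d (orthant n)) (hd0 : ∀ x ∈ orthant n, 0 < d x) (hdm : Measurable d)
    (hmap : Measure.map polarMap ((radial c (∑ i, α i) V).prod (gammaPi α)) =
      (volume.restrict (orthant n)).withDensity fun x => ENNReal.ofReal (d x))
    {τ : ℝ → ℝ} (hτ : Continuous τ) (hτ0 : ∀ s, 0 < s → 0 < τ s)
    (hκ : Integrable (fun s => (τ s ^ 2 / s ^ 2)⁻¹) (radial c (∑ i, α i) V))
    (hP : ∀ A B, 0 < A → A < B →
      ∀ u h : ℝ → ℝ, (∀ x, 0 < x → HasDerivAt u (h x) x) → ContinuousOn h (Ioi 0) →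
      (radial c (∑ i, α i) V).real (Icc A B) *
          (∫ s in Icc A B, u s ^ 2 ∂radial c (∑ i, α i) V) -
        (∫ s in Icc A B, u s ∂radial c (∑ i, α i) V) ^ 2 ≤
      (∫ s in Icc A B, (τ s ^ 2 / s ^ 2)⁻¹ ∂radial c (∑ i, α i) V) / (∑ i, α i - 1) *
        ∫ s in Icc A B, τ s ^ 2 * h s ^ 2 ∂radial c (∑ i, α i) V)
    {f : (Fin n → ℝ) → ℝ} {Df : Fin n → (Fin n → ℝ) → ℝ} (hfm : Measurable f)
    (hDm : ∀ i, Measurable (Df i)) (hf : HasWeakGradientOn (orthant n) f Df)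
    (hf2 : Integrable (fun x => f x ^ 2)
      ((volume.restrict (orthant n)).withDensity fun x => ENNReal.ofReal (d x)))
    (hE : Integrable (fun x => τ (∑ i, x i) ^ 2 * ∑ i, proj x i * Df i x ^ 2)
      ((volume.restrict (orthant n)).withDensity fun x => ENNReal.ofReal (d x))) :
    (∫ x, f x ^ 2 ∂((volume.restrict (orthant n)).withDensity fun x => ENNReal.ofReal (d x))) -
      (∫ x, f x ∂((volume.restrict (orthant n)).withDensity fun x => ENNReal.ofReal (d x))) ^ 2 ≤
      (∫ s, (τ s ^ 2 / s ^ 2)⁻¹ ∂radial c (∑ i, α i) V) / (∑ i, α i - 1) *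
        ∫ x, τ (∑ i, x i) ^ 2 * ∑ i, proj x i * Df i x ^ 2
          ∂((volume.restrict (orthant n)).withDensity fun x => ENNReal.ofReal (d x)) := by
  have hprob := isProbabilityMeasure_gammaPi hα
  set a := ∑ i, α i with haα
  set nu := radial c a V with hnu
  have hpi : ∀ i, Measurable fun x : Fin n → ℝ => proj x i := fun i =>
    (measurable_pi_apply i).comp measurable_proj
  have hSm : Measurable fun x : Fin n → ℝ => ∑ i, x i := by fun_prop
  have hSc : Continuous fun x : Fin n → ℝ => ∑ i, x i := by fun_prop
  have hτm := hτ.measurable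
  have hEm : Measurable fun x => τ (∑ i, x i) ^ 2 * ∑ i, proj x i * Df i x ^ 2 :=
    ((hτm.comp hSm).pow_const 2).mul (Finset.measurable_sum _ fun i _ =>
      (hpi i).mul ((hDm i).pow_const 2))
  have hΩ : ∀ᵐ x ∂((volume.restrict (orthant n)).withDensity fun x => ENNReal.ofReal (d x)),
      x ∈ orthant n := (withDensity_absolutelyContinuous _ _).ae_le
        (ae_restrict_mem (isOpen_orthant n).measurableSet)
  -- local square integrability
  have hf2K : ∀ K ⊆ orthant n, IsCompact K → IntegrableOn (fun x => f x ^ 2) K := fun K hK hKc =>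
    integrableOn_of_integrable_density hd hd0 hdm hf2 hKc hK
  have hD2K : ∀ i, ∀ K ⊆ orthant n, IsCompact K → IntegrableOn (fun x => Df i x ^ 2) K := by
    intro i K hK hKc
    have h1 : Integrable (fun x => τ (∑ i, x i) ^ 2 * proj x i * Df i x ^ 2)
        ((volume.restrict (orthant n)).withDensity fun x => ENNReal.ofReal (d x)) := by
      refine hE.mono' ((((hτm.comp hSm).pow_const 2).mul (hpi i)).mul
        ((hDm i).pow_const 2)).aestronglyMeasurable ?_
      filter_upwards [hΩ] with x hx
      have hnn : ∀ j, 0 ≤ proj x j * Df j x ^ 2 := fun j =>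
        mul_nonneg (proj_mem_orthant hn hx j).le (sq_nonneg _)
      rw [mul_assoc, Real.norm_of_nonneg (mul_nonneg (sq_nonneg _) (hnn i))]
      exact mul_le_mul_of_nonneg_left
        (Finset.single_le_sum (f := fun j => proj x j * Df j x ^ 2) (fun j _ => hnn j)
          (Finset.mem_univ i)) (sq_nonneg _)
    have h2 := integrableOn_of_integrable_density hd hd0 hdm h1 hKc hK
    have hpos : ∀ x ∈ K, 0 < τ (∑ i, x i) ^ 2 * proj x i := fun x hx =>
      mul_pos (pow_pos (hτ0 _ (sum_pos_of_mem_orthant hn (hK hx))) 2)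
        (proj_mem_orthant hn (hK hx) i)
    have h3 : ContinuousOn (fun x : Fin n → ℝ => (τ (∑ i, x i) ^ 2 * proj x i)⁻¹) K :=
      (((hτ.comp hSc).pow 2).continuousOn.mul ((continuous_apply i).comp_continuousOn
        ((continuousOn_proj hn).mono hK))).inv₀ fun x hx => (hpos x hx).ne'
    refine (h2.continuousOn_mul h3 hKc).congr ?_
    filter_upwards [ae_restrict_mem hKc.measurableSet] with x hx
    exact inv_mul_cancel_left₀ (hpos x hx).ne' _
  -- approximation along slices
  choose F hF hFx hFs using fun j : ℕ => exists_approx_slices (nu := nu) (gam := gammaPi α) hn hd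
    hdm hmap hfm hDm hf hf2K hD2K (A := 1 / ((j : ℝ) + 2)) (B := j + 2) (by positivity)
  have hFx' : ∀ᵐ x ∂gammaPi α, ∀ᶠ j : ℕ in atTop,
      Tendsto (fun k => ∫⁻ s in Icc (1 / ((j : ℝ) + 2)) (j + 2),
        ‖F j k (s • proj x) - f (s • proj x)‖ₑ ^ 2 + ∑ i,
          ‖fderiv ℝ (F j k) (s • proj x) (Pi.single i 1) - Df i (s • proj x)‖ₑ ^ 2 ∂nu)
        atTop (𝓝 0) := by
    have h1 := ae_all_iff.2 fun j => (ae_restrict_iff' (measurableSet_cube n _ _)).1 (hFx j)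
    filter_upwards [h1, ae_gammaPi_mem_orthant hα] with x hx hxΩ
    exact (eventually_mem_cube_exhaustion hxΩ).mono fun j hj => hx j hj
  have hFs' : ∀ᵐ s ∂nu, ∀ᶠ j : ℕ in atTop,
      Tendsto (fun k => ∫⁻ x in cube n (1 / ((j : ℝ) + 2)) (j + 2),
        ‖F j k (s • proj x) - f (s • proj x)‖ₑ ^ 2 + ∑ i,
          ‖fderiv ℝ (F j k) (s • proj x) (Pi.single i 1) - Df i (s • proj x)‖ₑ ^ 2 ∂gammaPi α)
        atTop (𝓝 0) := by
    have h1 := ae_all_iff.2 fun j => (ae_restrict_iff' measurableSet_Icc).1 (hFs j)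
    filter_upwards [h1, ae_radial_pos (c := c) (a := a) (V := V)] with s hs hs0
    exact (eventually_mem_Icc_exhaustion hs0).mono fun j hj => hs j hj
  -- the product space
  have hpm := measurable_polarMap (n := n)
  have hfst : ∀ᵐ z ∂nu.prod (gammaPi α), 0 < z.1 :=
    Measure.quasiMeasurePreserving_fst.ae (ae_radial_pos (c := c) (a := a) (V := V))
  have hsnd : ∀ᵐ z ∂nu.prod (gammaPi α), z.2 ∈ orthant n :=
    Measure.quasiMeasurePreserving_snd.ae (ae_gammaPi_mem_orthant hα)
  rw [← hmap] at hf2 hE ⊢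
  rw [integrable_map_measure (hfm.pow_const 2).aestronglyMeasurable hpm.aemeasurable] at hf2
  rw [integrable_map_measure hEm.aestronglyMeasurable hpm.aemeasurable] at hE
  rw [integral_map hpm.aemeasurable (hfm.pow_const 2).aestronglyMeasurable,
    integral_map hpm.aemeasurable hfm.aestronglyMeasurable,
    integral_map hpm.aemeasurable hEm.aestronglyMeasurable]
  have hpz : ∀ i, Measurable fun z : ℝ × (Fin n → ℝ) => proj z.2 i := fun i =>
    (hpi i).comp measurable_snd
  have hDz : ∀ i, Measurable fun z : ℝ × (Fin n → ℝ) => Df i (z.1 • proj z.2) := fun i =>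
    (hDm i).comp hpm
  have hτz : Measurable fun z : ℝ × (Fin n → ℝ) => τ z.1 ^ 2 :=
    (hτm.comp measurable_fst).pow_const 2
  have hsumz : Measurable fun z : ℝ × (Fin n → ℝ) => ∑ i, proj z.2 i * Df i (z.1 • proj z.2) :=
    Finset.measurable_sum _ fun i _ => (hpz i).mul (hDz i)
  set T : ℝ × (Fin n → ℝ) → ℝ := fun z => τ z.1 ^ 2 * ∑ i, proj z.2 i *
    Df i (z.1 • proj z.2) ^ 2 with hT
  set T1 : ℝ × (Fin n → ℝ) → ℝ := fun z => τ z.1 ^ 2 *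
    (∑ i, proj z.2 i * Df i (z.1 • proj z.2)) ^ 2 with hT1
  set T2 : ℝ × (Fin n → ℝ) → ℝ := fun z => τ z.1 ^ 2 * ∑ i, proj z.2 i *
    (Df i (z.1 • proj z.2) - ∑ j, proj z.2 j * Df j (z.1 • proj z.2)) ^ 2 with hT2
  have hTE : (fun z => τ (∑ i, polarMap z i) ^ 2 * ∑ i, proj (polarMap z) i *
      Df i (polarMap z) ^ 2) =ᵐ[nu.prod (gammaPi α)] T := by
    filter_upwards [hfst, hsnd] with z hz1 hz2
    have h1 : ∑ i, polarMap z i = z.1 := sum_smul_proj hn hz2 z.1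
    have h2 : proj (polarMap z) = proj z.2 := by
      rw [polarMap, proj_smul hz1.ne', proj_proj hn hz2]
    rw [h1, h2]
    rfl
  -- The energy splits into its radial part `T1` and its angular part `T2`.
  have hTsum : T =ᵐ[nu.prod (gammaPi α)] T1 + T2 := by
    filter_upwards [hsnd] with z hz2
    simp only [hT, hT1, hT2, Pi.add_apply]
    rw [sum_mul_sub_sum_sq (sum_proj hn hz2)]
    ring
  have hT2nn : ∀ᵐ z ∂nu.prod (gammaPi α), 0 ≤ T2 z := by
    filter_upwards [hsnd] with z hz2
    exact mul_nonneg (sq_nonneg _) (Finset.sum_nonneg fun i _ =>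
      mul_nonneg (proj_mem_orthant hn hz2 i).le (sq_nonneg _))
  have hT1nn : ∀ z, 0 ≤ T1 z := fun z => mul_nonneg (sq_nonneg _) (sq_nonneg _)
  have hTi : Integrable T (nu.prod (gammaPi α)) := hE.congr hTE
  have hT1m : Measurable T1 := hτz.mul (hsumz.pow_const 2)
  have hT2m : Measurable T2 := hτz.mul (Finset.measurable_sum _ fun i _ =>
    (hpz i).mul (((hDz i).sub hsumz).pow_const 2))
  have hT1i : Integrable T1 (nu.prod (gammaPi α)) := by
    refine hTi.mono' hT1m.aestronglyMeasurable ?_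
    filter_upwards [hTsum, hT2nn] with z hz hz2
    rw [Real.norm_of_nonneg (hT1nn z), hz, Pi.add_apply]
    linarith
  have hT2i : Integrable T2 (nu.prod (gammaPi α)) := by
    refine hTi.mono' hT2m.aestronglyMeasurable ?_
    filter_upwards [hTsum, hT2nn] with z hz hz2
    rw [Real.norm_of_nonneg hz2, hz, Pi.add_apply]
    linarith [hT1nn z]
  have hwpos : ∀ᵐ s ∂nu, 0 < τ s ^ 2 / s ^ 2 := by
    filter_upwards [ae_radial_pos (c := c) (a := a) (V := V)] with s hs
    exact div_pos (pow_pos (hτ0 s hs) 2) (pow_pos hs 2)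
  set K := ∫ s, (τ s ^ 2 / s ^ 2)⁻¹ ∂nu with hK
  have hK0 : 0 ≤ K := integral_nonneg_of_ae (hwpos.mono fun s hs => (inv_pos.2 hs).le)
  have ha0 : 0 < a := by linarith
  have ha1 : 0 < a - 1 := by linarith
  -- The weight `τ² / s²` is chosen so that the factor `s²` in the angular inequality becomes `τ²`,
  -- the weight in the energy. Cauchy-Schwarz then produces the same integral `K` as the radial
  -- inequality.
  have key := variance_prod_le (lam := nu) (tau := gammaPi α) (F := fun z => f (polarMap z))
    (w := fun s => τ s ^ 2 / s ^ 2) (p := fun x => K / (a - 1) * ∫ s, T1 (s, x) ∂nu)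
    (r := fun s => 1 / a * ∫ x, T2 (s, x) ∂gammaPi α)
    (hfm.comp hpm).aestronglyMeasurable hf2 (hT1i.integral_prod_right.const_mul _) ?_
    ((hτm.pow_const 2).div (measurable_id.pow_const 2)).aestronglyMeasurable hwpos hκ
    (hT2i.integral_prod_left.const_mul _) ?_
  · rw [integral_const_mul, integral_const_mul, ← integral_prod_symm _ hT1i,
      ← integral_prod _ hT2i] at key
    refine key.trans ?_
    rw [integral_congr_ae hTE, integral_congr_ae hTsum, integral_add' hT1i hT2i, mul_add]
    refine add_le_add le_rfl ?_
    rw [← mul_assoc, mul_one_div]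
    refine mul_le_mul_of_nonneg_right ?_ (integral_nonneg_of_ae hT2nn)
    -- The angular part carries `1 / a`; it is weakened to the radial `1 / (a - 1)`.
    exact div_le_div_of_nonneg_left hK0 ha1 (by linarith)
  · filter_upwards [hFx', hf2.prod_left_ae, hT1i.prod_left_ae] with x h1 h2 h3
    exact radial_variance_le_of_slice hτ hκ hP hfm hDm hF h1 h2 h3
  · filter_upwards [hFs', hf2.prod_right_ae, hTi.prod_right_ae,
      ae_radial_pos (c := c) (a := a) (V := V)] with s h1 h2 h3 hs
    have hτs : 0 < τ s ^ 2 := pow_pos (hτ0 s hs) 2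
    have h4 : Integrable (fun x => ∑ i, proj x i * Df i (s • proj x) ^ 2) (gammaPi α) := by
      refine (h3.const_mul (τ s ^ 2)⁻¹).congr (ae_of_all _ fun x => ?_)
      exact inv_mul_cancel_left₀ hτs.ne' _
    have h5 := angular_variance_le_of_slice hn hα hfm hDm hF h1 h2 h4
    rw [← haα] at h5
    have h6 : ∫ x, T2 (s, x) ∂gammaPi α = τ s ^ 2 * ∫ x, ∑ i, proj x i * (Df i (s • proj x) -
          ∑ j, proj x j * Df j (s • proj x)) ^ 2 ∂gammaPi α := by
      rw [← integral_const_mul]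
    simp only [h6]
    have h7 := mul_le_mul_of_nonneg_left h5 (by positivity : 0 ≤ τ s ^ 2 / (s ^ 2 * a))
    refine (le_of_eq ?_).trans (h7.trans (le_of_eq ?_))
    · simp only [polarMap]
      field_simp
    · field_simp

end Polar

end MultivariateLiouville

/-! ### Second moments and the polar form of a Liouville law -/

namespace MultivariateLiouville
open Filter Topology ENNReal

section Tail

/-- A convex function which is not antitone grows at least linearly. -/
theorem exists_linear_le_of_convexOn {V : ℝ → ℝ} (hV : ConvexOn ℝ (Ioi 0) V) {p t : ℝ} (hp : 0 < p)
    (hpt : p < t) (hlt : V p < V t) :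
    ∃ m C : ℝ, 0 < m ∧ ∀ s, t < s → C + m * s ≤ V s := by
  have hm : 0 < (V t - V p) / (t - p) := div_pos (by linarith) (by linarith)
  refine ⟨(V t - V p) / (t - p), V t - (V t - V p) / (t - p) * t, hm, fun s hs => ?_⟩
  have := hV.slope_mono_adjacent (mem_Ioi.2 hp) (mem_Ioi.2 (hp.trans (hpt.trans hs))) hpt hs
  rw [le_div_iff₀ (by linarith)] at this
  linarith

/-- A finite total mass forces `V` to increase somewhere, and convexity then gives linear growth, so
the density decays exponentially. Near the origin `s²` is bounded. -/
theorem integrable_sq_radial {c a : ℝ} {V : ℝ → ℝ} (hc : 0 < c) (ha : 1 < a) (hVm : Measurable V)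
    (hV : ConvexOn ℝ (Ioi 0) V) [IsFiniteMeasure (radial c a V)] :
    Integrable (fun s => s ^ 2) (radial c a V) := by
  have hwm : Measurable fun s => ENNReal.ofReal (c * (s ^ (a - 1) * Real.exp (-V s))) := by
    fun_prop
  have h1 : Integrable (fun _ => (1:ℝ)) (radial c a V) := integrable_const 1
  rw [radial, integrable_withDensity_iff_integrable_smul' hwm (ae_of_all _ fun _ => ofReal_lt_top)]
    at h1 ⊢
  have hdens : ∀ s, 0 < s → (ENNReal.ofReal (c * (s ^ (a - 1) * Real.exp (-V s)))).toReal =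
      c * (s ^ (a - 1) * Real.exp (-V s)) := fun s hs => ENNReal.toReal_ofReal (by positivity)
  have hq : IntegrableOn (fun s => s ^ (a - 1) * Real.exp (-V s)) (Ioi 0) := by
    refine (h1.const_mul c⁻¹).congr ?_
    filter_upwards [ae_restrict_mem measurableSet_Ioi] with s hs
    rw [hdens s hs, smul_eq_mul, mul_one, inv_mul_cancel_left₀ hc.ne']
  suffices h : IntegrableOn (fun s => s ^ 2 * (s ^ (a - 1) * Real.exp (-V s))) (Ioi 0) by
    refine (h.const_mul c).congr ?_
    filter_upwards [ae_restrict_mem measurableSet_Ioi] with s hs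
    rw [hdens s hs, smul_eq_mul]
    ring
  obtain ⟨p, t, hp, hpt, hlt⟩ : ∃ p t, 0 < p ∧ p < t ∧ V p < V t := by
    by_contra! hcon
    -- If `V` never increased, the density would be at least a positive constant beyond `1`, because
    -- `s ^ (a - 1) ≥ 1` there.
    have h2 : IntegrableOn (fun _ => Real.exp (-V 1)) (Ioi (1:ℝ)) := by
      refine (hq.mono_set (Ioi_subset_Ioi zero_le_one)).mono' aestronglyMeasurable_const ?_
      filter_upwards [ae_restrict_mem measurableSet_Ioi] with s hs
      have hs' : 1 < s := hs
      rw [Real.norm_of_nonneg (Real.exp_pos _).le]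
      have e1 : 1 ≤ s ^ (a - 1) := Real.one_le_rpow hs'.le (by linarith)
      have e2 : Real.exp (-V 1) ≤ Real.exp (-V s) :=
        Real.exp_le_exp.2 (neg_le_neg (hcon 1 s one_pos hs'))
      nlinarith [Real.exp_pos (-V s)]
    rw [integrableOn_const_iff] at h2
    simp [Real.exp_ne_zero] at h2
  obtain ⟨m, C, hm, hC⟩ := exists_linear_le_of_convexOn hV hp hpt hlt
  have ht : 0 < t := hp.trans hpt
  have hmeas : Measurable fun s => s ^ 2 * (s ^ (a - 1) * Real.exp (-V s)) := by fun_prop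
  rw [← Ioc_union_Ioi_eq_Ioi ht.le]
  refine IntegrableOn.union ?_ ?_
  · refine ((hq.mono_set Ioc_subset_Ioi_self).const_mul (t ^ 2)).mono'
      hmeas.aestronglyMeasurable ?_
    filter_upwards [ae_restrict_mem measurableSet_Ioc] with s hs
    have hs0 := hs.1
    rw [Real.norm_of_nonneg (by positivity)]
    gcongr
    exact hs.2
  · have h3 := integrableOn_rpow_mul_exp_neg_mul_rpow (p := 1) (s := a + 1) (b := m)
      (by linarith) one_pos hm
    refine ((h3.mono_set (Ioi_subset_Ioi ht.le)).const_mul (Real.exp (-C))).mono'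
      hmeas.aestronglyMeasurable ?_
    filter_upwards [ae_restrict_mem measurableSet_Ioi] with s hs
    have hs0 : 0 < s := ht.trans hs
    rw [Real.norm_of_nonneg (by positivity), Real.rpow_one, ← mul_assoc, ← Real.rpow_two,
      ← Real.rpow_add hs0, show 2 + (a - 1) = a + 1 by ring, mul_left_comm, ← Real.exp_add]
    refine mul_le_mul_of_nonneg_left (Real.exp_le_exp.2 ?_) (by positivity)
    linarith [hC s hs]

end Tail

section Main

variable {n : ℕ} {α : Fin n → ℝ}

theorem HasWeakGradientOn.congr_ae {Ω : Set (Fin n → ℝ)} {f f' : (Fin n → ℝ) → ℝ}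
    {Df Df' : Fin n → (Fin n → ℝ) → ℝ} (h : HasWeakGradientOn Ω f Df)
    (hf : f =ᵐ[volume.restrict Ω] f') (hD : ∀ i, Df i =ᵐ[volume.restrict Ω] Df' i) :
    HasWeakGradientOn Ω f' Df' := by
  have key : ∀ u u' : (Fin n → ℝ) → ℝ, u =ᵐ[volume.restrict Ω] u' →
      LocallyIntegrableOn u Ω volume → LocallyIntegrableOn u' Ω volume := fun u u' huu hu x hx => by
    obtain ⟨s, hs, hus⟩ := hu x hx
    exact ⟨s ∩ Ω, inter_mem hs self_mem_nhdsWithin, (hus.mono_set inter_subset_left).congr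
      (ae_mono (Measure.restrict_mono_set _ inter_subset_right) huu)⟩
  refine ⟨key _ _ hf h.locallyIntegrableOn, fun i => key _ _ (hD i) (h.locallyIntegrableOn_grad i),
    fun φ h1 h2 h3 i => ?_⟩
  have := h.integral_eq φ h1 h2 h3 i
  have e1 := integral_congr_ae (hf.mul (ae_eq_refl fun x => fderiv ℝ φ x (Pi.single i 1)))
  have e2 := integral_congr_ae ((hD i).mul (ae_eq_refl φ))
  simp only [Pi.mul_apply] at e1 e2
  rw [← e1, ← e2, this]

/-- Polar decomposition of a Liouville distribution. -/
theorem IsLiouville.exists_polar {g : ℝ → ℝ} {μ : Measure (Fin n → ℝ)} (hμ : IsLiouville α g μ)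
    (hg : LogConcaveOn (Ioi 0) g) (hn : 0 < n) :
    ∃ (c : ℝ) (V : ℝ → ℝ) (d : (Fin n → ℝ) → ℝ), 0 < c ∧ Measurable V ∧ ConvexOn ℝ (Ioi 0) V ∧
      IsProbabilityMeasure (radial c (∑ i, α i) V) ∧ ContinuousOn d (orthant n) ∧
      (∀ x ∈ orthant n, 0 < d x) ∧ Measurable d ∧
      μ = ((volume.restrict (orthant n)).withDensity fun x => ENNReal.ofReal (d x)) ∧
      Measure.map polarMap ((radial c (∑ i, α i) V).prod (gammaPi α)) = μ := by
  obtain ⟨hprobμ, hα, -, -, Z, hZ, hμZ⟩ := hμ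
  obtain ⟨V₀, hV₀, hgV₀⟩ := hg
  have : Nonempty (Fin n) := ⟨⟨0, hn⟩⟩
  have ha0 : 0 < ∑ i, α i := Finset.sum_pos (fun i _ => hα i) Finset.univ_nonempty
  have hprob := isProbabilityMeasure_gammaPi hα
  -- The potential is set to zero off the half-line to obtain a function measurable on the whole
  -- line; convexity makes it continuous inside.
  set V : ℝ → ℝ := (Ioi 0).indicator V₀ with hVdef
  have hVV : EqOn V₀ V (Ioi 0) := fun s hs => (indicator_of_mem hs _).symm
  have hV : ConvexOn ℝ (Ioi 0) V := hV₀.congr hVV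
  have hVc : ContinuousOn V (Ioi 0) := hV.continuousOn isOpen_Ioi
  have hVm : Measurable V := by
    classical
    rw [hVdef, ← piecewise_eq_indicator]
    exact (hV₀.continuousOn isOpen_Ioi).measurable_piecewise continuousOn_const measurableSet_Ioi
  set d : (Fin n → ℝ) → ℝ := fun x => Z⁻¹ * powProd α x * Real.exp (-V (∑ x_1, x x_1)) with hd
  have hmap := map_polarMap hn hα hZ (c := (∏ i, Real.Gamma (α i)) / (Real.Gamma (∑ i, α i) * Z))
    rfl hVm
  have hμd : μ = (volume.restrict (orthant n)).withDensity fun x => ENNReal.ofReal (d x) := by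
    rw [hμZ]
    refine withDensity_congr_ae ?_
    filter_upwards [ae_restrict_mem (isOpen_orthant n).measurableSet] with x hx
    have hs := sum_pos_of_mem_orthant hn hx
    rw [hgV₀ _ hs, hVV hs]
    rfl
  have hΓ : 0 < ∏ i, Real.Gamma (α i) := Finset.prod_pos fun i _ => Real.Gamma_pos_of_pos (hα i)
  refine ⟨_, V, d, div_pos hΓ (mul_pos (Real.Gamma_pos_of_pos ha0) hZ), hVm, hV, ⟨?_⟩, ?_, ?_, ?_,
    hμd, hmap.trans hμd.symm⟩
  · have h1 := congrArg (fun m => m univ) (hmap.trans hμd.symm)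
    rw [measure_univ (μ := μ), Measure.map_apply measurable_polarMap MeasurableSet.univ, preimage_univ,
      ← univ_prod_univ, Measure.prod_prod, measure_univ (μ := gammaPi α), mul_one] at h1
    exact h1
  · refine (continuousOn_const.mul (continuousOn_finsetProd _ fun i _ => ?_)).mul
      (Real.continuous_exp.comp_continuousOn (hVc.comp (by fun_prop) fun x hx =>
        sum_pos_of_mem_orthant hn hx).neg)
    exact (continuous_apply i).continuousOn.rpow_const fun x hx => Or.inl (hx i).ne'
  · intro x hx
    have := powProd_pos (α := α) hx
    positivity
  · exact ((measurable_powProd).const_mul _).mul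
      (Real.measurable_exp.comp (hVm.comp (by fun_prop)).neg)

/-- Identifies the law of `s` under `μ` with the radial factor, which transfers the second moment
between the two. -/
theorem map_sum_of_map_polarMap (hn : 0 < n) (hα : ∀ i, 0 < α i) {μ : Measure (Fin n → ℝ)}
    {nu : Measure ℝ} [SFinite nu] (hmap : Measure.map polarMap (nu.prod (gammaPi α)) = μ) :
    Measure.map (fun x : Fin n → ℝ => ∑ i, x i) μ = nu := by
  have hprob := isProbabilityMeasure_gammaPi hα
  rw [← hmap, Measure.map_map (by fun_prop) measurable_polarMap]
  have h : ((fun x : Fin n → ℝ => ∑ i, x i) ∘ polarMap) =ᵐ[nu.prod (gammaPi α)] Prod.fst := by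
    filter_upwards [Measure.quasiMeasurePreserving_snd.ae (ae_gammaPi_mem_orthant hα)] with z hz
    exact sum_smul_proj hn hz z.1
  rw [Measure.map_congr h, Measure.map_fst_prod, measure_univ, one_smul]

theorem normSq_diagonal (w v : Fin n → ℝ) :
    normSq (Matrix.diagonal w) v = ∑ i, w i * v i ^ 2 := by
  simp only [normSq, Matrix.mulVec_diagonal, dotProduct]
  exact Finset.sum_congr rfl fun i _ => by ring

end Main

end MultivariateLiouville

/-! ### The three inequalities -/

namespace MultivariateLiouville
open Filter Topology ENNReal

section Liouville

variable {n : ℕ} {α : Fin n → ℝ}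

/-- The weighted variance inequality for a measure in polar form, without measurability
assumptions on the function. -/
theorem variance_le_of_polar (hn : 0 < n) (hα : ∀ i, 0 < α i) (ha : 1 < ∑ i, α i) {c : ℝ}
    {V : ℝ → ℝ} [IsProbabilityMeasure (radial c (∑ i, α i) V)] {d : (Fin n → ℝ) → ℝ}
    (hd : ContinuousOn d (orthant n)) (hd0 : ∀ x ∈ orthant n, 0 < d x) (hdm : Measurable d)
    {μ : Measure (Fin n → ℝ)}
    (hμ : μ = (volume.restrict (orthant n)).withDensity fun x => ENNReal.ofReal (d x))
    (hmap : Measure.map polarMap ((radial c (∑ i, α i) V).prod (gammaPi α)) = μ)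
    {τ : ℝ → ℝ} (hτ : Continuous τ) (hτ0 : ∀ s, 0 < s → 0 < τ s)
    (hκ : Integrable (fun s => (τ s ^ 2 / s ^ 2)⁻¹) (radial c (∑ i, α i) V))
    (hP : ∀ A B, 0 < A → A < B →
      ∀ u h : ℝ → ℝ, (∀ x, 0 < x → HasDerivAt u (h x) x) → ContinuousOn h (Ioi 0) →
      (radial c (∑ i, α i) V).real (Icc A B) *
          (∫ s in Icc A B, u s ^ 2 ∂radial c (∑ i, α i) V) -
        (∫ s in Icc A B, u s ∂radial c (∑ i, α i) V) ^ 2 ≤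
      (∫ s in Icc A B, (τ s ^ 2 / s ^ 2)⁻¹ ∂radial c (∑ i, α i) V) / (∑ i, α i - 1) *
        ∫ s in Icc A B, τ s ^ 2 * h s ^ 2 ∂radial c (∑ i, α i) V)
    {f : (Fin n → ℝ) → ℝ} {Df : Fin n → (Fin n → ℝ) → ℝ} (hf : HasWeakGradientOn (orthant n) f Df)
    (hf2 : MemLp f 2 μ) {E : (Fin n → ℝ) → ℝ} (hEi : Integrable E μ)
    (hE : ∀ x ∈ orthant n, E x = τ (∑ i, x i) ^ 2 * ∑ i, proj x i * Df i x ^ 2) :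
    (∫ x, f x ^ 2 ∂μ) - (∫ x, f x ∂μ) ^ 2 ≤
      (∫ s, (τ s ^ 2 / s ^ 2)⁻¹ ∂radial c (∑ i, α i) V) / (∑ i, α i - 1) * ∫ x, E x ∂μ := by
  have hac : μ ≪ volume.restrict (orthant n) := hμ ▸ withDensity_absolutelyContinuous _ _
  have hΩ : ∀ᵐ x ∂μ, x ∈ orthant n :=
    hac.ae_le (ae_restrict_mem (isOpen_orthant n).measurableSet)
  -- Local integrability gives measurability only up to null sets, so `f` and its weak derivatives
  -- are replaced by measurable representatives.
  have hfm : AEStronglyMeasurable f (volume.restrict (orthant n)) :=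
    hf.locallyIntegrableOn.aestronglyMeasurable
  have hDm : ∀ i, AEStronglyMeasurable (Df i) (volume.restrict (orthant n)) := fun i =>
    (hf.locallyIntegrableOn_grad i).aestronglyMeasurable
  have hfe : f =ᵐ[μ] hfm.mk f := hac.ae_eq hfm.ae_eq_mk
  have hDe : ∀ᵐ x ∂μ, ∀ i, Df i x = (hDm i).mk (Df i) x :=
    ae_all_iff.2 fun i => hac.ae_eq (hDm i).ae_eq_mk
  have hEe : E =ᵐ[μ] fun x => τ (∑ i, x i) ^ 2 * ∑ i, proj x i * (hDm i).mk (Df i) x ^ 2 := by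
    filter_upwards [hΩ, hDe] with x hx hx'
    rw [hE x hx]
    simp only [hx']
  have hfe2 : (fun x => f x ^ 2) =ᵐ[μ] fun x => hfm.mk f x ^ 2 := hfe.pow_const 2
  rw [integral_congr_ae hfe, integral_congr_ae hfe2, integral_congr_ae hEe]
  have h1 := hf2.integrable_sq.congr hfe2
  have h2 := hEi.congr hEe
  rw [hμ] at h1 h2 ⊢
  exact variance_le_of_map_polarMap hn hα ha hd hd0 hdm (hmap.trans hμ) hτ hτ0 hκ hP
    hfm.stronglyMeasurable_mk.measurable (fun i => (hDm i).stronglyMeasurable_mk.measurable)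
    (hf.congr_ae hfm.ae_eq_mk fun i => (hDm i).ae_eq_mk) h1 h2

theorem normSq_one (v : Fin n → ℝ) : normSq 1 v = ∑ i, v i ^ 2 := by
  rw [← Matrix.diagonal_one, normSq_diagonal]
  simp

theorem integral_sum_sq_pos (hn : 0 < n) {μ : Measure (Fin n → ℝ)} [IsProbabilityMeasure μ]
    (hΩ : ∀ᵐ x ∂μ, x ∈ orthant n) (hi : Integrable (fun x : Fin n → ℝ => (∑ j, x j) ^ 2) μ) :
    0 < ∫ x : Fin n → ℝ, (∑ j, x j) ^ 2 ∂μ := by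
  have hnn : (0 : (Fin n → ℝ) → ℝ) ≤ fun x => (∑ j, x j) ^ 2 := fun x => sq_nonneg _
  refine (integral_nonneg hnn).lt_of_ne fun h => ?_
  have h1 := (integral_eq_zero_iff_of_nonneg hnn hi).1 h.symm
  obtain ⟨x, hx, hx0⟩ := (hΩ.and h1).exists
  exact (pow_pos (sum_pos_of_mem_orthant hn hx) 2).ne' hx0

end Liouville

end MultivariateLiouville

open MultivariateLiouville in
theorem mainTheorem2 {n : ℕ} (α : Fin n → ℝ) (g : ℝ → ℝ)
    (μ : MeasureTheory.Measure (Fin n → ℝ))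
    (hμ : MultivariateLiouville.IsLiouville α g μ)
    (hg : MultivariateLiouville.LogConcaveOn (Set.Ioi 0) g)
    (hα : 1 < ∑ i, α i) :
    -- the first weighted inequality, with energy `∫ s(x) ∑ᵢ xᵢ (∂ᵢf)² dμ`
    MultivariateLiouville.WeightedPoincare (MultivariateLiouville.orthant n) μ
      (fun x => Matrix.diagonal fun i => (∑ j, x j) * x i)
      (1 / ((∑ i, α i) - 1)) ∧
    -- the constant `∫ s² dμ` is finite
    MeasureTheory.Integrable (fun x : Fin n → ℝ => (∑ j, x j) ^ 2) μ ∧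
    -- the second weighted inequality, with energy `∫ ∑ᵢ (xᵢ / s(x)) (∂ᵢf)² dμ`
    MultivariateLiouville.WeightedPoincare (MultivariateLiouville.orthant n) μ
      (fun x => Matrix.diagonal fun i => x i / ∑ j, x j)
      (1 / ((∑ i, α i) - 1) * ∫ x, (∑ j, x j) ^ 2 ∂μ) ∧
    -- the resulting classical Poincaré inequality, with energy `∫ ∑ᵢ (∂ᵢf)² dμ`
    MultivariateLiouville.WeightedPoincare (MultivariateLiouville.orthant n) μ
      (fun _ => 1)
      (1 / ((∑ i, α i) - 1) * ∫ x, (∑ j, x j) ^ 2 ∂μ) := by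
  have hn : 0 < n := by
    rcases Nat.eq_zero_or_pos n with rfl | h
    · norm_num at hα
    · exact h
  have hprobμ := hμ.isProbabilityMeasure
  have hαp := hμ.param_pos
  have ha1 : 0 < ∑ i, α i - 1 := by linarith
  obtain ⟨c, V, d, hc, hVm, hV, hprob, hd, hd0, hdm, hμd, hmap⟩ := hμ.exists_polar hg hn
  have hac : μ ≪ volume.restrict (orthant n) := hμd ▸ withDensity_absolutelyContinuous _ _
  have hΩ : ∀ᵐ x ∂μ, x ∈ orthant n :=
    hac.ae_le (ae_restrict_mem (isOpen_orthant n).measurableSet)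
  have hsum := map_sum_of_map_polarMap hn hαp hmap
  have hSm : Measurable fun x : Fin n → ℝ => ∑ i, x i := by fun_prop
  have hsqm : AEStronglyMeasurable (fun s : ℝ => s ^ 2) (Measure.map (fun x : Fin n → ℝ =>
      ∑ i, x i) μ) := by fun_prop
  have hsq : Integrable (fun s => s ^ 2) (radial c (∑ i, α i) V) :=
    integrable_sq_radial hc hα hVm hV
  have hs2 : Integrable (fun x : Fin n → ℝ => (∑ j, x j) ^ 2) μ := by
    rw [← hsum] at hsq
    exact (integrable_map_measure hsqm hSm.aemeasurable).1 hsq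
  have hK : ∫ x : Fin n → ℝ, (∑ j, x j) ^ 2 ∂μ = ∫ s, s ^ 2 ∂radial c (∑ i, α i) V := by
    rw [← integral_map hSm.aemeasurable hsqm, hsum]
  have hCpos : 0 < 1 / ((∑ i, α i) - 1) * ∫ x : Fin n → ℝ, (∑ j, x j) ^ 2 ∂μ :=
    mul_pos (one_div_pos.2 ha1) (integral_sum_sq_pos hn hΩ hs2)
  have hsecond : WeightedPoincare (orthant n) μ (fun x => Matrix.diagonal fun i => x i / ∑ j, x j)
      (1 / ((∑ i, α i) - 1) * ∫ x, (∑ j, x j) ^ 2 ∂μ) := by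
    refine ⟨fun x hx => Matrix.PosDef.diagonal fun i =>
      div_pos (hx i) (sum_pos_of_mem_orthant hn hx), hCpos, fun f Df hf2 hf hE => ?_⟩
    -- With `τ = 1` the energy has weights `xᵢ / s` and the constant contains `∫ s²`.
    have h := variance_le_of_polar (τ := fun _ => 1) hn hαp hα hd hd0 hdm hμd hmap
      continuous_const (fun _ _ => one_pos) (by simpa only [one_pow, one_div, inv_inv] using hsq)
      (fun A B hA hAB u h hu hh => by
        simpa only [one_pow, one_div, inv_inv, one_mul] using radial_variance_le hc.le hA hAB hα hV hu hh)
      hf hf2 hE fun x hx => by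
        rw [normSq_diagonal, one_pow, one_mul]
        refine Finset.sum_congr rfl fun i _ => ?_
        rw [proj, Pi.smul_apply, smul_eq_mul, div_eq_inv_mul]
    simp only [one_pow, one_div, inv_inv] at h
    rwa [← hK, ← one_div_mul_eq_div] at h
  refine ⟨⟨fun x hx => Matrix.PosDef.diagonal fun i =>
    mul_pos (sum_pos_of_mem_orthant hn hx) (hx i), one_div_pos.2 ha1, fun f Df hf2 hf hE => ?_⟩,
    hs2, hsecond, ⟨fun x _ => Matrix.PosDef.one, hCpos, fun f Df hf2 hf hE => ?_⟩⟩
  · have hid : ∀ s : ℝ, 0 < s → (s ^ 2 / s ^ 2)⁻¹ = 1 := fun s hs => by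
      rw [div_self (pow_pos hs 2).ne', inv_one]
    have hae : (fun s : ℝ => (s ^ 2 / s ^ 2)⁻¹) =ᵐ[radial c (∑ i, α i) V] fun _ => 1 :=
      ae_radial_pos.mono hid
    -- With `τ = s` the energy has weights `s² xᵢ / s = s xᵢ`, and the integral in the constant is
    -- the total mass `1`.
    have h := variance_le_of_polar (τ := fun s => s) hn hαp hα hd hd0 hdm hμd hmap
      continuous_id (fun _ hs => hs) ((integrable_const 1).congr hae.symm)
      (fun A B hA hAB u h hu hh => by
        rw [setIntegral_congr_fun measurableSet_Icc fun s hs => hid s (hA.trans_le hs.1)]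
        exact radial_variance_le_sq hc.le hA hAB hα hV hu hh)
      hf hf2 hE fun x hx => by
        rw [normSq_diagonal, Finset.mul_sum]
        refine Finset.sum_congr rfl fun i _ => ?_
        rw [← sum_mul_proj hn hx i]
        ring
    rw [integral_congr_ae hae] at h
    simpa using h
  · have hDm : ∀ i, AEStronglyMeasurable (Df i) μ := fun i =>
      (hf.locallyIntegrableOn_grad i).aestronglyMeasurable.mono_ac hac
    have hle : ∀ x ∈ orthant n, normSq (Matrix.diagonal fun i => x i / ∑ j, x j)
        (fun i => Df i x) ≤ normSq 1 (fun i => Df i x) := fun x hx => by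
      rw [normSq_diagonal, normSq_one]
      refine Finset.sum_le_sum fun i _ => mul_le_of_le_one_left (sq_nonneg _) ?_
      rw [div_eq_inv_mul]
      exact proj_apply_le_one hn hx i
    -- Finite classical energy implies finite weighted energy because `xᵢ / s ≤ 1`; so the second
    -- inequality applies to the same functions.
    have hi : Integrable (fun x => normSq (Matrix.diagonal fun i => x i / ∑ j, x j)
        (fun i => Df i x)) μ := by
      refine hE.mono' ?_ ?_
      · simp only [normSq_diagonal]
        exact Finset.aestronglyMeasurable_fun_sum _ fun i _ =>
          ((measurable_pi_apply i).div hSm).aestronglyMeasurable.mul ((hDm i).pow 2)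
      · filter_upwards [hΩ] with x hx
        rw [Real.norm_of_nonneg]
        · exact hle x hx
        · rw [normSq_diagonal]
          exact Finset.sum_nonneg fun i _ => mul_nonneg
            (div_nonneg (hx i).le (sum_pos_of_mem_orthant hn hx).le) (sq_nonneg _)
    refine (hsecond.variance_le f Df hf2 hf hi).trans
      (mul_le_mul_of_nonneg_left (integral_mono_ae hi hE ?_) hCpos.le)
    filter_upwards [hΩ] with x hx using hle x hx
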